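/- Let $c,u,s\ge 0$ be integers, let $B$ be a real $c\times c$ matrix all of whose (complex) eigenvalues have zero real part, and let $A$ be a real $(u+s)\times(u+s)$ matrix having, counted with algebraic multiplicity, $u$ eigenvalues with positive real part and $s$ eigenvalues with negative real part. Let $E^u(A),E^s(A)\subset\mathbb R^{u+s}$ be the unstable and stable subspaces of $A$ (the real vectors in the complex span of the generalized eigenvectors for eigenvalues with positive, respectively negative, real part). Then there is $\delta>0$, depending only on $A$ and $B$, such that the following holds for all bounded $g:\mathbb R^c\times\mathbb R^{u+s}\to\mathbb R^c$ and $h:\mathbb R^c\times\mathbb R^{u+s}\to\mathbb R^{u+s}$ with $g(0,0)=0$, $h(0,0)=0$ and $$|g(x_1,y_1)-g(x_2,y_2)|\le c_1|x_1-x_2|+c_2|y_1-y_2|,\qquad |h(x_1,y_1)-h(x_2,y_2)|\le d_1|x_1-x_2|+d_2|y_1-y_2|$$ for some constants $c_1,c_2,d_1,d_2\le\delta$. The system $$\dot x=Bx+g(x,y),\qquad \dot y=Ay+h(x,y)$$ has a global flow $S^t$ on $\mathbb R^n=\mathbb R^c\times\mathbb R^{u+s}$. Let $U^tf=f\circ S^t$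 be its Koopman operators, and call $f\neq0$ a (generalized) eigenfunction at $\mu\in\mathbb C$ if $(\frac{d}{dt}-\mu)^mf=0$ along the flow for some $m$ (that is, there are continuous $f=f_0,f_1,\dots,f_m=0$ with $\frac{d}{dt}U^tf_i=\mu U^tf_i+U^tf_{i+1}$ for $i<m$). Define * the center-stable set $W^{cs}$: all $z$ such that $|S^tz|=O(e^{\eta t})$ as $t\to+\infty$ for every $\eta>0$; * the center-unstable set $W^{cu}$: all $z$ such that $|S^tz|=O(e^{\eta|t|})$ as $t\to-\infty$ for every $\eta>0$; * the center set $W^c=W^{cs}\cap W^{cu}$. There exist a complex Jordan normal form $J$ of $A$, with the $u$ diagonal entries of positive real part first, and linearly independent continuous functions $s_1,\dots,s_{u+s}:\mathbb R^n\to\mathbb C$ such that $\dot{\mathbf s}=J\mathbf s$ along the flow and each $s_j$ is a (generalized) Koopman eigenfunction at $J_{jj}$. Thus $s_1,\dots,s_u$ are unstable ($\operatorname{Re}J_{jj}>0$) and $s_{u+1},\dots,s_{u+s}$ are stable ($\operatorname{Re}J_{jj}<0$). Moreover $$\{s_1=\dots=s_u=0\}=W^{cs},\qquad \{s_1=\dots=s_{u+s}=0\}=W^c,\qquad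 \{s_{u+1}=\dots=s_{u+s}=0\}=W^{cu},$$ and these sets are global invariant manifolds, unique in the following sense. Let $$(P,Q)=(\mathbb R^c\times E^s(A),\ 0\times E^u(A)),\quad (\mathbb R^c\times 0,\ 0\times\mathbb R^{u+s}),\quad (\mathbb R^c\times E^u(A),\ 0\times E^s(A))$$ for $W=W^{cs},W^c,W^{cu}$ respectively. Then $\mathbb R^n=P\oplus Q$, the set $W$ contains $0$, is invariant under $S^t$ for all $t\in\mathbb R$, and is the graph $\{p+\varphi(p):p\in P\}$ of a bounded Lipschitz map $\varphi:P\to Q$. It is the only invariant set that is the graph of a map $\psi:P\to Q$ with at most linear growth, $|\psi(p)|\le C(1+|p|)$. Finally, if $g$ and $h$ are differentiable at $0$ with zero derivative (so that $B$ and $A$ are the blocks of the linearization at $0$), then each of the three manifolds is tangent to its subspace $P$ at $0$: its $\varphi$ is differentiable at $0$ with $\varphi(0)=0$ and $D\varphi(0)=0$. -/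

import Mathlib

open scoped NNReal Topology
open Filter Asymptotics

/-- The state space `ℝ^c × ℝ^n` of pairs `(x, y)`. -/
abbrev StateSpace (c n : ℕ) : Type := EuclideanSpace ℝ (Fin c) × EuclideanSpace ℝ (Fin n)

section Spectrum

variable {n : ℕ}

/-- The complex eigenvalues of a real matrix, repeated according to algebraic multiplicity. -/
noncomputable def complexEigenvalues (A : Matrix (Fin n) (Fin n) ℝ) : Multiset ℂ :=
  (A.map Complex.ofReal).charpoly.roots

/-- The inclusion `ℝ^n → ℂ^n`, as a real linear map. -/
noncomputable def complexify (n : ℕ) : EuclideanSpace ℝ (Fin n) →ₗ[ℝ] (Fin n → ℂ) where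
  toFun y := fun i => ((y i : ℝ) : ℂ)
  map_add' y z := by ext i; simp
  map_smul' a y := by ext i; simp

/-- The real vectors in the complex span of all generalized eigenvectors of `A` whose eigenvalue
lies in `Λ`. -/
noncomputable def spectralSubspace (A : Matrix (Fin n) (Fin n) ℝ) (Λ : Set ℂ) :
    Submodule ℝ (EuclideanSpace ℝ (Fin n)) :=
  ((⨆ μ ∈ Λ, Module.End.maxGenEigenspace
      (Matrix.toLin' (A.map Complex.ofReal)) μ).restrictScalars ℝ).comap (complexify n)

/-- The stable subspace of `A`. -/
noncomputable def stableSubspace (A : Matrix (Fin n) (Fin n) ℝ) :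
    Submodule ℝ (EuclideanSpace ℝ (Fin n)) :=
  spectralSubspace A {μ | μ.re < 0}

/-- The unstable subspace of `A`. -/
noncomputable def unstableSubspace (A : Matrix (Fin n) (Fin n) ℝ) :
    Submodule ℝ (EuclideanSpace ℝ (Fin n)) :=
  spectralSubspace A {μ | 0 < μ.re}

/-- `J` is in complex Jordan normal form: outside the diagonal, the only nonzero entries are
ones directly above the diagonal, joining equal diagonal entries. -/
def IsJordanMatrix (J : Matrix (Fin n) (Fin n) ℂ) : Prop :=
  ∀ j k : Fin n, j ≠ k →
    J j k = 0 ∨ ((k : ℕ) = (j : ℕ) + 1 ∧ J j k = 1 ∧ J j j = J k k)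

/-- `J` is a complex Jordan normal form of the real matrix `A`. -/
def IsJordanFormOf (J : Matrix (Fin n) (Fin n) ℂ) (A : Matrix (Fin n) (Fin n) ℝ) : Prop :=
  IsJordanMatrix J ∧
    ∃ V : GL (Fin n) ℂ,
      J = (↑V⁻¹ : Matrix (Fin n) (Fin n) ℂ) * A.map Complex.ofReal * (↑V : Matrix _ _ ℂ)

end Spectrum

section Dynamics

variable {E : Type*} [NormedAddCommGroup E] [NormedSpace ℝ E]

/-- `S` is the (global) flow of `ż = F(z)`. -/
def IsFlowOf (F : E → E) (S : ℝ → E → E) : Prop :=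
  ∀ z : E, S 0 z = z ∧ ∀ t : ℝ, HasDerivAt (fun τ => S τ z) (F (S t z)) t

/-- The Koopman operators `U^t f = f ∘ S^t`. -/
def koopman (S : ℝ → E → E) (t : ℝ) (f : E → ℂ) : E → ℂ := fun z => f (S t z)

/-- `(d/dt - μ)^m f = 0`, where `d/dt` is differentiation along the flow, for a continuous
observable `f` for which all the derivatives involved exist and are continuous. Thus
`d/dt f = μ f + f₁`, `d/dt f₁ = μ f₁ + f₂`, and so on, with `f_m = 0`. -/
def KoopmanNilpotent (S : ℝ → E → E) (μ : ℂ) : ℕ → (E → ℂ) → Prop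
  | 0, f => f = 0
  | m + 1, f => Continuous f ∧ ∃ f₁ : E → ℂ, KoopmanNilpotent S μ m f₁ ∧
      ∀ (z : E) (t : ℝ),
        HasDerivAt (fun τ => koopman S τ f z) (μ * koopman S t f z + koopman S t f₁ z) t

/-- `f` is a (generalized) eigenfunction of the Koopman operator at the eigenvalue `μ`. -/
def IsGeneralizedKoopmanEigenfunction (S : ℝ → E → E) (μ : ℂ) (f : E → ℂ) : Prop :=
  f ≠ 0 ∧ ∃ m : ℕ, KoopmanNilpotent S μ m f

/-- The center-stable set of the origin: the points whose forward orbit does not grow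
at any exponential rate. -/
def centerStableSet (S : ℝ → E → E) : Set E :=
  {z | ∀ η : ℝ, 0 < η → (fun t : ℝ => S t z) =O[atTop] fun t : ℝ => Real.exp (η * t)}

/-- The center-unstable set of the origin: the points whose backward orbit does not grow
at any exponential rate. -/
def centerUnstableSet (S : ℝ → E → E) : Set E :=
  {z | ∀ η : ℝ, 0 < η → (fun t : ℝ => S t z) =O[atBot] fun t : ℝ => Real.exp (-(η * t))}

/-- The center set of the origin: the points whose full orbit does not grow at any exponential
rate, forward or backward. -/
def centerSet (S : ℝ → E → E) : Set E := centerStableSet S ∩ centerUnstableSet S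

/-- The set `{p + φ(p) : p ∈ P}`. -/
def graphOver {P Q : Submodule ℝ E} (φ : P → Q) : Set E :=
  Set.range fun p : P => (p : E) + (φ p : E)

/-- Invariance under the flow, for all times. -/
def IsFlowInvariant (S : ℝ → E → E) (W : Set E) : Prop :=
  ∀ t : ℝ, ∀ z ∈ W, S t z ∈ W

/-- `W` is the global invariant manifold through the origin modelled on `P`: it is invariant and
is the graph of a bounded Lipschitz map from `P` to the complement `Q`, and it is the only
invariant graph of a map from `P` to `Q` with at most linear growth. -/
structure IsUniqueGlobalInvariantManifold (S : ℝ → E → E) (P Q : Submodule ℝ E)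
    (W : Set E) : Prop where
  isCompl : IsCompl P Q
  zero_mem : (0 : E) ∈ W
  invariant : IsFlowInvariant S W
  graph : ∃ φ : P → Q, (∃ K : ℝ≥0, LipschitzWith K φ) ∧ (∃ M : ℝ, ∀ p, ‖φ p‖ ≤ M) ∧
    W = graphOver φ
  unique : ∀ ψ : P → Q, (∃ C : ℝ, ∀ p, ‖ψ p‖ ≤ C * (1 + ‖p‖)) →
    IsFlowInvariant S (graphOver ψ) → graphOver ψ = W

/-- `W` is the graph of a map from `P` to `Q` that is differentiable at the origin, vanishes
there and has derivative zero there: `W` is tangent to `P` at the origin. -/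
def IsTangentAtZero (P Q : Submodule ℝ E) (W : Set E) : Prop :=
  ∃ φ : P → Q, W = graphOver φ ∧ φ 0 = 0 ∧ HasFDerivAt φ (0 : P →L[ℝ] Q) 0

end Dynamics

section System

variable {c n : ℕ}

/-- The right-hand side `(B x + g(x, y), A y + h(x, y))`. -/
noncomputable def vectorField (B : Matrix (Fin c) (Fin c) ℝ) (A : Matrix (Fin n) (Fin n) ℝ)
    (g : StateSpace c n → EuclideanSpace ℝ (Fin c))
    (h : StateSpace c n → EuclideanSpace ℝ (Fin n)) (z : StateSpace c n) : StateSpace c n :=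
  (Matrix.toEuclideanCLM (𝕜 := ℝ) B z.1 + g z, Matrix.toEuclideanCLM (𝕜 := ℝ) A z.2 + h z)

/-- The subspace of all `(x, y)` with `x` arbitrary and `y ∈ Y`. -/
def withCenter (c : ℕ) {n : ℕ} (Y : Submodule ℝ (EuclideanSpace ℝ (Fin n))) :
    Submodule ℝ (StateSpace c n) :=
  (⊤ : Submodule ℝ (EuclideanSpace ℝ (Fin c))).prod Y

/-- The subspace of all `(0, y)` with `y ∈ Y`. -/
def withoutCenter (c : ℕ) {n : ℕ} (Y : Submodule ℝ (EuclideanSpace ℝ (Fin n))) :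
    Submodule ℝ (StateSpace c n) :=
  (⊥ : Submodule ℝ (EuclideanSpace ℝ (Fin c))).prod Y

/-- `|f(x₁,y₁) - f(x₂,y₂)| ≤ a |x₁ - x₂| + b |y₁ - y₂|`. -/
def LipschitzPair {G : Type*} [NormedAddCommGroup G] (f : StateSpace c n → G) (a b : ℝ) : Prop :=
  ∀ z₁ z₂ : StateSpace c n, ‖f z₁ - f z₂‖ ≤ a * ‖z₁.1 - z₂.1‖ + b * ‖z₁.2 - z₂.2‖

end System

/-! Write the system as `ż = L z + N z`, with `L = (B, A)` and `N = (g, h)` bounded and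
`ε`-Lipschitz. The spectrum gives exponential dichotomies: `L` grows at most like `exp (a t)`, for
any `a > 0`, on the center-stable part (projection `p`), and its backward flow decays like `exp (-b
t)` on the unstable part (projection `q`).

Since `N` is bounded, the limit `σ z = lim exp (-t L) q (S^t z)` exists for every `z`
(`straightened`). It satisfies `σ (S^t z) = exp (t L) σ z` and stays within bounded distance of `q
z`. An orbit growing at a rate below `b` must have `σ z = 0`. Conversely, if `σ z = 0`, variation of
constants becomes the Lyapunov-Perron equation, whose terms grow arbitrarily slowly. Hence `{σ = 0}`
is exactly the center-stable set (`centerStableSet_eq`).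

For small `ε` a contraction in a weighted sup norm at a rate inside the spectral gap gives a point
of `{σ = 0}` over each value of `p` (`exists_slow_solution`). Comparing two orbits in the same norm
bounds their `q`-difference by a small multiple of their `p`-difference (`norm_q_sub_le`). So `{σ =
0}` is a Lipschitz graph, and it is bounded because `σ - q` is. On an invariant graph of linear
growth the `q`-component is dominated by the `p`-component, which always grows slowly; such a graph
lies in `{σ = 0}` and, being a graph over the same space, equals it. Tangency follows by feeding the
smallness of `N` near `0` into the same integral equation.

Reversing time gives the center-unstable set. The center set is the intersection of the two graphs,
found by a second contraction (`SlowManifold.inter`).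

The eigenfunctions are the coordinates of the unstable and stable straightenings in a Jordan basis
adapted to the two spectral subspaces. They linearize the flow exactly, and each differs by a
bounded amount from a linear coordinate, which makes them independent. -/

/-! ### Linear flows of bounded operators -/

section LinearFlow

variable {E F : Type*} [NormedAddCommGroup E] [NormedSpace ℝ E]
  [NormedAddCommGroup F] [NormedSpace ℝ F]

/-- The linear flow `exp (t L)`. -/
noncomputable def expL (L : E →L[ℝ] E) (t : ℝ) : E →L[ℝ] E := NormedSpace.exp (t • L)

theorem expL_zero (L : E →L[ℝ] E) : expL L 0 = 1 := by
  simp [expL]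

theorem expL_zero_apply (L : E →L[ℝ] E) (z : E) : expL L 0 z = z := by
  rw [expL_zero]; rfl

theorem expL_neg (L : E →L[ℝ] E) (t : ℝ) : expL (-L) t = expL L (-t) := by
  simp [expL]

variable [CompleteSpace E] [CompleteSpace F]

theorem expL_add (L : E →L[ℝ] E) (s t : ℝ) : expL L (s + t) = expL L s * expL L t := by
  have : NormedAlgebra ℚ (E →L[ℝ] E) := NormedAlgebra.restrictScalars ℚ ℝ _
  rw [expL, add_smul, NormedSpace.exp_add_of_commute]
  · rfl
  · exact ((Commute.refl L).smul_left s).smul_right t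

theorem expL_add_apply (L : E →L[ℝ] E) (s t : ℝ) (z : E) :
    expL L (s + t) z = expL L s (expL L t z) := by
  rw [expL_add]; rfl

theorem expL_neg_apply_expL (L : E →L[ℝ] E) (t : ℝ) (z : E) :
    expL L (-t) (expL L t z) = z := by
  rw [← expL_add_apply, neg_add_cancel, expL_zero_apply]

theorem expL_apply_expL_neg (L : E →L[ℝ] E) (t : ℝ) (z : E) :
    expL L t (expL L (-t) z) = z := by
  rw [← expL_add_apply, add_neg_cancel, expL_zero_apply]

theorem hasDerivAt_expL (L : E →L[ℝ] E) (t : ℝ) : HasDerivAt (expL L) (L * expL L t) t :=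
  hasDerivAt_exp_smul_const' (𝕂 := ℝ) L t

theorem continuous_expL (L : E →L[ℝ] E) : Continuous (expL L) :=
  continuous_iff_continuousAt.2 fun t => (hasDerivAt_expL L t).continuousAt

theorem hasDerivAt_expL_apply (L : E →L[ℝ] E) {w : ℝ → E} {w' : E} {t : ℝ}
    (hw : HasDerivAt w w' t) :
    HasDerivAt (fun τ => expL L τ (w τ)) (L (expL L t (w t)) + expL L t w') t :=
  (hasDerivAt_expL L t).clm_apply hw

/-- A linear map that intertwines two operators intertwines their linear flows. -/
theorem expL_intertwine {L : E →L[ℝ] E} {M : F →L[ℝ] F} (f : E →L[ℝ] F)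
    (h : ∀ z, f (L z) = M (f z)) (t : ℝ) (z : E) : f (expL L t z) = expL M t (f z) := by
  -- The curve `exp (-τ M) f (exp (τ L) z)` has zero derivative, hence keeps its initial value `f
  -- z`.
  have key : ∀ τ, HasDerivAt (fun τ => expL M (-τ) (f (expL L τ z))) 0 τ := by
    intro τ
    have h1 : HasDerivAt (fun τ => f (expL L τ z)) (f (L (expL L τ z))) τ := by
      have := hasDerivAt_expL_apply L (hasDerivAt_const τ z)
      simpa [Function.comp_def] using f.hasFDerivAt.comp_hasDerivAt τ this
    have h2 := hasDerivAt_expL_apply (-M) h1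
    simp only [expL_neg] at h2
    convert h2 using 1
    rw [h, ← mul_apply_eq_comp (expL M (-τ)) M]
    have hc : Commute M (expL M (-τ)) := by
      have := (((Commute.refl M).smul_right (-τ)).exp_right)
      exact this
    rw [← hc.eq]
    simp
  have hconst := is_const_of_deriv_eq_zero (fun τ => (key τ).differentiableAt)
    (fun τ => (key τ).deriv) t 0
  have h3 : expL M (-t) (f (expL L t z)) = f z := by
    simpa [expL_zero_apply] using hconst
  rw [← h3, expL_apply_expL_neg]

theorem expL_comm_apply {L q : E →L[ℝ] E} (h : ∀ z, q (L z) = L (q z)) (t : ℝ) (z : E) :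
    q (expL L t z) = expL L t (q z) :=
  expL_intertwine q h t z

theorem norm_expL_apply_le (L : E →L[ℝ] E) {t : ℝ} (ht : 0 ≤ t) (z : E) :
    ‖expL L t z‖ ≤ Real.exp (‖L‖ * t) * ‖z‖ := by
  have hd : ∀ τ, HasDerivAt (fun τ => expL L τ z) (L (expL L τ z)) τ := fun τ => by
    simpa using hasDerivAt_expL_apply L (hasDerivAt_const τ z)
  have := norm_le_gronwallBound_of_norm_deriv_right_le (f := fun τ => expL L τ z)
    (f' := fun τ => L (expL L τ z)) (δ := ‖z‖) (K := ‖L‖) (ε := 0) (a := 0) (b := t)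
    (fun τ _ => (hd τ).continuousAt.continuousWithinAt)
    (fun τ _ => (hd τ).hasDerivWithinAt) (by simp [expL_zero_apply])
    (fun τ _ => by simpa using L.le_opNorm _) t ⟨ht, le_rfl⟩
  rw [gronwallBound_ε0] at this
  simpa [mul_comm] using this

end LinearFlow

/-! ### Exponential dichotomies and the Lyapunov-Perron operator -/

section Dichotomy

open MeasureTheory Set

variable {E : Type*} [NormedAddCommGroup E] [NormedSpace ℝ E]

/-- An exponential dichotomy for `ż = L z`: the complementary spectral projections `p` and `q`
with forward growth at most `exp (a t)` on the range of `p` and backward decay at least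
`exp (-b t)` on the range of `q`. -/
structure ExpDichotomy (L p q : E →L[ℝ] E) (K a b : ℝ) : Prop where
  nonneg : 0 ≤ K
  add_apply : ∀ z, p z + q z = z
  pq : ∀ z, p (q z) = 0
  qp : ∀ z, q (p z) = 0
  comm : ∀ z, q (L z) = L (q z)
  bound_p : ∀ t, 0 ≤ t → ∀ z, ‖expL L t (p z)‖ ≤ K * Real.exp (a * t) * ‖z‖
  bound_q : ∀ t, 0 ≤ t → ∀ z, ‖expL L (-t) (q z)‖ ≤ K * Real.exp (-b * t) * ‖z‖

/-- The solution operator of `ż = L z + f` that singles out the solution of slow forward growth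
whose initial value has no component in the range of `p`. -/
noncomputable def lpOp (L q : E →L[ℝ] E) (f : ℝ → E) (t : ℝ) : E :=
  expL L t ((∫ τ in (0:ℝ)..t, expL L (-τ) (f τ)) - ∫ τ in Ioi (0:ℝ), expL L (-τ) (q (f τ)))

namespace ExpDichotomy

variable {L p q : E →L[ℝ] E} {K a b γ C : ℝ}

theorem q_idem (D : ExpDichotomy L p q K a b) (z : E) : q (q z) = q z := by
  simpa [D.pq] using D.add_apply (q z)

theorem p_idem (D : ExpDichotomy L p q K a b) (z : E) : p (p z) = p z := by
  simpa [D.qp] using D.add_apply (p z)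

theorem p_eq (D : ExpDichotomy L p q K a b) (z : E) : p z = z - q z :=
  eq_sub_of_add_eq (D.add_apply z)

theorem norm_integrand_le (D : ExpDichotomy L p q K a b) {f : ℝ → E}
    (hC : ∀ τ, 0 ≤ τ → ‖f τ‖ ≤ C * Real.exp (γ * τ)) {τ : ℝ} (hτ : 0 ≤ τ) :
    ‖expL L (-τ) (q (f τ))‖ ≤ K * C * Real.exp ((γ - b) * τ) := by
  calc _ ≤ K * Real.exp (-b * τ) * ‖f τ‖ := D.bound_q τ hτ _
    _ ≤ K * Real.exp (-b * τ) * (C * Real.exp (γ * τ)) := by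
        have := D.nonneg
        gcongr
        exact hC τ hτ
    _ = K * C * Real.exp ((γ - b) * τ) := by
        rw [show (γ - b) * τ = -b * τ + γ * τ by ring, Real.exp_add]; ring

variable [CompleteSpace E]

theorem q_expL (D : ExpDichotomy L p q K a b) (t : ℝ) (z : E) :
    q (expL L t z) = expL L t (q z) := expL_comm_apply D.comm t z

theorem p_expL (D : ExpDichotomy L p q K a b) (t : ℝ) (z : E) :
    p (expL L t z) = expL L t (p z) := by
  rw [D.p_eq, D.p_eq, D.q_expL, map_sub]

theorem continuous_integrand (L : E →L[ℝ] E) {f : ℝ → E} (hf : Continuous f) :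
    Continuous fun τ => expL L (-τ) (f τ) :=
  ((continuous_expL L).comp continuous_neg).clm_apply hf

theorem integrableOn_integrand (D : ExpDichotomy L p q K a b) {f : ℝ → E} (hf : Continuous f)
    (hC : ∀ τ, 0 ≤ τ → ‖f τ‖ ≤ C * Real.exp (γ * τ)) (hγ : γ < b) {t : ℝ} (ht : 0 ≤ t) :
    IntegrableOn (fun τ => expL L (-τ) (q (f τ))) (Ioi t) := by
  refine Integrable.mono' ((integrableOn_exp_mul_Ioi (sub_neg.2 hγ) t).const_mul (K * C))
    (continuous_integrand L (q.continuous.comp hf)).aestronglyMeasurable ?_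
  refine (ae_restrict_iff' measurableSet_Ioi).2 (Eventually.of_forall fun τ hτ => ?_)
  exact D.norm_integrand_le hC (ht.trans (le_of_lt hτ))

/-- Moving `exp (t L)` inside leaves the backward flow over time `τ - t`; its decay at rate `b`
beats the growth `γ < b` of `f`, and the exponential integrates to `1 / (b - γ)`. -/
theorem norm_tail_le (D : ExpDichotomy L p q K a b) {f : ℝ → E} (hf : Continuous f)
    (hC : ∀ τ, 0 ≤ τ → ‖f τ‖ ≤ C * Real.exp (γ * τ)) (hγ : γ < b) {t : ℝ} (ht : 0 ≤ t) :
    ‖expL L t (∫ τ in Ioi t, expL L (-τ) (q (f τ)))‖ ≤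
      K * C * (1 / (b - γ)) * Real.exp (γ * t) := by
  rw [← ContinuousLinearMap.integral_comp_comm _ (D.integrableOn_integrand hf hC hγ ht)]
  have hg : IntegrableOn (fun τ => K * C * Real.exp (b * t) * Real.exp ((γ - b) * τ)) (Ioi t) :=
    (integrableOn_exp_mul_Ioi (sub_neg.2 hγ) t).const_mul _
  refine (norm_integral_le_of_norm_le hg ?_).trans_eq ?_
  · refine (ae_restrict_iff' measurableSet_Ioi).2 (Eventually.of_forall fun τ hτ => ?_)
    have hτ' : t < τ := hτ
    rw [← expL_add_apply, show t + -τ = -(τ - t) by ring]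
    refine (D.bound_q (τ - t) (by linarith) _).trans ?_
    calc _ ≤ K * Real.exp (-b * (τ - t)) * (C * Real.exp (γ * τ)) := by
          have := D.nonneg
          gcongr
          exact hC τ (by linarith)
      _ = _ := by
          rw [show -b * (τ - t) = b * t + -b * τ by ring,
            show (γ - b) * τ = -b * τ + γ * τ by ring, Real.exp_add, Real.exp_add]
          ring
  · rw [integral_const_mul, integral_exp_mul_Ioi (sub_neg.2 hγ)]
    rw [show γ * t = b * t + (γ - b) * t by ring, Real.exp_add, ← neg_sub b γ, neg_div_neg_eq]
    ring

/-- The counterpart of `norm_tail_le` on the slow side: convergence comes from `a < γ`. -/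
theorem norm_head_le (D : ExpDichotomy L p q K a b) {f : ℝ → E} (hf : Continuous f) (h0 : 0 ≤ C)
    (hC : ∀ τ, 0 ≤ τ → ‖f τ‖ ≤ C * Real.exp (γ * τ)) (hγ : a < γ) {t : ℝ} (ht : 0 ≤ t) :
    ‖expL L t (∫ τ in (0:ℝ)..t, expL L (-τ) (p (f τ)))‖ ≤
      K * C * (1 / (γ - a)) * Real.exp (γ * t) := by
  have hK := D.nonneg
  rw [← ContinuousLinearMap.intervalIntegral_comp_comm _
    ((continuous_integrand L (f := fun τ => p (f τ)) (p.continuous.comp hf)).intervalIntegrable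
      _ _)]
  have hg : Continuous (fun τ => K * C * Real.exp (a * t) * Real.exp ((γ - a) * τ)) := by
    fun_prop
  refine (intervalIntegral.norm_integral_le_of_norm_le ht ?_
    (hg.intervalIntegrable _ _)).trans ?_
  · refine Eventually.of_forall fun τ hτ => ?_
    rw [← expL_add_apply, show t + -τ = t - τ by ring]
    refine (D.bound_p (t - τ) (by linarith [hτ.2]) _).trans ?_
    calc _ ≤ K * Real.exp (a * (t - τ)) * (C * Real.exp (γ * τ)) := by
          gcongr
          exact hC τ hτ.1.le
      _ = _ := by
          rw [show a * (t - τ) = a * t + -a * τ by ring,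
            show (γ - a) * τ = -a * τ + γ * τ by ring, Real.exp_add, Real.exp_add]
          ring
  · rw [intervalIntegral.integral_const_mul,
      intervalIntegral.integral_comp_mul_left _ (sub_pos.2 hγ).ne', integral_exp]
    have h1 : 0 < γ - a := sub_pos.2 hγ
    rw [show γ * t = a * t + (γ - a) * t by ring, Real.exp_add]
    simp only [mul_zero, Real.exp_zero, smul_eq_mul, one_div]
    have : K * C * Real.exp (a * t) * ((γ - a)⁻¹ * (Real.exp ((γ - a) * t) - 1)) ≤
        K * C * Real.exp (a * t) * ((γ - a)⁻¹ * Real.exp ((γ - a) * t)) := by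
      gcongr
      linarith
    linarith

/-- For a rate `γ` in the gap `(a, b)` the operator preserves growth `exp (γ t)`. Its gain is what
must be beaten by the Lipschitz constant of the nonlinearity. -/
theorem norm_lpOp_le (D : ExpDichotomy L p q K a b) {f : ℝ → E} (hf : Continuous f) (h0 : 0 ≤ C)
    (hC : ∀ τ, 0 ≤ τ → ‖f τ‖ ≤ C * Real.exp (γ * τ)) (ha : a < γ) (hb : γ < b)
    {t : ℝ} (ht : 0 ≤ t) :
    ‖lpOp L q f t‖ ≤ K * (1 / (γ - a) + 1 / (b - γ)) * C * Real.exp (γ * t) := by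
  -- The `q`-part of the integral over `[0, t]` cancels against the full half-line integral, leaving
  -- the `p`-part of the past and the `q`-part of the future.
  have hsplit : lpOp L q f t = expL L t (∫ τ in (0:ℝ)..t, expL L (-τ) (p (f τ))) -
      expL L t (∫ τ in Ioi t, expL L (-τ) (q (f τ))) := by
    rw [lpOp, ← map_sub, ← intervalIntegral.integral_interval_add_Ioi
      (D.integrableOn_integrand hf hC hb le_rfl) (D.integrableOn_integrand hf hC hb ht)]
    congr 1
    rw [← sub_sub, ← intervalIntegral.integral_sub]
    · simp only [D.p_eq, map_sub]
    · exact (continuous_integrand L hf).intervalIntegrable _ _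
    · exact (continuous_integrand L (q.continuous.comp hf)).intervalIntegrable _ _
  rw [hsplit]
  refine (norm_sub_le _ _).trans ?_
  have h1 := D.norm_head_le hf h0 hC ha ht
  have h2 := D.norm_tail_le hf hC hb ht
  calc _ ≤ _ := add_le_add h1 h2
    _ = _ := by ring

/-- The half-line integral is independent of `t`, so it only alters the initial value and neither
its convergence nor the dichotomy matters here. -/
theorem hasDerivAt_lpOp (L q : E →L[ℝ] E) {f : ℝ → E} (hf : Continuous f) (t : ℝ) :
    HasDerivAt (lpOp L q f) (L (lpOp L q f t) + f t) t := by
  have h := ((continuous_integrand L hf).integral_hasStrictDerivAt 0 t).hasDerivAt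
  have h2 := hasDerivAt_expL_apply L
    (h.sub_const (∫ τ in Ioi (0:ℝ), expL L (-τ) (q (f τ))))
  rw [expL_apply_expL_neg] at h2
  exact h2

theorem lpOp_sub (D : ExpDichotomy L p q K a b) {f g : ℝ → E} {C' : ℝ} (hf : Continuous f)
    (hg : Continuous g)
    (hC : ∀ τ, 0 ≤ τ → ‖f τ‖ ≤ C * Real.exp (γ * τ))
    (hC' : ∀ τ, 0 ≤ τ → ‖g τ‖ ≤ C' * Real.exp (γ * τ)) (hγ : γ < b) (t : ℝ) :
    lpOp L q f t - lpOp L q g t = lpOp L q (fun τ => f τ - g τ) t := by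
  simp only [lpOp, map_sub]
  rw [intervalIntegral.integral_sub ((continuous_integrand L hf).intervalIntegrable _ _)
    ((continuous_integrand L hg).intervalIntegrable _ _),
    integral_sub (D.integrableOn_integrand hf hC hγ le_rfl)
      (D.integrableOn_integrand hg hC' hγ le_rfl)]
  simp only [map_sub]
  abel

theorem p_lpOp_zero (D : ExpDichotomy L p q K a b) {f : ℝ → E} (hf : Continuous f)
    (hC : ∀ τ, 0 ≤ τ → ‖f τ‖ ≤ C * Real.exp (γ * τ)) (hγ : γ < b) :
    p (lpOp L q f 0) = 0 := by
  have h : ∀ τ, p (expL L (-τ) (q (f τ))) = 0 := fun τ => by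
    rw [D.p_expL, D.pq, map_zero]
  rw [lpOp, D.p_expL, intervalIntegral.integral_same, zero_sub, map_neg,
    ← ContinuousLinearMap.integral_comp_comm p (D.integrableOn_integrand hf hC hγ le_rfl)]
  simp [h]

end ExpDichotomy

end Dichotomy

/-! ### Slow solutions by contraction, and the global flow -/

section LyapunovPerron

open MeasureTheory Set

variable {E : Type*} [NormedAddCommGroup E] [NormedSpace ℝ E]
  {L p q : E →L[ℝ] E} {K a b γ ε : ℝ} {N : E → E}

theorem continuous_of_norm_sub_le (hN : ∀ z w, ‖N z - N w‖ ≤ ε * ‖z - w‖) : Continuous N := by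
  refine (LipschitzWith.of_dist_le' (K := ε) fun z w => ?_).continuous
  simpa [dist_eq_norm] using hN z w

theorem norm_le_of_norm_sub_le (hN : ∀ z w, ‖N z - N w‖ ≤ ε * ‖z - w‖) (hN0 : N 0 = 0) (z : E) :
    ‖N z‖ ≤ ε * ‖z‖ := by
  simpa [hN0] using hN z 0

variable [CompleteSpace E]

namespace ExpDichotomy

theorem norm_expL_of_p_eq (D : ExpDichotomy L p q K a b) (ha : a < γ) {z : E} (hz : p z = z)
    {t : ℝ} (ht : 0 ≤ t) : ‖expL L t z‖ ≤ K * ‖z‖ * Real.exp (γ * t) := by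
  have := D.bound_p t ht z
  rw [hz] at this
  have hK := D.nonneg
  calc _ ≤ _ := this
    _ ≤ K * Real.exp (γ * t) * ‖z‖ := by gcongr
    _ = _ := by ring

/-- For every initial value in the range of `p` there is a forward solution of slow growth. -/
theorem exists_slow_solution (D : ExpDichotomy L p q K a b) (ha : a < γ) (hb : γ < b)
    (hε : 0 ≤ ε) (hN : ∀ z w, ‖N z - N w‖ ≤ ε * ‖z - w‖) (hN0 : N 0 = 0)
    (hκ : K * (1 / (γ - a) + 1 / (b - γ)) * ε ≤ 1 / 2) {x : E} (hx : p x = x) :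
    ∃ Z : ℝ → E, (∀ t, 0 ≤ t → HasDerivAt Z (L (Z t) + N (Z t)) t) ∧
      (∃ C, ∀ t, 0 ≤ t → ‖Z t‖ ≤ C * Real.exp (γ * t)) ∧ p (Z 0) = x := by
  have hK := D.nonneg
  have hNc := continuous_of_norm_sub_le hN
  -- The unknown is `ζ t = exp (-γ t) Z t`, a bounded function. Clamping time at `0` lets it live on
  -- all of `ℝ` while only `t ≥ 0` matters.
  let f : BoundedContinuousFunction ℝ E → ℝ → E :=
    fun ζ τ => N (Real.exp (γ * max τ 0) • ζ (max τ 0))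
  have hf : ∀ ζ, Continuous (f ζ) := fun ζ => hNc.comp (by fun_prop)
  have hfsub : ∀ ζ ξ τ, 0 ≤ τ → ‖f ζ τ - f ξ τ‖ ≤ ε * dist ζ ξ * Real.exp (γ * τ) := by
    intro ζ ξ τ hτ
    refine (hN _ _).trans ?_
    rw [← smul_sub, norm_smul, Real.norm_of_nonneg (Real.exp_pos _).le, max_eq_left hτ]
    have h : ‖ζ τ - ξ τ‖ ≤ dist ζ ξ := by
      rw [← dist_eq_norm]
      exact BoundedContinuousFunction.dist_coe_le_dist τ
    calc _ ≤ ε * (Real.exp (γ * τ) * dist ζ ξ) := by gcongr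
      _ = _ := by ring
  have hf0 : ∀ ζ τ, 0 ≤ τ → ‖f ζ τ‖ ≤ ε * ‖ζ‖ * Real.exp (γ * τ) := by
    intro ζ τ hτ
    have := hfsub ζ 0 τ hτ
    simpa [f, hN0] using this
  let Tf : BoundedContinuousFunction ℝ E → ℝ → E := fun ζ t => expL L t x + lpOp L q (f ζ) t
  have hTd : ∀ ζ t, HasDerivAt (Tf ζ) (L (Tf ζ t) + f ζ t) t := by
    intro ζ t
    have h1 := hasDerivAt_expL_apply L (hasDerivAt_const t x)
    have h2 := h1.add (hasDerivAt_lpOp L q (hf ζ) t)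
    refine h2.congr_deriv ?_
    simp only [Tf, map_add, map_zero]
    abel
  have hTc : ∀ ζ, Continuous (Tf ζ) := fun ζ =>
    continuous_iff_continuousAt.2 fun t => (hTd ζ t).continuousAt
  set κ := K * (1 / (γ - a) + 1 / (b - γ)) with hκ'
  have hκ0 : 0 ≤ κ := by
    have := sub_pos.2 ha; have := sub_pos.2 hb; positivity
  have hTb : ∀ ζ t, 0 ≤ t → ‖Tf ζ t‖ ≤ (K * ‖x‖ + κ * (ε * ‖ζ‖)) * Real.exp (γ * t) := by
    intro ζ t ht
    refine (norm_add_le _ _).trans ?_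
    rw [add_mul]
    exact add_le_add (D.norm_expL_of_p_eq ha hx ht)
      (D.norm_lpOp_le (hf ζ) (by positivity) (hf0 ζ) ha hb ht)
  have hTsub : ∀ ζ ξ t, 0 ≤ t → ‖Tf ζ t - Tf ξ t‖ ≤ 1 / 2 * dist ζ ξ * Real.exp (γ * t) := by
    intro ζ ξ t ht
    have h1 : Tf ζ t - Tf ξ t = lpOp L q (fun τ => f ζ τ - f ξ τ) t := by
      rw [← D.lpOp_sub (hf ζ) (hf ξ) (hf0 ζ) (hf0 ξ) hb]
      simp [Tf]
    rw [h1]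
    refine (D.norm_lpOp_le ((hf ζ).sub (hf ξ)) (by positivity) (hfsub ζ ξ) ha hb ht).trans ?_
    rw [← mul_assoc]
    gcongr
  have hexp : ∀ (t : ℝ) (v : E) (c : ℝ), ‖v‖ ≤ c * Real.exp (γ * t) →
      ‖Real.exp (-(γ * t)) • v‖ ≤ c := by
    intro t v c h
    rw [norm_smul, Real.norm_of_nonneg (Real.exp_pos _).le, Real.exp_neg,
      inv_mul_le_iff₀ (Real.exp_pos _), mul_comm]
    exact h
  let T : BoundedContinuousFunction ℝ E → BoundedContinuousFunction ℝ E := fun ζ =>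
    BoundedContinuousFunction.ofNormedAddCommGroup
      (fun t => Real.exp (-(γ * max t 0)) • Tf ζ (max t 0))
      (by have := hTc ζ; fun_prop) (K * ‖x‖ + κ * (ε * ‖ζ‖))
      (fun t => hexp _ _ _ (hTb ζ _ (le_max_right _ _)))
  -- The factor `1 / 2` is the gain of `lpOp` times `ε`, bounded by `hκ`.
  have hT : ContractingWith (1 / 2) T := by
    refine ⟨by
      rw [← NNReal.coe_lt_coe]
      norm_num, LipschitzWith.of_dist_le_mul fun ζ ξ => ?_⟩
    refine (BoundedContinuousFunction.dist_le (by positivity)).2 fun t => ?_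
    rw [dist_eq_norm]
    change ‖Real.exp (-(γ * max t 0)) • Tf ζ (max t 0)
      - Real.exp (-(γ * max t 0)) • Tf ξ (max t 0)‖ ≤ _
    rw [← smul_sub]
    exact hexp _ _ _ (by simpa using hTsub ζ ξ _ (le_max_right t 0))
  let ζ := hT.fixedPoint
  have hζ : T ζ = ζ := hT.fixedPoint_isFixedPt
  have hfix : ∀ t, 0 ≤ t → Real.exp (γ * t) • ζ t = Tf ζ t := by
    intro t ht
    have h1 : ζ t = Real.exp (-(γ * max t 0)) • Tf ζ (max t 0) := by
      conv_lhs => rw [← hζ]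
      rfl
    rw [h1, max_eq_left ht, smul_smul, ← Real.exp_add]
    simp
  refine ⟨Tf ζ, fun t ht => ?_, ⟨_, hTb ζ⟩, ?_⟩
  · have h1 : N (Tf ζ t) = f ζ t := by
      simp only [f, max_eq_left ht, hfix t ht]
    rw [h1]
    exact hTd ζ t
  · simp only [Tf, map_add, expL_zero_apply]
    rw [hx, D.p_lpOp_zero (hf ζ) (hf0 ζ) hb, add_zero]

end ExpDichotomy

/-- Global existence is the degenerate case `p = id`, `q = 0`: no growth is too fast, so the gap may
be placed above `‖L‖`. -/
theorem exists_forward_solution (L : E →L[ℝ] E) (hε : 0 ≤ ε)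
    (hN : ∀ z w, ‖N z - N w‖ ≤ ε * ‖z - w‖) (hN0 : N 0 = 0) (x : E) :
    ∃ Z : ℝ → E, (∀ t, 0 ≤ t → HasDerivAt Z (L (Z t) + N (Z t)) t) ∧ Z 0 = x := by
  -- Each side of the gap has width `4 ε + 1`, so the contraction constant is `2 ε / (4 ε + 1) ≤ 1 /
  -- 2`; the bound on `q = 0` is vacuous.
  have D : ExpDichotomy L (ContinuousLinearMap.id ℝ E) 0 1 ‖L‖
      (‖L‖ + (4 * ε + 1) + (4 * ε + 1)) :=
    { nonneg := zero_le_one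
      add_apply := by simp
      pq := by simp
      qp := by simp
      comm := by simp
      bound_p := fun t ht z => by simpa using norm_expL_apply_le L ht z
      bound_q := fun t ht z => by simp; positivity }
  obtain ⟨Z, h1, -, h3⟩ := D.exists_slow_solution (γ := ‖L‖ + (4 * ε + 1)) (by linarith)
    (by linarith) hε hN hN0 (x := x) (by
      simp only [add_sub_cancel_left]
      have : 0 < 4 * ε + 1 := by linarith
      field_simp
      linarith) (by simp)
  exact ⟨Z, h1, by simpa using h3⟩

/-- A globally Lipschitz perturbation of a linear vector field has a global flow. -/
theorem exists_isFlowOf (L : E →L[ℝ] E) (hε : 0 ≤ ε)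
    (hN : ∀ z w, ‖N z - N w‖ ≤ ε * ‖z - w‖) (hN0 : N 0 = 0) :
    ∃ S : ℝ → E → E, IsFlowOf (fun z => L z + N z) S := by
  choose Z hZ hZ0 using exists_forward_solution L hε hN hN0
  -- Backward solutions are forward solutions of the reversed system; the two halves are glued at `t
  -- = 0`, where their one-sided derivatives agree.
  choose Y hY hY0 using exists_forward_solution (N := fun z => -N z) (-L) hε
    (fun z w => by rw [neg_sub_neg, norm_sub_rev]; exact hN z w) (by simp [hN0])
  refine ⟨fun t z => if 0 ≤ t then Z z t else Y z (-t), fun z => ⟨by simp [hZ0], fun t => ?_⟩⟩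
  have hY' : ∀ t, t ≤ 0 → HasDerivAt (fun τ => Y z (-τ)) (L (Y z (-t)) + N (Y z (-t))) t := by
    intro t ht
    have := (hY z (-t) (by linarith)).scomp t (hasDerivAt_neg t)
    refine this.congr_deriv ?_
    simp
  dsimp only
  rcases lt_trichotomy t 0 with ht | rfl | ht
  · rw [if_neg (not_le.2 ht)]
    refine (hY' t ht.le).congr_of_eventuallyEq ?_
    filter_upwards [Iio_mem_nhds ht] with τ hτ
    rw [if_neg (not_le.2 hτ)]
  · have h1 : HasDerivWithinAt (fun τ => if 0 ≤ τ then Z z τ else Y z (-τ)) (L z + N z)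
        (Ici 0) 0 := by
      have := (hZ z 0 le_rfl).hasDerivWithinAt (s := Ici 0)
      rw [hZ0] at this
      refine this.congr (fun τ hτ => if_pos hτ) (by simp)
    have h2 : HasDerivWithinAt (fun τ => if 0 ≤ τ then Z z τ else Y z (-τ)) (L z + N z)
        (Iic 0) 0 := by
      have := (hY' 0 le_rfl).hasDerivWithinAt (s := Iic 0)
      rw [neg_zero, hY0] at this
      refine this.congr (fun τ hτ => ?_) (by simp [hZ0, hY0])
      rcases (show τ ≤ 0 from hτ).eq_or_lt with rfl | h
      · simp [hZ0, hY0]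
      · rw [if_neg (not_le.2 h)]
    have h3 := h2.union h1
    rw [Iic_union_Ici, hasDerivWithinAt_univ] at h3
    simpa [hZ0] using h3
  · rw [if_pos ht.le]
    refine (hZ z t ht.le).congr_of_eventuallyEq ?_
    filter_upwards [Ioi_mem_nhds ht] with τ hτ
    rw [if_pos (le_of_lt hτ)]

end LyapunovPerron

/-! ### Properties of the flow, and the straightening map -/

section Flow

open MeasureTheory Set

variable {E : Type*} [NormedAddCommGroup E] [NormedSpace ℝ E] {F : E → E} {S : ℝ → E → E} {Λ : ℝ≥0}

namespace IsFlowOf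

theorem continuous_time (hS : IsFlowOf F S) (z : E) : Continuous fun t => S t z :=
  continuous_iff_continuousAt.2 fun t => ((hS z).2 t).continuousAt

theorem eq_of_forward (hS : IsFlowOf F S) (hF : LipschitzWith Λ F) {Z : ℝ → E}
    (hZ : ∀ t, 0 ≤ t → HasDerivAt Z (F (Z t)) t) {t : ℝ} (ht : 0 ≤ t) : S t (Z 0) = Z t := by
  refine ODE_solution_unique (v := fun _ => F) (K := Λ) (f := fun τ => S τ (Z 0)) (g := Z)
    (a := 0) (b := t) (fun _ => hF) (hS.continuous_time _).continuousOn
    (fun τ _ => ((hS _).2 τ).hasDerivWithinAt)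
    (fun τ hτ => (hZ τ hτ.1).continuousAt.continuousWithinAt)
    (fun τ hτ => (hZ τ hτ.1).hasDerivWithinAt) (hS _).1 ⟨ht, le_rfl⟩

theorem flow_add (hS : IsFlowOf F S) (hF : LipschitzWith Λ F) (t r : ℝ) (z : E) :
    S (t + r) z = S t (S r z) := by
  have := ODE_solution_unique_univ (v := fun _ => F) (s := fun _ => univ) (K := Λ) (t₀ := 0)
    (f := fun τ => S (τ + r) z) (g := fun τ => S τ (S r z)) (fun _ => hF.lipschitzOnWith)
    (fun τ => ⟨((hS z).2 (τ + r)).comp_add_const τ r, trivial⟩)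
    (fun τ => ⟨(hS _).2 τ, trivial⟩) (by simp [(hS _).1])
  exact congrFun this t

/-- By Grönwall, orbits separate by at most the factor `exp (Λ t)`. Forward times suffice, since the
integral in `straightened` involves no others. -/
theorem continuous_forward (hS : IsFlowOf F S) (hF : LipschitzWith Λ F) {t : ℝ} (ht : 0 ≤ t) :
    Continuous (S t) := by
  refine (LipschitzWith.of_dist_le_mul (K := ⟨Real.exp (Λ * t), (Real.exp_pos _).le⟩)
    fun z w => ?_).continuous
  have := dist_le_of_trajectories_ODE (v := fun _ => F) (K := Λ) (f := fun τ => S τ z)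
    (g := fun τ => S τ w) (a := 0) (b := t) (δ := dist z w) (fun _ => hF)
    (hS.continuous_time _).continuousOn
    (fun τ _ => ((hS _).2 τ).hasDerivWithinAt) (hS.continuous_time _).continuousOn
    (fun τ _ => ((hS _).2 τ).hasDerivWithinAt) (by simp [(hS _).1]) t ⟨ht, le_rfl⟩
  rw [sub_zero, mul_comm] at this
  exact this

theorem flow_zero (hS : IsFlowOf F S) (hF : LipschitzWith Λ F) (h0 : F 0 = 0) (t : ℝ) :
    S t 0 = 0 := by
  have := ODE_solution_unique_univ (v := fun _ => F) (s := fun _ => univ) (K := Λ) (t₀ := 0)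
    (f := fun τ => S τ 0) (g := fun _ => 0) (fun _ => hF.lipschitzOnWith)
    (fun τ => ⟨(hS _).2 τ, trivial⟩)
    (fun τ => ⟨by simpa [h0] using hasDerivAt_const τ (0 : E), trivial⟩) (by simp [(hS _).1])
  exact congrFun this t

/-- Reversing time turns the flow of `F` into the flow of `-F`. -/
theorem reverse (hS : IsFlowOf F S) : IsFlowOf (fun z => -F z) fun t => S (-t) := fun z =>
  ⟨by simpa using (hS z).1, fun t => by
    simpa [Function.comp_def] using ((hS z).2 (-t)).scomp t (hasDerivAt_neg t)⟩

end IsFlowOf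

variable {L p q : E →L[ℝ] E} {K a b γ ε M C : ℝ} {N : E → E}

theorem lipschitzWith_vectorField (L : E →L[ℝ] E) (hN : ∀ z w, ‖N z - N w‖ ≤ ε * ‖z - w‖) :
    LipschitzWith (‖L‖₊ + ε.toNNReal) fun z => L z + N z := by
  refine L.lipschitz.add (LipschitzWith.of_dist_le' fun z w => ?_)
  simpa [dist_eq_norm] using hN z w

variable [CompleteSpace E]

namespace IsFlowOf

theorem hasDerivAt_expL_neg_flow (hS : IsFlowOf (fun z => L z + N z) S) (z : E) (t : ℝ) :
    HasDerivAt (fun τ => expL L (-τ) (S τ z)) (expL L (-t) (N (S t z))) t := by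
  have h := hasDerivAt_expL_apply (-L) ((hS z).2 t)
  simp only [expL_neg] at h
  refine h.congr_deriv ?_
  have h1 : L (expL L (-t) (S t z)) = expL L (-t) (L (S t z)) :=
    expL_comm_apply (fun _ => rfl) _ _
  simp [h1]

/-- Variation of constants. -/
theorem duhamel (hS : IsFlowOf (fun z => L z + N z) S) (hN : Continuous N) (z : E) (t : ℝ) :
    expL L (-t) (S t z) = z + ∫ τ in (0:ℝ)..t, expL L (-τ) (N (S τ z)) := by
  rw [intervalIntegral.integral_eq_sub_of_hasDerivAt
    (fun τ _ => hS.hasDerivAt_expL_neg_flow z τ)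
    ((ExpDichotomy.continuous_integrand L
      (hN.comp (hS.continuous_time z))).intervalIntegrable _ _)]
  simp [expL_zero_apply, (hS z).1]

end IsFlowOf

/-- The projection of the flow to the range of `q`, straightened by its asymptotic behaviour:
the limit of `exp (-t L) q (S t z)` as `t → ∞`. -/
noncomputable def straightened (L q : E →L[ℝ] E) (N : E → E) (S : ℝ → E → E) (z : E) : E :=
  q z + ∫ τ in Ioi (0:ℝ), expL L (-τ) (q (N (S τ z)))

namespace ExpDichotomy

/-- Variation of constants with the half-line integral added and subtracted. The first term carries
all growth faster than the gap; without it this is the Lyapunov-Perron equation. -/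
theorem flow_eq (D : ExpDichotomy L p q K a b) (hS : IsFlowOf (fun z => L z + N z) S)
    (hN : Continuous N) (z : E) (t : ℝ) :
    S t z = expL L t (straightened L q N S z) + expL L t (p z)
      + lpOp L q (fun τ => N (S τ z)) t := by
  conv_lhs => rw [← expL_apply_expL_neg L t (S t z), hS.duhamel hN]
  rw [lpOp, ← map_add, ← map_add, straightened]
  congr 1
  have h := D.add_apply z
  generalize (∫ τ in (0:ℝ)..t, expL L (-τ) (N (S τ z))) = I
  generalize (∫ τ in Ioi (0:ℝ), expL L (-τ) (q (N (S τ z)))) = I'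
  have h1 : z + I = p z + q z + I := by rw [h]
  rw [h1]
  abel

theorem integrableOn_flow (D : ExpDichotomy L p q K a b) (hb : 0 < b)
    (hS : IsFlowOf (fun z => L z + N z) S)
    (hN : Continuous N) (hM : ∀ z, ‖N z‖ ≤ M) (z : E) :
    IntegrableOn (fun τ => expL L (-τ) (q (N (S τ z)))) (Ioi (0:ℝ)) :=
  D.integrableOn_integrand (f := fun τ => N (S τ z)) (γ := 0) (C := M)
    (hN.comp (hS.continuous_time z)) (fun τ _ => by simpa using hM _) hb le_rfl

theorem tendsto_straightened (D : ExpDichotomy L p q K a b) (hb : 0 < b)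
    (hS : IsFlowOf (fun z => L z + N z) S)
    (hN : Continuous N) (hM : ∀ z, ‖N z‖ ≤ M) (z : E) :
    Tendsto (fun t => expL L (-t) (q (S t z))) atTop (𝓝 (straightened L q N S z)) := by
  have h := (intervalIntegral_tendsto_integral_Ioi 0 (D.integrableOn_flow hb hS hN hM z)
    tendsto_id).const_add (q z)
  refine h.congr fun t => ?_
  rw [← D.q_expL, hS.duhamel hN, map_add,
    ← ContinuousLinearMap.intervalIntegral_comp_comm _ ((continuous_integrand L
      (f := fun τ => N (S τ z)) (hN.comp (hS.continuous_time z))).intervalIntegrable _ _)]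
  simp only [D.q_expL, id]

/-- Shifting time by `r` in the defining limit produces the factor `exp (r L)`. -/
theorem straightened_flow (D : ExpDichotomy L p q K a b) (hb : 0 < b)
    (hS : IsFlowOf (fun z => L z + N z) S)
    (hN : ∀ z w, ‖N z - N w‖ ≤ ε * ‖z - w‖) (hM : ∀ z, ‖N z‖ ≤ M) (z : E) (r : ℝ) :
    straightened L q N S (S r z) = expL L r (straightened L q N S z) := by
  have hNc := continuous_of_norm_sub_le hN
  refine tendsto_nhds_unique (D.tendsto_straightened hb hS hNc hM (S r z)) ?_
  have h := ((D.tendsto_straightened hb hS hNc hM z).comp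
    (tendsto_atTop_add_const_right atTop r tendsto_id))
  refine (((expL L r).continuous.tendsto _).comp h).congr fun t => ?_
  simp only [Function.comp, id]
  rw [← expL_add_apply, hS.flow_add (lipschitzWith_vectorField L hN)]
  congr 2
  ring

theorem norm_straightened_sub_le (D : ExpDichotomy L p q K a b) (hb : 0 < b)
    (hS : IsFlowOf (fun z => L z + N z) S)
    (hN : Continuous N) (hM : ∀ z, ‖N z‖ ≤ M) (z : E) :
    ‖straightened L q N S z - q z‖ ≤ K * M * (1 / b) := by
  have := D.norm_tail_le (f := fun τ => N (S τ z)) (γ := 0) (C := M) (t := 0)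
    (hN.comp (hS.continuous_time z)) (fun τ _ => by simpa using hM _) hb le_rfl
  simpa [straightened, expL_zero_apply] using this

theorem q_straightened (D : ExpDichotomy L p q K a b) (hb : 0 < b)
    (hS : IsFlowOf (fun z => L z + N z) S)
    (hN : Continuous N) (hM : ∀ z, ‖N z‖ ≤ M) (z : E) :
    q (straightened L q N S z) = straightened L q N S z := by
  rw [straightened, map_add, D.q_idem,
    ← ContinuousLinearMap.integral_comp_comm _ (D.integrableOn_flow hb hS hN hM z)]
  simp only [D.q_expL, D.q_idem]

theorem continuous_straightened (D : ExpDichotomy L p q K a b) (hb : 0 < b)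
    (hS : IsFlowOf (fun z => L z + N z) S)
    (hN : ∀ z w, ‖N z - N w‖ ≤ ε * ‖z - w‖) (hM : ∀ z, ‖N z‖ ≤ M) :
    Continuous (straightened L q N S) := by
  have hNc := continuous_of_norm_sub_le hN
  refine q.continuous.add (continuous_of_dominated
    (bound := fun τ => K * M * Real.exp ((0 - b) * τ)) (fun z => ?_) (fun z => ?_) ?_ ?_)
  · exact (D.integrableOn_flow hb hS hNc hM z).aestronglyMeasurable
  · refine (ae_restrict_iff' measurableSet_Ioi).2 (Eventually.of_forall fun τ hτ => ?_)
    exact D.norm_integrand_le (f := fun τ => N (S τ z)) (γ := 0) (C := M)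
      (fun τ _ => by simpa using hM _) (le_of_lt hτ)
  · exact (integrableOn_exp_mul_Ioi (by linarith) 0).const_mul _
  · refine (ae_restrict_iff' measurableSet_Ioi).2 (Eventually.of_forall fun τ hτ => ?_)
    exact (expL L (-τ)).continuous.comp (q.continuous.comp (hNc.comp
      (hS.continuous_forward (lipschitzWith_vectorField L hN) (le_of_lt hτ))))

/-- Along the orbit the straightened value is `exp (t L) σ z`, and it is within bounded distance of
`q (S t z)`, hence `O(exp (γ t))`. Pulling back by the backward decay gives `‖σ z‖ = O(exp (-(b - γ)
t))`. One rate `γ < b` is enough. -/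
theorem straightened_eq_zero (D : ExpDichotomy L p q K a b) (h0 : 0 ≤ γ) (hγ : γ < b)
    (hS : IsFlowOf (fun z => L z + N z) S)
    (hN : ∀ z w, ‖N z - N w‖ ≤ ε * ‖z - w‖) (hM : ∀ z, ‖N z‖ ≤ M) {z : E}
    (hz : (fun t : ℝ => S t z) =O[atTop] fun t : ℝ => Real.exp (γ * t)) :
    straightened L q N S z = 0 := by
  have hb : 0 < b := h0.trans_lt hγ
  have hK := D.nonneg
  have hM0 : 0 ≤ M := (norm_nonneg _).trans (hM 0)
  have hNc := continuous_of_norm_sub_le hN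
  obtain ⟨C, hC0, hC⟩ := hz.exists_pos
  have key : ∀ᶠ t in atTop, ‖straightened L q N S z‖ ≤
      K * (‖q‖ * C + K * M * (1 / b)) * Real.exp (-((b - γ) * t)) := by
    filter_upwards [hC.bound, eventually_ge_atTop 0] with t ht ht0
    rw [Real.norm_of_nonneg (Real.exp_pos _).le] at ht
    have h1 : ‖straightened L q N S (S t z)‖ ≤
        (‖q‖ * C + K * M * (1 / b)) * Real.exp (γ * t) := by
      have h2 := D.norm_straightened_sub_le hb hS hNc hM (S t z)
      have h3 := norm_le_norm_add_norm_sub' (straightened L q N S (S t z)) (q (S t z))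
      have h4 : ‖q (S t z)‖ ≤ ‖q‖ * (C * Real.exp (γ * t)) :=
        (q.le_opNorm _).trans (by gcongr)
      have h5 : 1 ≤ Real.exp (γ * t) := Real.one_le_exp (by positivity)
      have h6 : K * M * (1 / b) ≤ K * M * (1 / b) * Real.exp (γ * t) :=
        le_mul_of_one_le_right (by positivity) h5
      linarith
    rw [D.straightened_flow hb hS hN hM] at h1
    have h7 := D.bound_q t ht0 (expL L t (straightened L q N S z))
    rw [D.q_expL, expL_neg_apply_expL, D.q_straightened hb hS hNc hM] at h7
    calc _ ≤ _ := h7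
      _ ≤ K * Real.exp (-b * t) * ((‖q‖ * C + K * M * (1 / b)) * Real.exp (γ * t)) := by gcongr
      _ = _ := by
        rw [show -((b - γ) * t) = -b * t + γ * t by ring, Real.exp_add]; ring
  have hlim : Tendsto (fun t : ℝ => K * (‖q‖ * C + K * M * (1 / b)) *
      Real.exp (-((b - γ) * t))) atTop (𝓝 (K * (‖q‖ * C + K * M * (1 / b)) * 0)) :=
    (Real.tendsto_exp_neg_atTop_nhds_zero.comp
      (tendsto_id.const_mul_atTop (sub_pos.2 hγ))).const_mul _
  rw [mul_zero] at hlim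
  exact norm_le_zero_iff.1 (ge_of_tendsto hlim key)

/-- The projection `p` annihilates the straightened term of `flow_eq`, so the `p`-component of every
orbit grows slowly, on the manifold or off it. -/
theorem norm_p_flow_le (D : ExpDichotomy L p q K a b) (h0 : 0 ≤ γ) (ha : a < γ) (hγ : γ < b)
    (hS : IsFlowOf (fun z => L z + N z) S) (hN : Continuous N) (hM : ∀ z, ‖N z‖ ≤ M)
    (hb : 0 < b) (z : E) {t : ℝ} (ht : 0 ≤ t) :
    ‖p (S t z)‖ ≤ (K * ‖p z‖ + ‖p‖ * (K * (1 / (γ - a) + 1 / (b - γ)) * M)) *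
      Real.exp (γ * t) := by
  have hM0 : 0 ≤ M := (norm_nonneg _).trans (hM 0)
  have h1 := D.norm_lpOp_le (f := fun τ => N (S τ z)) (hN.comp (hS.continuous_time z)) hM0
    (fun τ hτ => (hM _).trans (le_mul_of_one_le_right hM0 (Real.one_le_exp (by positivity))))
    ha hγ ht
  have h2 := D.norm_expL_of_p_eq ha (D.p_idem z) ht
  rw [D.flow_eq hS hN, map_add, map_add, D.p_expL, D.p_expL, D.p_idem,
    ← D.q_straightened hb hS hN hM, D.pq, map_zero, zero_add, add_mul]
  refine (norm_add_le _ _).trans (add_le_add h2 ((p.le_opNorm _).trans ?_))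
  rw [mul_assoc]
  gcongr

/-- Boundedness of `N` replaces smallness here, so `γ` can be taken as small as desired without
shrinking `ε`. -/
theorem norm_flow_le (D : ExpDichotomy L p q K a b) (h0 : 0 ≤ γ) (ha : a < γ) (hγ : γ < b)
    (hS : IsFlowOf (fun z => L z + N z) S) (hN : Continuous N) (hM : ∀ z, ‖N z‖ ≤ M)
    {z : E} (hz : straightened L q N S z = 0) {t : ℝ} (ht : 0 ≤ t) :
    ‖S t z‖ ≤ (K * ‖p z‖ + K * (1 / (γ - a) + 1 / (b - γ)) * M) * Real.exp (γ * t) := by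
  have hM0 : 0 ≤ M := (norm_nonneg _).trans (hM 0)
  have h1 := D.norm_lpOp_le (f := fun τ => N (S τ z)) (hN.comp (hS.continuous_time z)) hM0
    (fun τ hτ => (hM _).trans (le_mul_of_one_le_right hM0 (Real.one_le_exp (by positivity))))
    ha hγ ht
  have h2 := D.norm_expL_of_p_eq ha (D.p_idem z) ht
  rw [D.flow_eq hS hN, hz, map_zero, zero_add, add_mul]
  exact (norm_add_le _ _).trans (add_le_add h2 h1)

/-- The difference of two orbits solves a Lyapunov-Perron equation whose inhomogeneity is `ε`-small
relative to the difference itself. A bound with constant `C` therefore improves to `K ‖p (z - w)‖ +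
C / 2`, and iterating gives the fixed point `2 K ‖p (z - w)‖`. -/
theorem norm_flow_sub_le (D : ExpDichotomy L p q K a b) (h0 : 0 ≤ γ) (ha : a < γ) (hγ : γ < b)
    (hS : IsFlowOf (fun z => L z + N z) S) (hε : 0 ≤ ε)
    (hN : ∀ z w, ‖N z - N w‖ ≤ ε * ‖z - w‖) (hM : ∀ z, ‖N z‖ ≤ M)
    (hκ : K * (1 / (γ - a) + 1 / (b - γ)) * ε ≤ 1 / 2)
    {z w : E} (hz : straightened L q N S z = 0) (hw : straightened L q N S w = 0)
    {t : ℝ} (ht : 0 ≤ t) :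
    ‖S t z - S t w‖ ≤ 2 * K * ‖p (z - w)‖ * Real.exp (γ * t) := by
  have hNc := continuous_of_norm_sub_le hN
  have hM0 : 0 ≤ M := (norm_nonneg _).trans (hM 0)
  have hK := D.nonneg
  have hκ0 : 0 ≤ K * (1 / (γ - a) + 1 / (b - γ)) := by
    have := sub_pos.2 ha; have := sub_pos.2 hγ; positivity
  have hMγ : ∀ v τ, 0 ≤ τ → ‖N v‖ ≤ M * Real.exp (γ * τ) := fun v τ hτ =>
    (hM _).trans (le_mul_of_one_le_right hM0 (Real.one_le_exp (by positivity)))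
  have hstep : ∀ C, 0 ≤ C → (∀ t, 0 ≤ t → ‖S t z - S t w‖ ≤ C * Real.exp (γ * t)) →
      ∀ t, 0 ≤ t → ‖S t z - S t w‖ ≤ (K * ‖p (z - w)‖ + C / 2) * Real.exp (γ * t) := by
    intro C hC0 hC t ht
    have heq : S t z - S t w = expL L t (p (z - w)) +
        lpOp L q (fun τ => N (S τ z) - N (S τ w)) t := by
      rw [← D.lpOp_sub (f := fun τ => N (S τ z)) (g := fun τ => N (S τ w))
          (hNc.comp (hS.continuous_time z)) (hNc.comp (hS.continuous_time w))
        (fun τ hτ => hMγ _ τ hτ) (fun τ hτ => hMγ _ τ hτ) hγ, D.flow_eq hS hNc z,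
        D.flow_eq hS hNc w, hz, hw, map_sub, map_sub]
      abel
    have h1 := D.norm_lpOp_le (f := fun τ => N (S τ z) - N (S τ w)) (C := ε * C)
      ((hNc.comp (hS.continuous_time z)).sub (hNc.comp (hS.continuous_time w))) (by positivity)
      (fun τ hτ => (hN _ _).trans (by rw [mul_assoc]; gcongr; exact hC τ hτ)) ha hγ ht
    have h2 := D.norm_expL_of_p_eq ha (D.p_idem (z - w)) ht
    rw [heq, add_mul]
    refine (norm_add_le _ _).trans (add_le_add h2 (h1.trans ?_))
    gcongr
    rw [← mul_assoc]
    nlinarith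
  -- A crude initial bound from `norm_flow_le` for each orbit; it is halved at every iteration.
  set C₀ := K * ‖p z‖ + K * (1 / (γ - a) + 1 / (b - γ)) * M +
    (K * ‖p w‖ + K * (1 / (γ - a) + 1 / (b - γ)) * M) with hC₀
  have hC₀0 : 0 ≤ C₀ := by positivity
  have hiter : ∀ n : ℕ, ∀ t, 0 ≤ t →
      ‖S t z - S t w‖ ≤ (2 * K * ‖p (z - w)‖ + C₀ * (1 / 2) ^ n) * Real.exp (γ * t) := by
    intro n
    induction n with
    | zero =>
      intro t ht
      refine (norm_sub_le _ _).trans ((add_le_add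
        (D.norm_flow_le h0 ha hγ hS hNc hM hz ht)
        (D.norm_flow_le h0 ha hγ hS hNc hM hw ht)).trans ?_)
      rw [← add_mul, pow_zero, mul_one]
      have h1 : 0 ≤ 2 * K * ‖p (z - w)‖ := by positivity
      exact mul_le_mul_of_nonneg_right (by linarith) (Real.exp_pos _).le
    | succ n ih =>
      intro t ht
      refine (hstep _ (by positivity) ih t ht).trans_eq ?_
      ring
  have hlim : Tendsto (fun n : ℕ => (2 * K * ‖p (z - w)‖ + C₀ * (1 / 2) ^ n) * Real.exp (γ * t))
      atTop (𝓝 ((2 * K * ‖p (z - w)‖ + C₀ * 0) * Real.exp (γ * t))) :=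
    (((tendsto_pow_atTop_nhds_zero_of_lt_one (𝕜 := ℝ) (r := (1 / 2 : ℝ)) (by norm_num)
      (by norm_num)).const_mul
      C₀).const_add _).mul_const _
  rw [mul_zero, add_zero] at hlim
  exact ge_of_tendsto' hlim fun n => hiter n t ht

theorem q_eq_lpOp (D : ExpDichotomy L p q K a b)
    (hS : IsFlowOf (fun z => L z + N z) S) (hN : Continuous N)
    {z : E} (hz : straightened L q N S z = 0) :
    q z = lpOp L q (fun τ => N (S τ z)) 0 := by
  have h := D.flow_eq hS hN z 0
  rw [hz, (hS z).1, expL_zero_apply, expL_zero_apply, zero_add] at h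
  have h1 := D.add_apply z
  conv_rhs at h1 => rw [h]
  exact add_left_cancel h1

theorem norm_q_sub_le (D : ExpDichotomy L p q K a b) (h0 : 0 ≤ γ) (ha : a < γ) (hγ : γ < b)
    (hS : IsFlowOf (fun z => L z + N z) S) (hε : 0 ≤ ε)
    (hN : ∀ z w, ‖N z - N w‖ ≤ ε * ‖z - w‖) (hM : ∀ z, ‖N z‖ ≤ M)
    (hκ : K * (1 / (γ - a) + 1 / (b - γ)) * ε ≤ 1 / 2)
    {z w : E} (hz : straightened L q N S z = 0) (hw : straightened L q N S w = 0) :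
    ‖q (z - w)‖ ≤ K * (1 / (γ - a) + 1 / (b - γ)) * (ε * (2 * K)) * ‖p (z - w)‖ := by
  have hNc := continuous_of_norm_sub_le hN
  have hM0 : 0 ≤ M := (norm_nonneg _).trans (hM 0)
  have hK := D.nonneg
  have hMγ : ∀ v τ, 0 ≤ τ → ‖N v‖ ≤ M * Real.exp (γ * τ) := fun v τ hτ =>
    (hM _).trans (le_mul_of_one_le_right hM0 (Real.one_le_exp (by positivity)))
  rw [map_sub, D.q_eq_lpOp hS hNc hz, D.q_eq_lpOp hS hNc hw,
    D.lpOp_sub (f := fun τ => N (S τ z)) (g := fun τ => N (S τ w))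
          (hNc.comp (hS.continuous_time z)) (hNc.comp (hS.continuous_time w))
        (fun τ hτ => hMγ _ τ hτ) (fun τ hτ => hMγ _ τ hτ) hγ]
  refine (D.norm_lpOp_le (f := fun τ => N (S τ z) - N (S τ w))
    (C := ε * (2 * K) * ‖p (z - w)‖)
    ((hNc.comp (hS.continuous_time z)).sub (hNc.comp (hS.continuous_time w))) (by positivity)
    (fun τ hτ => (hN _ _).trans ?_) ha hγ le_rfl).trans_eq ?_
  · have := D.norm_flow_sub_le h0 ha hγ hS hε hN hM hκ hz hw hτ
    calc _ ≤ ε * (2 * K * ‖p (z - w)‖ * Real.exp (γ * τ)) := by gcongr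
      _ = _ := by ring
  · simp
    ring

/-- The slow solution found by contraction is a forward orbit of the flow by uniqueness, and slow
growth forces its straightened value to vanish. -/
theorem exists_straightened_eq_zero (D : ExpDichotomy L p q K a b) (h0 : 0 ≤ γ) (ha : a < γ)
    (hγ : γ < b) (hS : IsFlowOf (fun z => L z + N z) S) (hε : 0 ≤ ε)
    (hN : ∀ z w, ‖N z - N w‖ ≤ ε * ‖z - w‖) (hM : ∀ z, ‖N z‖ ≤ M) (hN0 : N 0 = 0)
    (hκ : K * (1 / (γ - a) + 1 / (b - γ)) * ε ≤ 1 / 2) {x : E} (hx : p x = x) :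
    ∃ z, straightened L q N S z = 0 ∧ p z = x := by
  obtain ⟨Z, hZ, ⟨C, hC⟩, hp⟩ := D.exists_slow_solution ha hγ hε hN hN0 hκ hx
  refine ⟨Z 0, D.straightened_eq_zero h0 hγ hS hN hM ?_, hp⟩
  refine IsBigO.of_bound C ?_
  filter_upwards [eventually_ge_atTop 0] with t ht
  rw [hS.eq_of_forward (lipschitzWith_vectorField L hN) hZ ht,
    Real.norm_of_nonneg (Real.exp_pos _).le]
  exact hC t ht

/-- If the nonlinearity has zero derivative at the origin, then so has the slow manifold. -/
theorem tangent (D : ExpDichotomy L p q K a b) {γ' : ℝ} (h0 : 0 ≤ γ) (ha : a < γ)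
    (hγγ' : γ < γ') (hγ' : γ' < b)
    (hS : IsFlowOf (fun z => L z + N z) S) (hε : 0 ≤ ε)
    (hN : ∀ z w, ‖N z - N w‖ ≤ ε * ‖z - w‖) (hM : ∀ z, ‖N z‖ ≤ M) (hN0 : N 0 = 0)
    (hκ : K * (1 / (γ - a) + 1 / (b - γ)) * ε ≤ 1 / 2)
    (hNd : HasFDerivAt N (0 : E →L[ℝ] E) 0) {η : ℝ} (hη : 0 < η) :
    ∃ r, 0 < r ∧ ∀ z, straightened L q N S z = 0 → ‖p z‖ < r → ‖q z‖ ≤ η * ‖p z‖ := by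
  have hγ : γ < b := hγγ'.trans hγ'
  have hNc := continuous_of_norm_sub_le hN
  have hK := D.nonneg
  have hS0 : ∀ t, S t 0 = 0 :=
    hS.flow_zero (lipschitzWith_vectorField L hN) (by simp [hN0])
  have hσ0 : straightened L q N S 0 = 0 := by
    simp [straightened, hS0, hN0]
  have hgrow : ∀ z, straightened L q N S z = 0 → ∀ t, 0 ≤ t →
      ‖S t z‖ ≤ 2 * K * ‖p z‖ * Real.exp (γ * t) := by
    intro z hz t ht
    simpa [hS0] using D.norm_flow_sub_le h0 ha hγ hS hε hN hM hκ hz hσ0 ht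
  set κ := K * (1 / (γ' - a) + 1 / (b - γ')) with hκdef
  have hκ0 : 0 ≤ κ := by
    have := sub_pos.2 (ha.trans hγγ'); have := sub_pos.2 hγ'; positivity
  -- Orbits are bounded at rate `γ` and the integral is estimated at the larger rate `γ'`. The
  -- difference of the rates supplies smallness at late times.
  obtain ⟨η', hη', hηκ⟩ : ∃ η', 0 < η' ∧ κ * η' ≤ η := by
    refine ⟨η / (κ + 1), by positivity, ?_⟩
    rw [mul_div_assoc', div_le_iff₀ (by positivity)]
    nlinarith
  have hlim : Tendsto (fun t : ℝ => ε * (2 * K) * Real.exp (-((γ' - γ) * t))) atTop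
      (𝓝 (ε * (2 * K) * 0)) :=
    (Real.tendsto_exp_neg_atTop_nhds_zero.comp
      (tendsto_id.const_mul_atTop (sub_pos.2 hγγ'))).const_mul _
  rw [mul_zero] at hlim
  obtain ⟨T, hT⟩ := eventually_atTop.1
    ((eventually_ge_atTop (0 : ℝ)).and (hlim.eventually_le_const hη'))
  have hT0 : 0 ≤ T := (hT T le_rfl).1
  obtain ⟨ρ, hρ, hNρ⟩ : ∃ ρ > 0, ∀ w, ‖w‖ < ρ → ‖N w‖ ≤ η' / (2 * K + 1) * ‖w‖ := by
    have h1 := (hasFDerivAt_iff_isLittleO_nhds_zero.1 hNd).bound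
      (show 0 < η' / (2 * K + 1) by positivity)
    obtain ⟨ρ, hρ, h2⟩ := Metric.eventually_nhds_iff.1 h1
    exact ⟨ρ, hρ, fun w hw => by simpa [hN0] using h2 (show dist w 0 < ρ by simpa using hw)⟩
  -- This radius keeps the orbit in the ball of radius `ρ` up to time `T`; `2 K + 1` replaces `2 K`
  -- to avoid dividing by zero.
  refine ⟨ρ / ((2 * K + 1) * Real.exp (γ * T)), by positivity, fun z hz hzr => ?_⟩
  have hNS : ∀ τ, 0 ≤ τ → ‖N (S τ z)‖ ≤ η' * ‖p z‖ * Real.exp (γ' * τ) := by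
    intro τ hτ
    have hg := hgrow z hz τ hτ
    -- Before `T` the orbit is near `0`, where `N` has small slope. After `T` the factor `exp (-(γ'
    -- - γ) τ)` makes the plain Lipschitz bound small enough.
    rcases le_total τ T with hτT | hτT
    · have hexp : Real.exp (γ * τ) ≤ Real.exp (γ * T) := by gcongr
      have hexp' : Real.exp (γ * τ) ≤ Real.exp (γ' * τ) := by gcongr
      have hlt : ‖S τ z‖ < ρ := by
        rw [lt_div_iff₀ (by positivity)] at hzr
        have h3 : 2 * K * ‖p z‖ * Real.exp (γ * τ) ≤ (2 * K + 1) * ‖p z‖ * Real.exp (γ * T) := by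
          gcongr
          linarith
        calc _ ≤ _ := hg.trans h3
          _ = ‖p z‖ * ((2 * K + 1) * Real.exp (γ * T)) := by ring
          _ < ρ := hzr
      calc _ ≤ _ := hNρ _ hlt
        _ ≤ η' / (2 * K + 1) * ((2 * K + 1) * ‖p z‖ * Real.exp (γ' * τ)) := by
          refine mul_le_mul_of_nonneg_left (hg.trans ?_) (by positivity)
          gcongr
          linarith
        _ = _ := by field_simp
    · have h4 := (hT τ hτT).2
      calc _ ≤ ε * ‖S τ z‖ := norm_le_of_norm_sub_le hN hN0 _
        _ ≤ ε * (2 * K * ‖p z‖ * Real.exp (γ * τ)) := by gcongr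
        _ = ε * (2 * K) * Real.exp (-((γ' - γ) * τ)) * ‖p z‖ * Real.exp (γ' * τ) := by
          rw [show γ * τ = -((γ' - γ) * τ) + γ' * τ by ring, Real.exp_add]; ring
        _ ≤ _ := by gcongr
  have h5 := D.norm_lpOp_le (f := fun τ => N (S τ z)) (hNc.comp (hS.continuous_time z))
    (by positivity) hNS (ha.trans hγγ') hγ' le_rfl
  rw [← D.q_eq_lpOp hS hNc hz, mul_zero, Real.exp_zero, mul_one, ← hκdef, ← mul_assoc] at h5
  exact h5.trans (by gcongr)

end ExpDichotomy

end Flow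

/-! ### From slow manifolds to unique invariant graphs -/

section Manifolds

variable {E : Type*} [NormedAddCommGroup E] [NormedSpace ℝ E] {S : ℝ → E → E}
  {p q : E →L[ℝ] E} {P Q : Submodule ℝ E} {W : Set E} {ℓ : ℝ}

/-- `p` and `q` are the projections belonging to the decomposition of the space into `P`
and `Q`. -/
structure ComplProj (p q : E →L[ℝ] E) (P Q : Submodule ℝ E) : Prop where
  add_apply : ∀ z, p z + q z = z
  p_mem : ∀ z, p z ∈ P
  q_mem : ∀ z, q z ∈ Q
  p_eq : ∀ z ∈ P, p z = z
  q_eq : ∀ z ∈ Q, q z = z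

namespace ComplProj

theorem p_eq_zero (h : ComplProj p q P Q) {z : E} (hz : z ∈ Q) : p z = 0 := by
  simpa [h.q_eq z hz] using h.add_apply z

theorem q_eq_zero (h : ComplProj p q P Q) {z : E} (hz : z ∈ P) : q z = 0 := by
  simpa [h.p_eq z hz] using h.add_apply z

theorem isCompl (h : ComplProj p q P Q) : IsCompl P Q := by
  refine ⟨Submodule.disjoint_def.2 fun z hP hQ => ?_, codisjoint_iff.2 (eq_top_iff.2 fun z _ => ?_)⟩
  · rw [← h.p_eq z hP, h.p_eq_zero hQ]
  · rw [← h.add_apply z]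
    exact Submodule.add_mem_sup (h.p_mem z) (h.q_mem z)

end ComplProj

/-- `W` is an invariant Lipschitz graph of small slope over the range of `p`, and contains all
orbits along which the `q`-component is dominated by the `p`-component. -/
structure SlowManifold (S : ℝ → E → E) (p q : E →L[ℝ] E) (W : Set E) (ℓ : ℝ) : Prop where
  zero_mem : (0 : E) ∈ W
  invariant : IsFlowInvariant S W
  surj : ∀ x, p x = x → ∃ z ∈ W, p z = x
  lip : ∀ z ∈ W, ∀ w ∈ W, ‖q (z - w)‖ ≤ ℓ * ‖p (z - w)‖
  bdd : ∃ M, ∀ z ∈ W, ‖q z‖ ≤ M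
  slow : ∀ z C, (∀ t, ‖q (S t z)‖ ≤ C * (1 + ‖p (S t z)‖)) → z ∈ W

/-- On `W` the `q`-component is of smaller order than the `p`-component at the origin. -/
def FlatAtZero (p q : E →L[ℝ] E) (W : Set E) : Prop :=
  ∀ η : ℝ, 0 < η → ∃ r, 0 < r ∧ ∀ z ∈ W, ‖p z‖ < r → ‖q z‖ ≤ η * ‖p z‖

namespace SlowManifold

theorem reverse (h : SlowManifold (fun t => S (-t)) p q W ℓ) : SlowManifold S p q W ℓ where
  zero_mem := h.zero_mem
  invariant t z hz := by simpa using h.invariant (-t) z hz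
  surj := h.surj
  lip := h.lip
  bdd := h.bdd
  slow z C hC := h.slow z C fun t => hC (-t)

/-- The Lipschitz cone condition makes `p` injective on `W`; both the graph property and uniqueness
rest on this. -/
theorem eq_of_p_eq (h : SlowManifold S p q W ℓ) (hc : ComplProj p q P Q) {z w : E}
    (hz : z ∈ W) (hw : w ∈ W) (hzw : p z = p w) : z = w := by
  have h1 : p (z - w) = 0 := by rw [map_sub, hzw, sub_self]
  have h2 : q (z - w) = 0 := by
    have := h.lip z hz w hw
    rw [h1, norm_zero, mul_zero] at this
    exact norm_le_zero_iff.1 this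
  have h3 := hc.add_apply (z - w)
  rw [h1, h2, add_zero] at h3
  exact sub_eq_zero.1 h3.symm

theorem exists_graph (h : SlowManifold S p q W ℓ) (hc : ComplProj p q P Q) :
    ∃ φ : P → Q, W = graphOver φ ∧ ∀ x : P, ∃ z ∈ W, p z = x ∧ q z = φ x := by
  choose! f hfW hfp using h.surj
  refine ⟨fun x => ⟨q (f x), hc.q_mem _⟩, ?_, fun x => ⟨f x, hfW x (hc.p_eq x x.2),
    hfp x (hc.p_eq x x.2), rfl⟩⟩
  have key : ∀ x : P, (x : E) + q (f x) = f x := fun x => by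
    conv_rhs => rw [← hc.add_apply (f x), hfp x (hc.p_eq x x.2)]
  ext z
  constructor
  · intro hz
    have hpz := hc.p_eq _ (hc.p_mem z)
    refine ⟨⟨p z, hc.p_mem z⟩, ?_⟩
    change p z + q (f (p z)) = z
    rw [key ⟨p z, hc.p_mem z⟩]
    exact h.eq_of_p_eq hc (hfW _ hpz) hz (hfp _ hpz)
  · rintro ⟨x, rfl⟩
    change (x : E) + q (f x) ∈ W
    rw [key x]
    exact hfW x (hc.p_eq x x.2)

theorem isUniqueGlobalInvariantManifold (h : SlowManifold S p q W ℓ) (hc : ComplProj p q P Q) :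
    IsUniqueGlobalInvariantManifold S P Q W where
  isCompl := hc.isCompl
  zero_mem := h.zero_mem
  invariant := h.invariant
  graph := by
    obtain ⟨φ, hW, hφ⟩ := h.exists_graph hc
    obtain ⟨M, hM⟩ := h.bdd
    refine ⟨φ, ⟨ℓ.toNNReal, LipschitzWith.of_dist_le' fun x y => ?_⟩, ⟨M, fun x => ?_⟩, hW⟩
    · obtain ⟨z, hz, hpz, hqz⟩ := hφ x
      obtain ⟨w, hw, hpw, hqw⟩ := hφ y
      have := h.lip z hz w hw
      rw [map_sub, map_sub, hpz, hpw, hqz, hqw] at this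
      rw [dist_eq_norm, dist_eq_norm]
      exact this
    · obtain ⟨z, hz, -, hqz⟩ := hφ x
      have := hM z hz
      rw [hqz] at this
      exact this
  unique ψ := by
    rintro ⟨C, hC⟩ hinv
    have hp : ∀ x : P, p ((x : E) + ψ x) = x := fun x => by
      rw [map_add, hc.p_eq x x.2, hc.p_eq_zero (ψ x).2, add_zero]
    have hq : ∀ x : P, q ((x : E) + ψ x) = ψ x := fun x => by
      rw [map_add, hc.q_eq _ (ψ x).2, hc.q_eq_zero x.2, zero_add]
    -- By invariance the linear growth bound on `ψ` holds along the whole orbit, which is the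
    -- criterion `slow`.
    have hsub : graphOver ψ ⊆ W := by
      intro z hz
      refine h.slow z C fun t => ?_
      obtain ⟨x, hx⟩ := hinv t z hz
      simp only at hx
      rw [← hx, hp, hq]
      exact hC x
    -- Above `p z` the graph of `ψ` has a point, which lies in `W` and so must be `z`.
    refine hsub.antisymm fun z hz => ?_
    have hm : p z + ψ ⟨p z, hc.p_mem z⟩ ∈ graphOver ψ := ⟨⟨p z, hc.p_mem z⟩, rfl⟩
    rwa [h.eq_of_p_eq hc hz (hsub hm) (hp ⟨p z, hc.p_mem z⟩).symm]

theorem isTangentAtZero (h : SlowManifold S p q W ℓ) (hc : ComplProj p q P Q)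
    (hf : FlatAtZero p q W) : IsTangentAtZero P Q W := by
  obtain ⟨φ, hW, hφ⟩ := h.exists_graph hc
  have hφ0 : φ 0 = 0 := by
    obtain ⟨z, hz, hpz, hqz⟩ := hφ 0
    have := h.eq_of_p_eq hc hz h.zero_mem (by rw [hpz]; simp)
    rw [this, map_zero] at hqz
    exact Subtype.ext hqz.symm
  refine ⟨φ, hW, hφ0, ?_⟩
  rw [hasFDerivAt_iff_isLittleO_nhds_zero]
  refine isLittleO_iff.2 fun η hη => ?_
  obtain ⟨r, hr, hrW⟩ := hf η hη
  filter_upwards [Metric.ball_mem_nhds (0 : P) hr] with x hx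
  obtain ⟨z, hz, hpz, hqz⟩ := hφ x
  have := hrW z hz (by rw [hpz]; simpa using hx)
  rw [hpz, hqz] at this
  simpa [hφ0] using this

end SlowManifold

/-! ### The center manifold as an intersection -/

section Center

variable {W₁ W₂ : Set E} {pc ps pu : E →L[ℝ] E}

/-- Adding the two cone conditions gives `(1 - η) (‖y‖ + ‖z‖) ≤ 2 η ‖x‖`, and `1 - η ≥ 1 / 2`. -/
theorem norm_center_le {x y z : E} {η : ℝ} (h0 : 0 ≤ η) (h1 : η ≤ 1 / 2)
    (hz : ‖z‖ ≤ η * ‖x + y‖) (hy : ‖y‖ ≤ η * ‖x + z‖) : ‖y‖ + ‖z‖ ≤ 4 * η * ‖x‖ := by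
  have h2 := norm_add_le x y
  have h3 := norm_add_le x z
  have h4 : η * ‖x + y‖ ≤ η * (‖x‖ + ‖y‖) := by gcongr
  have h5 : η * ‖x + z‖ ≤ η * (‖x‖ + ‖z‖) := by gcongr
  nlinarith [norm_nonneg y, norm_nonneg z]

/-- The intersection of a slow manifold over `pc + ps` and one over `pc + pu` is a slow manifold
over `pc`. -/
theorem SlowManifold.inter [CompleteSpace E] (h₁ : SlowManifold S (pc + ps) pu W₁ ℓ)
    (h₂ : SlowManifold S (pc + pu) ps W₂ ℓ) (hc₁ : ∀ z, pc z + ps z + pu z = z)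
    (hcs : ∀ z, pc (ps z) = 0) (hcu : ∀ z, pc (pu z) = 0)
    (hsc : ∀ z, ps (pc z) = 0) (hsu : ∀ z, ps (pu z) = 0)
    (huc : ∀ z, pu (pc z) = 0) (hus : ∀ z, pu (ps z) = 0)
    (hℓ0 : 0 ≤ ℓ) (hℓ : ℓ ≤ 1 / 2) (hℓp : ℓ * (‖ps‖ + ‖pu‖) ≤ 1 / 2) :
    SlowManifold S pc (ps + pu) (W₁ ∩ W₂) (4 * ℓ) where
  zero_mem := ⟨h₁.zero_mem, h₂.zero_mem⟩
  invariant t z hz := ⟨h₁.invariant t z hz.1, h₂.invariant t z hz.2⟩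
  surj x hx := by
    have hcc : ∀ z, pc (pc z) = pc z := fun z => by simpa [hcs, hcu] using congrArg pc (hc₁ z)
    have hss : ∀ z, ps (ps z) = ps z := fun z => by simpa [hsc, hsu] using congrArg ps (hc₁ z)
    have huu : ∀ z, pu (pu z) = pu z := fun z => by simpa [huc, hus] using congrArg pu (hc₁ z)
    have hxs : ps x = 0 := by rw [← hx, hsc]
    have hxu : pu x = 0 := by rw [← hx, huc]
    choose! f hfW hfp using h₁.surj
    choose! g hgW hgp using h₂.surj
    have hf1 : ∀ w, (pc + ps) (x + ps w) = x + ps w := fun w => by simp [hx, hxs, hcs, hss]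
    have hg1 : ∀ w, (pc + pu) (x + pu w) = x + pu w := fun w => by simp [hx, hxu, hcu, huu]
    -- The unknown `w` carries the stable and unstable coordinates of a common point over `x`: the
    -- first manifold determines the unstable one from the stable one, the second the reverse. At a
    -- fixed point both sections equal `x + ps w + pu w`.
    let Φ : E → E := fun w => pu (f (x + ps w)) + ps (g (x + pu w))
    have hΦ : ContractingWith (1 / 2) Φ := by
      refine ⟨by rw [← NNReal.coe_lt_coe]; norm_num, LipschitzWith.of_dist_le_mul fun w v => ?_⟩
      have e1 := h₁.lip _ (hfW _ (hf1 w)) _ (hfW _ (hf1 v))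
      have e2 := h₂.lip _ (hgW _ (hg1 w)) _ (hgW _ (hg1 v))
      rw [map_sub (pc + ps), hfp _ (hf1 w), hfp _ (hf1 v), add_sub_add_left_eq_sub, ← map_sub] at e1
      rw [map_sub (pc + pu), hgp _ (hg1 w), hgp _ (hg1 v), add_sub_add_left_eq_sub, ← map_sub] at e2
      have e3 : Φ w - Φ v = pu (f (x + ps w) - f (x + ps v)) +
          ps (g (x + pu w) - g (x + pu v)) := by
        simp only [Φ, map_sub]; abel
      rw [dist_eq_norm, dist_eq_norm, e3]
      calc _ ≤ ℓ * (‖ps‖ * ‖w - v‖) + ℓ * (‖pu‖ * ‖w - v‖) := by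
            refine (norm_add_le _ _).trans (add_le_add (e1.trans ?_) (e2.trans ?_))
            · gcongr; exact ps.le_opNorm _
            · gcongr; exact pu.le_opNorm _
        _ = ℓ * (‖ps‖ + ‖pu‖) * ‖w - v‖ := by ring
        _ ≤ _ := by push_cast; gcongr
    obtain ⟨w, hw⟩ : ∃ w, Φ w = w := ⟨hΦ.fixedPoint, hΦ.fixedPoint_isFixedPt⟩
    have hwu : pu w = pu (f (x + ps w)) := by
      conv_lhs => rw [← hw]
      simp [Φ, huu, hus]
    have hws : ps w = ps (g (x + pu w)) := by
      conv_lhs => rw [← hw]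
      simp [Φ, hss, hsu]
    have k1 : f (x + ps w) = x + ps w + pu w := by
      have := hc₁ (f (x + ps w))
      have h3 := hfp _ (hf1 w)
      rw [ContinuousLinearMap.add_apply] at h3
      rw [← hwu, h3] at this
      exact this.symm
    have k2 : g (x + pu w) = x + ps w + pu w := by
      have := hc₁ (g (x + pu w))
      rw [← hws, add_right_comm] at this
      have h3 := hgp _ (hg1 w)
      rw [ContinuousLinearMap.add_apply] at h3
      rw [h3] at this
      rw [← this]; abel
    refine ⟨x + ps w + pu w, ⟨k1 ▸ hfW _ (hf1 w), k2 ▸ hgW _ (hg1 w)⟩, ?_⟩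
    simp [hx, hcs, hcu]
  lip z hz w hw := by
    have e1 := h₁.lip z hz.1 w hw.1
    have e2 := h₂.lip z hz.2 w hw.2
    exact (norm_add_le _ _).trans (norm_center_le hℓ0 hℓ e1 e2)
  bdd := by
    obtain ⟨M₁, h1⟩ := h₁.bdd
    obtain ⟨M₂, h2⟩ := h₂.bdd
    exact ⟨M₂ + M₁, fun z hz =>
      (norm_add_le _ _).trans (add_le_add (h2 z hz.2) (h1 z hz.1))⟩
  slow z C hC := by
    have hss : ∀ z, ps (ps z) = ps z := fun z => by simpa [hsc, hsu] using congrArg ps (hc₁ z)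
    have huu : ∀ z, pu (pu z) = pu z := fun z => by simpa [huc, hus] using congrArg pu (hc₁ z)
    have hcc : ∀ z, pc (pc z) = pc z := fun z => by simpa [hcs, hcu] using congrArg pc (hc₁ z)
    have hC0 : 0 ≤ C := by
      have := (norm_nonneg _).trans (hC 0)
      exact nonneg_of_mul_nonneg_left this (by positivity)
    -- Domination of `ps + pu` by `pc` passes to each summand, since `pc` factors through the larger
    -- slow projection `p'`.
    have key : ∀ (r p' : E →L[ℝ] E), (∀ w, r ((ps + pu) w) = r w) → (∀ w, pc (p' w) = pc w) →
        ∀ t, ‖r (S t z)‖ ≤ ‖r‖ * C * (1 + ‖pc‖) * (1 + ‖p' (S t z)‖) := by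
      intro r p' hr hp' t
      have h1 : ‖pc (S t z)‖ ≤ ‖pc‖ * ‖p' (S t z)‖ := by
        rw [← hp']; exact pc.le_opNorm _
      calc _ = ‖r ((ps + pu) (S t z))‖ := by rw [hr]
        _ ≤ ‖r‖ * (C * (1 + ‖pc (S t z)‖)) := (r.le_opNorm _).trans (by gcongr; exact hC t)
        _ ≤ ‖r‖ * (C * ((1 + ‖pc‖) * (1 + ‖p' (S t z)‖))) := by
          gcongr
          nlinarith [norm_nonneg pc, norm_nonneg (p' (S t z))]
        _ = _ := by ring
    exact ⟨h₁.slow z _ (key pu (pc + ps) (by simp [hus, huu]) (by simp [hcs, hcc])),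
      h₂.slow z _ (key ps (pc + pu) (by simp [hsu, hss]) (by simp [hcu, hcc]))⟩

theorem FlatAtZero.inter (h₁ : FlatAtZero (pc + ps) pu W₁) (h₂ : FlatAtZero (pc + pu) ps W₂)
    (h : SlowManifold S pc (ps + pu) (W₁ ∩ W₂) ℓ)
    (hsu : ∀ z, ps (pu z) = 0) (hss : ∀ z, ps (ps z) = ps z)
    (hus : ∀ z, pu (ps z) = 0) (huu : ∀ z, pu (pu z) = pu z) :
    FlatAtZero pc (ps + pu) (W₁ ∩ W₂) := by
  intro η hη
  have hη' : 0 < min (η / 4) (1 / 2) := by positivity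
  obtain ⟨r₁, hr₁, h1⟩ := h₁ _ hη'
  obtain ⟨r₂, hr₂, h2⟩ := h₂ _ hη'
  -- By the Lipschitz bound on the intersection, the norms of `pc z + ps z` and `pc z + pu z` are at
  -- most `A ‖pc z‖`.
  set A := 1 + ‖ps‖ * |ℓ| + ‖pu‖ * |ℓ| with hA
  have hA0 : 0 < A := by positivity
  refine ⟨min r₁ r₂ / A, by positivity, fun z hz hzr => ?_⟩
  rw [lt_div_iff₀ hA0] at hzr
  have h3 : ‖(ps + pu) z‖ ≤ |ℓ| * ‖pc z‖ := by
    have := h.lip z hz 0 h.zero_mem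
    rw [sub_zero] at this
    exact this.trans (by gcongr; exact le_abs_self ℓ)
  have hs : ‖ps z‖ ≤ ‖ps‖ * (|ℓ| * ‖pc z‖) := by
    have : ps z = ps ((ps + pu) z) := by simp [hss, hsu]
    rw [this]
    exact (ps.le_opNorm _).trans (by gcongr)
  have hu : ‖pu z‖ ≤ ‖pu‖ * (|ℓ| * ‖pc z‖) := by
    have : pu z = pu ((ps + pu) z) := by simp [huu, hus]
    rw [this]
    exact (pu.le_opNorm _).trans (by gcongr)
  have hmul : ‖pc z‖ * A = ‖pc z‖ + ‖ps‖ * (|ℓ| * ‖pc z‖) + ‖pu‖ * (|ℓ| * ‖pc z‖) := by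
    rw [hA]; ring
  have e1 := h1 z hz.1 (by
    refine lt_of_le_of_lt (norm_add_le (pc z) (ps z)) ?_
    have := min_le_left r₁ r₂
    have : 0 ≤ ‖pu‖ * (|ℓ| * ‖pc z‖) := by positivity
    linarith)
  have e2 := h2 z hz.2 (by
    refine lt_of_le_of_lt (norm_add_le (pc z) (pu z)) ?_
    have := min_le_right r₁ r₂
    have : 0 ≤ ‖ps‖ * (|ℓ| * ‖pc z‖) := by positivity
    linarith)
  have e3 := norm_center_le hη'.le (min_le_right _ _) e1 e2
  refine (norm_add_le _ _).trans (e3.trans ?_)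
  have := min_le_left (η / 4) (1 / 2)
  exact mul_le_mul_of_nonneg_right (by linarith) (norm_nonneg _)

end Center

end Manifolds

/-! ### The center-stable set as a slow manifold, and time reversal -/

section CenterStable

variable {E : Type*} [NormedAddCommGroup E] [NormedSpace ℝ E] [CompleteSpace E]
  {S : ℝ → E → E} {L p q : E →L[ℝ] E} {K b ε M ℓ : ℝ} {N : E → E}

theorem isBigO_exp_of_le {f : ℝ → E} {γ η C : ℝ} (hγ : γ ≤ η)
    (h : ∀ t, 0 ≤ t → ‖f t‖ ≤ C * Real.exp (γ * t)) :
    f =O[atTop] fun t : ℝ => Real.exp (η * t) := by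
  have hC : 0 ≤ C := by
    have := (norm_nonneg _).trans (h 0 le_rfl)
    simpa using this
  refine IsBigO.of_bound C ?_
  filter_upwards [eventually_ge_atTop 0] with t ht
  rw [Real.norm_of_nonneg (Real.exp_pos _).le]
  exact (h t ht).trans (by gcongr)

/-- Growth at the single rate `b / 2` already forces the straightened value to vanish, and vanishing
yields every rate `η`. The dichotomy constant may depend on the rate because `straightened` does not
involve it. -/
theorem centerStableSet_eq (hb : 0 < b) (hD : ∀ a, 0 < a → ∃ K, ExpDichotomy L p q K a b)
    (hS : IsFlowOf (fun z => L z + N z) S) (hN : ∀ z w, ‖N z - N w‖ ≤ ε * ‖z - w‖)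
    (hM : ∀ z, ‖N z‖ ≤ M) : centerStableSet S = {z | straightened L q N S z = 0} := by
  ext z
  constructor
  · intro hz
    obtain ⟨K, D⟩ := hD b hb
    exact D.straightened_eq_zero (γ := b / 2) (by linarith) (by linarith) hS hN hM
      (hz (b / 2) (by linarith))
  · intro hz η hη
    have hγ0 : 0 < min η (b / 2) := by positivity
    have hγb : min η (b / 2) < b := (min_le_right _ _).trans_lt (by linarith)
    obtain ⟨K, D⟩ := hD (min η (b / 2) / 2) (by linarith)
    exact isBigO_exp_of_le (min_le_left η (b / 2)) fun t ht =>
      D.norm_flow_le hγ0.le (by linarith) hγb hS (continuous_of_norm_sub_le hN) hM hz ht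

/-- The `p`-component grows slowly in any case, so an orbit whose `q`-component it dominates grows
slowly as a whole. -/
theorem mem_centerStableSet_of_dominated (hb : 0 < b)
    (hD : ∀ a, 0 < a → ∃ K, ExpDichotomy L p q K a b)
    (hS : IsFlowOf (fun z => L z + N z) S) (hN : ∀ z w, ‖N z - N w‖ ≤ ε * ‖z - w‖)
    (hM : ∀ z, ‖N z‖ ≤ M) {z : E} {C : ℝ} (hC : ∀ t, ‖q (S t z)‖ ≤ C * (1 + ‖p (S t z)‖)) :
    z ∈ centerStableSet S := by
  intro η hη
  have hC0 : 0 ≤ C := by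
    have := (norm_nonneg _).trans (hC 0)
    exact nonneg_of_mul_nonneg_left this (by positivity)
  have hγ0 : 0 < min η (b / 2) := by positivity
  have hγb : min η (b / 2) < b := (min_le_right _ _).trans_lt (by linarith)
  obtain ⟨K, D⟩ := hD (min η (b / 2) / 2) (by linarith)
  set γ := min η (b / 2)
  obtain ⟨C', hC'⟩ : ∃ C', ∀ t, 0 ≤ t → ‖p (S t z)‖ ≤ C' * Real.exp (γ * t) :=
    ⟨_, fun t ht => D.norm_p_flow_le hγ0.le (by linarith) hγb hS (continuous_of_norm_sub_le hN)
      hM hb z ht⟩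
  refine isBigO_exp_of_le (C := C' + C * (1 + C')) (min_le_left η (b / 2)) fun t ht => ?_
  have h1 : 1 ≤ Real.exp (γ * t) := Real.one_le_exp (by positivity)
  calc ‖S t z‖ = ‖p (S t z) + q (S t z)‖ := by rw [D.add_apply]
    _ ≤ C' * Real.exp (γ * t) + C * (1 + C' * Real.exp (γ * t)) := by
      refine (norm_add_le _ _).trans (add_le_add (hC' t ht) ((hC t).trans ?_))
      gcongr
      exact hC' t ht
    _ ≤ C' * Real.exp (γ * t) + C * (Real.exp (γ * t) + C' * Real.exp (γ * t)) := by gcongr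
    _ = _ := by ring

/-- Smallness of `ε` is needed only at the fixed rate `γ = b / 2` with `a = b / 4`, so it can be
fixed once for all growth rates. -/
theorem slowManifold_centerStableSet (hb : 0 < b)
    (hD : ∀ a, 0 < a → ∃ K, ExpDichotomy L p q K a b) (D : ExpDichotomy L p q K (b / 4) b)
    (hS : IsFlowOf (fun z => L z + N z) S) (hε : 0 ≤ ε)
    (hN : ∀ z w, ‖N z - N w‖ ≤ ε * ‖z - w‖) (hM : ∀ z, ‖N z‖ ≤ M) (hN0 : N 0 = 0)
    (hκ : K * (1 / (b / 2 - b / 4) + 1 / (b - b / 2)) * ε ≤ 1 / 2)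
    (hℓ : K * (1 / (b / 2 - b / 4) + 1 / (b - b / 2)) * (ε * (2 * K)) ≤ ℓ) :
    SlowManifold S p q (centerStableSet S) ℓ := by
  have hNc := continuous_of_norm_sub_le hN
  have hW := centerStableSet_eq hb hD hS hN hM
  have hS0 : ∀ t, S t 0 = 0 := hS.flow_zero (lipschitzWith_vectorField L hN) (by simp [hN0])
  refine ⟨?_, ?_, ?_, ?_, ?_, fun z C hC => mem_centerStableSet_of_dominated hb hD hS hN hM hC⟩
  all_goals rw [hW]
  · simp [straightened, hS0, hN0]
  · intro t z hz
    have hz' : straightened L q N S z = 0 := hz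
    change straightened L q N S (S t z) = 0
    rw [D.straightened_flow hb hS hN hM, hz', map_zero]
  · exact fun x hx => D.exists_straightened_eq_zero (γ := b / 2) (by linarith) (by linarith)
      (by linarith) hS hε hN hM hN0 hκ hx
  · exact fun z hz w hw => (D.norm_q_sub_le (γ := b / 2) (by linarith) (by linarith)
      (by linarith) hS hε hN hM hκ hz hw).trans (by gcongr)
  · refine ⟨K * M * (1 / b), fun z hz => ?_⟩
    have h1 := D.norm_straightened_sub_le hb hS hNc hM z
    have h2 : straightened L q N S z = 0 := hz
    rwa [h2, zero_sub, norm_neg] at h1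

theorem flatAtZero_centerStableSet (hb : 0 < b)
    (hD : ∀ a, 0 < a → ∃ K, ExpDichotomy L p q K a b) (D : ExpDichotomy L p q K (b / 4) b)
    (hS : IsFlowOf (fun z => L z + N z) S) (hε : 0 ≤ ε)
    (hN : ∀ z w, ‖N z - N w‖ ≤ ε * ‖z - w‖) (hM : ∀ z, ‖N z‖ ≤ M) (hN0 : N 0 = 0)
    (hκ : K * (1 / (b / 2 - b / 4) + 1 / (b - b / 2)) * ε ≤ 1 / 2)
    (hNd : HasFDerivAt N (0 : E →L[ℝ] E) 0) : FlatAtZero p q (centerStableSet S) := by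
  intro η hη
  rw [centerStableSet_eq hb hD hS hN hM]
  exact D.tangent (γ := b / 2) (γ' := 3 * b / 4) (by linarith) (by linarith)
      (by linarith) (by linarith) hS hε hN hM hN0 hκ hNd hη

omit [CompleteSpace E] [NormedSpace ℝ E] in
theorem centerUnstableSet_eq (S : ℝ → E → E) :
    centerUnstableSet S = centerStableSet fun t => S (-t) := by
  ext z
  refine forall₂_congr fun η _ => ⟨fun h => ?_, fun h => ?_⟩
  · simpa [Function.comp_def] using h.comp_tendsto tendsto_neg_atTop_atBot
  · simpa [Function.comp_def] using h.comp_tendsto tendsto_neg_atBot_atTop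

omit [CompleteSpace E] in
theorem IsFlowOf.reverse_linear_add (hS : IsFlowOf (fun z => L z + N z) S) :
    IsFlowOf (fun z => (-L) z + -N z) fun t => S (-t) := by
  have h : (fun z => (-L) z + -N z) = fun z => -(L z + N z) := by
    ext z; simp [add_comm]
  rw [h]
  exact hS.reverse

end CenterStable

/-! ### Existence of Jordan bases -/

section Jordan

variable {𝕜 : Type*} [Field 𝕜] {V : Type*} [AddCommGroup V] [Module 𝕜 V]

/-- Each `v k` is mapped by `T` to `μ k • v k`, or to `μ k • v k` plus the preceding vector. -/
def IsJordanFamily (T : Module.End 𝕜 V) {n : ℕ} (v : Fin n → V) (μ : Fin n → 𝕜) : Prop :=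
  ∀ k, T (v k) = μ k • v k ∨
    ∃ j : Fin n, (k : ℕ) = j + 1 ∧ μ j = μ k ∧ T (v k) = μ k • v k + v j

theorem IsJordanFamily.append {T : Module.End 𝕜 V} {m n : ℕ} {v : Fin m → V} {μ : Fin m → 𝕜}
    {w : Fin n → V} {ν : Fin n → 𝕜} (hv : IsJordanFamily T v μ) (hw : IsJordanFamily T w ν) :
    IsJordanFamily T (Fin.append v w) (Fin.append μ ν) := by
  intro k
  induction k using Fin.addCases with
  | left k =>
    rcases hv k with h | ⟨j, h1, h2, h3⟩
    · left; simpa using h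
    · right; exact ⟨Fin.castAdd n j, by simpa using h1, by simpa using h2, by simpa using h3⟩
  | right k =>
    rcases hw k with h | ⟨j, h1, h2, h3⟩
    · left; simpa using h
    · right
      exact ⟨Fin.natAdd m j, by simp [h1, add_assoc], by simpa using h2, by simpa using h3⟩

theorem IsJordanFamily.subtype {T : Module.End 𝕜 V} {W : Submodule 𝕜 V}
    (hW : ∀ x ∈ W, T x ∈ W) {n : ℕ} {v : Fin n → W} {μ : Fin n → 𝕜}
    (hv : IsJordanFamily (T.restrict hW) v μ) : IsJordanFamily T (fun k => (v k : V)) μ := by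
  intro k
  rcases hv k with h | ⟨j, h1, h2, h3⟩
  · left; simpa using congrArg Subtype.val h
  · right; exact ⟨j, h1, h2, by simpa using congrArg Subtype.val h3⟩

theorem append_eq_elim_comp {α : Type*} {m n : ℕ} (v : Fin m → α) (w : Fin n → α) :
    Fin.append v w = Sum.elim v w ∘ finSumFinEquiv.symm := by
  ext k
  induction k using Fin.addCases <;> simp

theorem span_range_append {m n : ℕ} (v : Fin m → V) (w : Fin n → V) :
    Submodule.span 𝕜 (Set.range (Fin.append v w)) =
      Submodule.span 𝕜 (Set.range v) ⊔ Submodule.span 𝕜 (Set.range w) := by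
  rw [← Submodule.span_union, append_eq_elim_comp, EquivLike.range_comp, Set.Sum.elim_range]

theorem linearIndependent_append {m n : ℕ} {v : Fin m → V} {w : Fin n → V}
    (hv : LinearIndependent 𝕜 v) (hw : LinearIndependent 𝕜 w)
    (h : Disjoint (Submodule.span 𝕜 (Set.range v)) (Submodule.span 𝕜 (Set.range w))) :
    LinearIndependent 𝕜 (Fin.append v w) := by
  have h1 := hv.sum_type hw h
  rw [append_eq_elim_comp]
  exact h1.comp _ finSumFinEquiv.symm.injective

/-- A cyclic subspace of maximal nilpotency index has an invariant complement. -/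
theorem exists_cyclic_split [FiniteDimensional 𝕜 V] (N : Module.End 𝕜 V) (hN : LinearMap.ker N ≠ ⊥) :
    ∃ (m : ℕ) (v : V) (W : Submodule 𝕜 V), 0 < m ∧ (N ^ m) v = 0 ∧ (∀ x ∈ W, N x ∈ W) ∧
      LinearIndependent 𝕜 (fun i : Fin m => (N ^ (i : ℕ)) v) ∧
      IsCompl (Submodule.span 𝕜 (Set.range fun i : Fin m => (N ^ (i : ℕ)) v)) W := by
  obtain ⟨m₀, hm₀⟩ := eventually_atTop.1 N.eventually_isCompl_ker_pow_range_pow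
  -- Fitting decomposition into the kernel and range of `N ^ r`. Taking `m₀ + 1` ensures `r ≥ 1`, so
  -- that `ker N` lies in the kernel of `N ^ r`.
  have hc := hm₀ (m₀ + 1) (by omega)
  set r := m₀ + 1
  have hex : ∃ m, LinearMap.ker (N ^ r) ≤ LinearMap.ker (N ^ m) := ⟨r, le_rfl⟩
  classical
  obtain ⟨m, hm, hmin⟩ : ∃ m, LinearMap.ker (N ^ r) ≤ LinearMap.ker (N ^ m) ∧
      ∀ i < m, ¬ LinearMap.ker (N ^ r) ≤ LinearMap.ker (N ^ i) :=
    ⟨Nat.find hex, Nat.find_spec hex, fun i hi => Nat.find_min hex hi⟩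
  have hmpos : 0 < m := by
    rcases Nat.eq_zero_or_pos m with rfl | h
    · exfalso
      apply hN
      rw [eq_bot_iff]
      refine le_trans (fun x hx => ?_) hm |>.trans_eq (by simp; rfl)
      rw [LinearMap.mem_ker] at hx ⊢
      rw [pow_succ, Module.End.mul_apply, hx, map_zero]
    · exact h
  obtain ⟨v, hvr, hv⟩ := SetLike.not_le_iff_exists.1 (hmin (m - 1) (by omega))
  have hvm : (N ^ m) v = 0 := hm hvr
  rw [LinearMap.mem_ker] at hv hvr
  have hnot : (N ^ (m - 1)) v ∉ LinearMap.range (N ^ r) := by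
    intro h
    refine hv (Submodule.disjoint_def.1 hc.disjoint _ ?_ h)
    rw [LinearMap.mem_ker, ← Module.End.mul_apply, ← pow_add, add_comm, pow_add,
      Module.End.mul_apply, hvr, map_zero]
  -- A functional that detects the last vector `N ^ (m - 1) v` of the chain and kills the range of
  -- `N ^ r`. The complement will be the common kernel of the functionals `f ∘ N ^ i`; as these
  -- vanish for `i ≥ m`, it is invariant.
  obtain ⟨f, hf1, hf2⟩ := Submodule.exists_le_ker_of_notMem hnot
  have hfm : ∀ i, m ≤ i → ∀ w, f ((N ^ i) w) = 0 := by
    intro i hi w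
    obtain ⟨k, hk, _, ⟨w', rfl⟩, rfl⟩ := Submodule.mem_sup.1 (hc.sup_eq_top ▸ Submodule.mem_top (x := w))
    have h1 : (N ^ i) k = 0 := by
      have h2 : (N ^ m) k = 0 := hm hk
      rw [← Nat.sub_add_cancel hi, pow_add, Module.End.mul_apply, h2, map_zero]
    rw [map_add, h1, zero_add, ← Module.End.mul_apply, ← pow_add, add_comm, pow_add,
      Module.End.mul_apply]
    exact hf2 ⟨_, rfl⟩
  let G : (Fin m → 𝕜) →ₗ[𝕜] V := Fintype.linearCombination 𝕜 (fun i : Fin m => (N ^ (i : ℕ)) v)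
  let Φ : V →ₗ[𝕜] (Fin m → 𝕜) := LinearMap.pi fun i => f ∘ₗ (N ^ (i : ℕ))
  have hΦ : ∀ w, Φ w = 0 → ∀ i, f ((N ^ i) w) = 0 := by
    intro w hw i
    rcases lt_or_ge i m with h | h
    · exact congrFun hw ⟨i, h⟩
    · exact hfm i h w
  -- The matrix of `Φ ∘ G` has entries `f (N ^ (i + j) v)`: zero for `i + j ≥ m`, nonzero for `i + j
  -- = m - 1`. It is anti-triangular, hence invertible.
  have hinj : Function.Injective (Φ ∘ₗ G) := by
    rw [← LinearMap.ker_eq_bot, LinearMap.ker_eq_bot']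
    intro a ha
    have hz := hΦ (G a) ha
    have hG : ∀ i, f ((N ^ i) (G a)) = ∑ j, a j * f ((N ^ (i + j)) v) := by
      intro i
      simp [G, Fintype.linearCombination_apply, pow_add]
    have : ∀ n, ∀ j : Fin m, (j : ℕ) = n → a j = 0 := by
      intro n
      induction n using Nat.strong_induction_on with
      | _ n ih =>
        intro j hj
        -- In row `m - 1 - j` the coefficients before `j` vanish by induction, and the later vectors
        -- are killed because the power reaches `m`.
        have h1 := hz (m - 1 - j)
        rw [hG, Finset.sum_eq_single j] at h1
        · rw [show m - 1 - (j : ℕ) + j = m - 1 by omega] at h1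
          exact (mul_eq_zero.1 h1).resolve_right hf1
        · intro i _ hij
          rcases lt_or_gt_of_ne (fun h => hij (Fin.ext h) : (i : ℕ) ≠ j) with h | h
          · rw [ih i (by omega) i rfl, zero_mul]
          · have : m ≤ m - 1 - j + i := by omega
            rw [← Nat.sub_add_cancel this, pow_add, Module.End.mul_apply, hvm]
            simp
        · simp
    exact funext fun j => this j j rfl
  have hsurj : Function.Surjective (Φ ∘ₗ G) := LinearMap.injective_iff_surjective.1 hinj
  have hrange : LinearMap.range G =
      Submodule.span 𝕜 (Set.range fun i : Fin m => (N ^ (i : ℕ)) v) :=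
    Fintype.range_linearCombination 𝕜 _
  refine ⟨m, v, LinearMap.ker Φ, hmpos, hvm, fun x hx => ?_, ?_, ?_⟩
  · rw [LinearMap.mem_ker] at hx ⊢
    ext i
    have := hΦ x hx (i + 1)
    rw [pow_succ, Module.End.mul_apply] at this
    exact this
  · rw [Fintype.linearIndependent_iff]
    intro a ha i
    have : (Φ ∘ₗ G) a = (Φ ∘ₗ G) 0 := by
      simp only [LinearMap.comp_apply, map_zero]
      rw [show G a = 0 from ha, map_zero]
    rw [hinj this]; rfl
  · rw [← hrange]
    refine ⟨Submodule.disjoint_def.2 ?_, codisjoint_iff.2 (eq_top_iff.2 fun w _ => ?_)⟩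
    · rintro _ ⟨a, rfl⟩ ha
      rw [LinearMap.mem_ker] at ha
      have : (Φ ∘ₗ G) a = (Φ ∘ₗ G) 0 := by simpa using ha
      rw [hinj this, map_zero]
    · obtain ⟨a, ha⟩ := hsurj (Φ w)
      rw [LinearMap.comp_apply] at ha
      refine Submodule.mem_sup.2 ⟨G a, ⟨a, rfl⟩, w - G a, ?_, by abel⟩
      rw [LinearMap.mem_ker, map_sub, ha, sub_self]

/-- The chain is listed in reverse, so that `N` sends each vector to the preceding one and the ones
land above the diagonal. -/
theorem isJordanFamily_cyclic (T : Module.End 𝕜 V) (c : 𝕜) {m : ℕ} (v : V)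
    (hv : ((T - c • 1) ^ m) v = 0) :
    IsJordanFamily T (fun k : Fin m => ((T - c • 1) ^ ((Fin.rev k : Fin m) : ℕ)) v)
      fun _ => c := by
  intro k
  set N := T - c • 1 with hN
  have hT : ∀ x, T x = c • x + N x := fun x => by simp [hN]
  have hs : ∀ i, N ((N ^ i) v) = (N ^ (i + 1)) v := fun i => by
    rw [pow_succ', Module.End.mul_apply]
  rcases Nat.eq_zero_or_pos (k : ℕ) with h | h
  · left
    rw [hT, hs, Fin.val_rev, show m - ((k : ℕ) + 1) + 1 = m by omega, hv, add_zero]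
  · right
    refine ⟨⟨k - 1, by omega⟩, by simp; omega, rfl, ?_⟩
    simp only
    rw [hT, hs]
    congr 3
    simp only [Fin.val_rev]
    omega

/-- Induction on the dimension: split off a longest chain for one eigenvalue and recurse on its
invariant complement. -/
theorem exists_jordanFamily [IsAlgClosed 𝕜] (n : ℕ) {V : Type*} [AddCommGroup V] [Module 𝕜 V]
    [FiniteDimensional 𝕜 V] (hn : Module.finrank 𝕜 V = n) (T : Module.End 𝕜 V) :
    ∃ (k : ℕ) (v : Fin k → V) (μ : Fin k → 𝕜), LinearIndependent 𝕜 v ∧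
      Submodule.span 𝕜 (Set.range v) = ⊤ ∧ IsJordanFamily T v μ := by
  induction n using Nat.strong_induction_on generalizing V with
  | _ n ih =>
  rcases subsingleton_or_nontrivial V with hV | hV
  · exact ⟨0, Fin.elim0, Fin.elim0, linearIndependent_empty_type,
      Subsingleton.elim _ _, fun k => k.elim0⟩
  obtain ⟨c, hc⟩ := Module.End.exists_eigenvalue T
  have hker : LinearMap.ker (T - c • 1) ≠ ⊥ := by
    rw [← Module.End.eigenspace_def]; exact hc
  obtain ⟨m, v, W, hm, hv, hW, hli, hcompl⟩ := exists_cyclic_split _ hker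
  have hWT : ∀ x ∈ W, T x ∈ W := by
    intro x hx
    have h1 : T x = c • x + (T - c • 1) x := by
      simp
    rw [h1]
    exact W.add_mem (W.smul_mem c hx) (hW x hx)
  have hne : W ≠ ⊤ := by
    rintro rfl
    have h1 := hcompl.disjoint
    rw [disjoint_top, Submodule.span_eq_bot] at h1
    exact hli.ne_zero ⟨0, hm⟩ (h1 _ ⟨⟨0, hm⟩, rfl⟩)
  obtain ⟨k, w, ν, hw1, hw2, hw3⟩ := ih _ (hn ▸ Submodule.finrank_lt hne) rfl (T.restrict hWT)
  have hw4 : Submodule.span 𝕜 (Set.range fun i => (w i : V)) = W := by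
    have h1 := congrArg (Submodule.map W.subtype) hw2
    rw [Submodule.map_span, Submodule.map_top, Submodule.range_subtype, ← Set.range_comp] at h1
    exact h1
  have hrev : Submodule.span 𝕜 (Set.range fun i : Fin m =>
      ((T - c • 1) ^ ((Fin.rev i : Fin m) : ℕ)) v) =
      Submodule.span 𝕜 (Set.range fun i : Fin m => ((T - c • 1) ^ (i : ℕ)) v) := by
    congr 1
    exact Fin.rev_surjective.range_comp
      (fun i : Fin m => ((T - c • 1) ^ (i : ℕ)) v)
  have hli' : LinearIndependent 𝕜 fun i : Fin m => ((T - c • 1) ^ ((Fin.rev i : Fin m) : ℕ)) v :=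
    hli.comp _ Fin.rev_injective
  have hw1' : LinearIndependent 𝕜 fun i => (w i : V) := hw1.map' W.subtype W.ker_subtype
  refine ⟨m + k, Fin.append _ _, Fin.append _ _, linearIndependent_append hli' hw1' ?_, ?_,
    (isJordanFamily_cyclic T c v hv).append hw3.subtype⟩
  · rw [hrev, hw4]
    exact hcompl.disjoint
  · rw [span_range_append, hrev, hw4, hcompl.sup_eq_top]

end Jordan

/-! ### Spans of generalized eigenspaces -/

section ComplexSpectral

variable {V : Type*} [AddCommGroup V] [Module ℂ V]

/-- The span of the generalized eigenvectors of `T` with eigenvalues in `Λ`. -/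
def genEigenspan (T : Module.End ℂ V) (Λ : Set ℂ) : Submodule ℂ V :=
  ⨆ μ ∈ Λ, Module.End.maxGenEigenspace T μ

variable {T : Module.End ℂ V} {Λ Λ' : Set ℂ}

theorem maxGenEigenspace_le_genEigenspan (T : Module.End ℂ V) {μ : ℂ} (hμ : μ ∈ Λ) :
    Module.End.maxGenEigenspace T μ ≤ genEigenspan T Λ :=
  le_iSup₂_of_le μ hμ le_rfl

theorem map_mem_genEigenspan {x : V} (hx : x ∈ genEigenspan T Λ) : T x ∈ genEigenspan T Λ := by
  have h : genEigenspan T Λ ≤ (genEigenspan T Λ).comap T :=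
    iSup₂_le fun μ hμ y hy => maxGenEigenspace_le_genEigenspan T hμ
      (Module.End.mapsTo_maxGenEigenspace_of_comm (Commute.refl T) μ hy)
  exact h hx

/-- Independence of the generalized eigenspaces. This identifies the eigenvalues that occur in a
Jordan basis of a spectral span. -/
theorem mem_of_mem_genEigenspan {μ : ℂ} {x : V} (hx0 : x ≠ 0)
    (hμ : x ∈ Module.End.maxGenEigenspace T μ) (hx : x ∈ genEigenspan T Λ) : μ ∈ Λ := by
  by_contra h
  have := T.independent_maxGenEigenspace.disjoint_biSup h
  exact hx0 (Submodule.disjoint_def.1 this x hμ hx)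

theorem disjoint_genEigenspan (h : Disjoint Λ Λ') :
    Disjoint (genEigenspan T Λ) (genEigenspan T Λ') := by
  exact T.independent_maxGenEigenspace.disjoint_biSup_biSup h

theorem maxGenEigenspace_eq_bot {μ : ℂ} (h : ¬ T.HasEigenvalue μ) :
    Module.End.maxGenEigenspace T μ = ⊥ := by
  by_contra h1
  exact h ((Module.End.hasUnifEigenvalue_iff_hasUnifEigenvalue_one (k := ⊤) (by simp)).1 h1)

theorem genEigenspan_sup_eq_top [FiniteDimensional ℂ V] (h : ∀ μ, T.HasEigenvalue μ → μ ∈ Λ ∪ Λ') :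
    genEigenspan T Λ ⊔ genEigenspan T Λ' = ⊤ := by
  rw [eq_top_iff, ← Module.End.iSup_maxGenEigenspace_eq_top T]
  refine iSup_le fun μ => ?_
  by_cases hμ : T.HasEigenvalue μ
  · rcases h μ hμ with h1 | h1
    · exact (maxGenEigenspace_le_genEigenspan T h1).trans le_sup_left
    · exact (maxGenEigenspace_le_genEigenspan T h1).trans le_sup_right
  · rw [maxGenEigenspace_eq_bot hμ]
    exact bot_le

theorem IsJordanFamily.mem_maxGenEigenspace {n : ℕ} {v : Fin n → V} {μ : Fin n → ℂ}
    (h : IsJordanFamily T v μ) (k : Fin n) : v k ∈ Module.End.maxGenEigenspace T (μ k) := by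
  obtain ⟨k, hk⟩ := k
  induction k with
  | zero =>
    rcases h ⟨0, hk⟩ with h1 | ⟨j, h1, -⟩
    · exact (Module.End.mem_maxGenEigenspace _ _ _).2 ⟨1, by simp [h1]⟩
    · simp at h1
  | succ k ih =>
    rcases h ⟨k + 1, hk⟩ with h1 | ⟨j, h1, h2, h3⟩
    · exact (Module.End.mem_maxGenEigenspace _ _ _).2 ⟨1, by simp [h1]⟩
    · have hj : j = ⟨k, by omega⟩ := Fin.ext (by simpa using h1.symm)
      obtain ⟨m, hm⟩ := (Module.End.mem_maxGenEigenspace _ _ _).1 (ih (by omega))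
      rw [← hj, h2] at hm
      refine (Module.End.mem_maxGenEigenspace _ _ _).2 ⟨m + 1, ?_⟩
      rw [pow_succ, Module.End.mul_apply]
      simpa [h3] using hm

/-- A Jordan basis of the span of the generalized eigenvectors with eigenvalues in `Λ`. -/
theorem exists_jordanFamily_genEigenspan [FiniteDimensional ℂ V] (T : Module.End ℂ V)
    (Λ : Set ℂ) : ∃ (k : ℕ) (v : Fin k → V) (μ : Fin k → ℂ), LinearIndependent ℂ v ∧
      Submodule.span ℂ (Set.range v) = genEigenspan T Λ ∧ IsJordanFamily T v μ ∧
      ∀ i, μ i ∈ Λ := by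
  have hW : ∀ x ∈ genEigenspan T Λ, T x ∈ genEigenspan T Λ := fun x hx => map_mem_genEigenspan hx
  obtain ⟨k, v, μ, h1, h2, h3⟩ := exists_jordanFamily _ rfl (T.restrict hW)
  have h1' : LinearIndependent ℂ fun i => (v i : V) :=
    h1.map' (genEigenspan T Λ).subtype (Submodule.ker_subtype _)
  refine ⟨k, fun i => v i, μ, h1', ?_, h3.subtype, fun i => mem_of_mem_genEigenspan (T := T)
    (h1'.ne_zero i) (h3.subtype.mem_maxGenEigenspace i) (v i).2⟩
  have h4 := congrArg (Submodule.map (genEigenspan T Λ).subtype) h2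
  rw [Submodule.map_span, Submodule.map_top, Submodule.range_subtype, ← Set.range_comp] at h4
  exact h4

end ComplexSpectral

/-! ### The ordered Jordan form of `A` -/

section JordanForm

theorem IsJordanFamily.toMatrix {n : ℕ} {V : Type*} [AddCommGroup V] [Module ℂ V]
    {T : Module.End ℂ V} (b : Module.Basis (Fin n) ℂ V) {μ : Fin n → ℂ}
    (h : IsJordanFamily T b μ) : IsJordanMatrix (LinearMap.toMatrix b b T) ∧
      ∀ i, LinearMap.toMatrix b b T i i = μ i := by
  have hentry : ∀ i k, LinearMap.toMatrix b b T i k = b.repr (T (b k)) i := fun i k =>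
    LinearMap.toMatrix_apply _ _ _ _ _
  have hdiag : ∀ i, LinearMap.toMatrix b b T i i = μ i := by
    intro i
    rw [hentry]
    rcases h i with h1 | ⟨j, h1, -, h3⟩
    · simp [h1]
    · have : j ≠ i := fun hj => by rw [hj] at h1; omega
      simp [h3, this]
  refine ⟨fun i k hik => ?_, hdiag⟩
  rw [hdiag, hdiag, hentry]
  rcases h k with h1 | ⟨j, h1, h2, h3⟩
  · left
    simp [h1, hik.symm]
  · by_cases hj : j = i
    · right
      subst hj
      refine ⟨h1, ?_, h2⟩
      simp [h3, hik.symm]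
    · left
      simp [h3, hik.symm, hj]

theorem IsJordanMatrix.roots_charpoly {n : ℕ} {J : Matrix (Fin n) (Fin n) ℂ}
    (h : IsJordanMatrix J) : J.charpoly.roots = Finset.univ.val.map fun i => J i i := by
  have hup : J.IsUpperTriangular := by
    intro i j hij
    rcases h i j (ne_of_gt hij) with h1 | ⟨h1, -⟩
    · exact h1
    · have : (j : ℕ) < i := hij
      omega
  rw [Matrix.charpoly_of_isUpperTriangular _ hup]
  have := Polynomial.roots_multiset_prod_X_sub_C (Finset.univ.val.map fun i => J i i)
  rwa [Multiset.map_map] at this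

variable {u s : ℕ} {A : Matrix (Fin (u + s)) (Fin (u + s)) ℝ}

theorem hasEigenvalue_iff_mem_complexEigenvalues {n : ℕ} (A : Matrix (Fin n) (Fin n) ℝ) (μ : ℂ) :
    Module.End.HasEigenvalue (Matrix.toLin' (A.map Complex.ofReal)) μ ↔
      μ ∈ complexEigenvalues A := by
  rw [Module.End.hasEigenvalue_iff_isRoot_charpoly, Matrix.charpoly_toLin', complexEigenvalues,
    Polynomial.mem_roots (Matrix.charpoly_monic _).ne_zero]

/-- The two counts already exhaust the degree `u + s` of the characteristic polynomial, leaving no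
root on the imaginary axis. -/
theorem re_ne_zero_of_countP
    (hu : (complexEigenvalues A).countP (fun μ => 0 < μ.re) = u)
    (hs : (complexEigenvalues A).countP (fun μ => μ.re < 0) = s) :
    ∀ μ ∈ complexEigenvalues A, μ.re ≠ 0 := by
  have hadd : ∀ M : Multiset ℂ, M.countP (fun μ => 0 < μ.re) + M.countP (fun μ => μ.re < 0) =
      M.countP (fun μ => μ.re ≠ 0) := by
    intro M
    induction M using Multiset.induction with
    | empty => simp
    | cons a M ih =>
      simp only [Multiset.countP_cons]
      rcases lt_trichotomy a.re 0 with h | h | h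
      · simp [h, h.ne, not_lt.2 h.le, ← ih]; omega
      · simp [h, ← ih]
      · simp [h, h.ne', not_lt.2 h.le, ← ih]; omega
  have hcard : (complexEigenvalues A).card = u + s := by
    rw [complexEigenvalues, IsAlgClosed.card_roots_eq_natDegree, Matrix.charpoly_natDegree_eq_dim,
      Fintype.card_fin]
  refine Multiset.countP_eq_card.1 ?_
  rw [← hadd, hu, hs, hcard]

/-- The Jordan normal form with the eigenvalues of positive real part first. -/
theorem exists_jordanForm
    (hu : (complexEigenvalues A).countP (fun μ => 0 < μ.re) = u)
    (hs : (complexEigenvalues A).countP (fun μ => μ.re < 0) = s) :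
    ∃ (J : Matrix (Fin (u + s)) (Fin (u + s)) ℂ) (X : GL (Fin (u + s)) ℂ),
      IsJordanMatrix J ∧
      J = (↑X⁻¹ : Matrix (Fin (u + s)) (Fin (u + s)) ℂ) * A.map Complex.ofReal *
        (↑X : Matrix _ _ ℂ) ∧
      (∀ j : Fin (u + s), (j : ℕ) < u → 0 < (J j j).re) ∧
      (∀ j : Fin (u + s), u ≤ (j : ℕ) → (J j j).re < 0) ∧
      (∀ x ∈ genEigenspan (Matrix.toLin' (A.map Complex.ofReal)) {μ | 0 < μ.re},
        ∀ j : Fin (u + s), u ≤ (j : ℕ) → ((↑X⁻¹ : Matrix _ _ ℂ).mulVec x) j = 0) ∧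
      (∀ x ∈ genEigenspan (Matrix.toLin' (A.map Complex.ofReal)) {μ | μ.re < 0},
        ∀ j : Fin (u + s), (j : ℕ) < u → ((↑X⁻¹ : Matrix _ _ ℂ).mulVec x) j = 0) := by
  set T := Matrix.toLin' (A.map Complex.ofReal) with hT
  obtain ⟨k, v, μ, hv1, hv2, hv3, hv4⟩ := exists_jordanFamily_genEigenspan T {μ | 0 < μ.re}
  obtain ⟨l, w, ν, hw1, hw2, hw3, hw4⟩ := exists_jordanFamily_genEigenspan T {μ | μ.re < 0}
  have hdisj : Disjoint (genEigenspan T {μ | 0 < μ.re}) (genEigenspan T {μ | μ.re < 0}) :=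
    disjoint_genEigenspan (Set.disjoint_left.2 fun μ (h1 : 0 < μ.re) (h2 : μ.re < 0) =>
      lt_asymm h1 h2)
  have htop : genEigenspan T {μ | 0 < μ.re} ⊔ genEigenspan T {μ | μ.re < 0} = ⊤ := by
    refine genEigenspan_sup_eq_top fun μ hμ => ?_
    have := re_ne_zero_of_countP hu hs μ ((hasEigenvalue_iff_mem_complexEigenvalues A μ).1 hμ)
    exact this.lt_or_gt.symm
  have hli := linearIndependent_append hv1 hw1 (by rw [hv2, hw2]; exact hdisj)
  have hsp : ⊤ ≤ Submodule.span ℂ (Set.range (Fin.append v w)) := by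
    rw [span_range_append, hv2, hw2, htop]
  let b := Module.Basis.mk hli hsp
  have hb : ⇑b = Fin.append v w := Module.Basis.coe_mk hli hsp
  have hJ := IsJordanFamily.toMatrix (T := T) b (μ := Fin.append μ ν)
    (by rw [hb]; exact hv3.append hw3)
  have hroots : complexEigenvalues A = Finset.univ.val.map (Fin.append μ ν) := by
    have h1 := hJ.1.roots_charpoly
    rw [LinearMap.charpoly_toMatrix, hT, Matrix.charpoly_toLin'] at h1
    rw [complexEigenvalues, h1]
    exact Multiset.map_congr rfl fun i _ => hJ.2 i
  have hkl : k + l = u + s := by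
    have h1 := congrArg Multiset.card hroots
    rw [complexEigenvalues, IsAlgClosed.card_roots_eq_natDegree,
      Matrix.charpoly_natDegree_eq_dim] at h1
    simpa using h1.symm
  -- The diagonal lists the eigenvalues with multiplicity, so the size of the unstable block is the
  -- number of roots with positive real part.
  have hk : k = u := by
    rw [← hu, hroots, Multiset.countP_map, ← Finset.filter_val, Finset.card_val,
      Finset.card_filter, Fin.sum_univ_add]
    have h1 : ∀ i, ¬ 0 < (ν i).re := fun i => not_lt.2 (le_of_lt (hw4 i))
    have h2 : ∀ i, 0 < (μ i).re := hv4
    simp [h1, h2]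
  subst hk
  obtain rfl : l = s := by omega
  let e : Module.Basis (Fin (k + l)) ℂ (Fin (k + l) → ℂ) := Pi.basisFun ℂ (Fin (k + l))
  -- The columns are the Jordan basis, so the inverse matrix reads off coordinates in it; vectors of
  -- one spectral span have no coordinates in the other block.
  let X : GL (Fin (k + l)) ℂ := ⟨e.toMatrix b, b.toMatrix e, e.toMatrix_mul_toMatrix_flip b,
    b.toMatrix_mul_toMatrix_flip e⟩
  have hXinv : ∀ x j, ((↑X⁻¹ : Matrix _ _ ℂ).mulVec x) j = b.repr x j := by
    intro x j
    have : (b.toMatrix e).mulVec (e.repr x) = b.repr x := Module.Basis.toMatrix_mulVec_repr _ _ _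
    exact congrFun this j
  refine ⟨LinearMap.toMatrix b b T, X, hJ.1, ?_, ?_, ?_, ?_, ?_⟩
  · have h1 := basis_toMatrix_mul_linearMap_toMatrix_mul_basis_toMatrix b e b e T
    rw [← h1]
    congr 2
    rw [hT, ← LinearMap.toMatrix'_toLin' (A.map Complex.ofReal)]
    simp [e, LinearMap.toMatrix_eq_toMatrix']
  · intro j hj
    rw [hJ.2]
    obtain ⟨i, rfl⟩ : ∃ i, j = Fin.castAdd l i := ⟨⟨j, hj⟩, rfl⟩
    rw [Fin.append_left]
    exact hv4 _
  · intro j hj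
    rw [hJ.2]
    obtain ⟨i, rfl⟩ : ∃ i, j = Fin.natAdd k i := ⟨⟨j - k, by omega⟩, Fin.ext (by simp; omega)⟩
    rw [Fin.append_right]
    exact hw4 _
  · intro x hx j hj
    rw [hXinv]
    rw [← hv2] at hx
    have hle : Submodule.span ℂ (Set.range v) ≤ LinearMap.ker (b.coord j) := by
      rw [Submodule.span_le]
      rintro _ ⟨i, rfl⟩
      have : v i = b (Fin.castAdd l i) := by rw [hb, Fin.append_left]
      have hne : Fin.castAdd l i ≠ j := fun h => by
        have := congrArg Fin.val h
        simp at this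
        omega
      rw [SetLike.mem_coe, LinearMap.mem_ker, this]
      simp [hne]
    exact hle hx
  · intro x hx j hj
    rw [hXinv]
    rw [← hw2] at hx
    have hle : Submodule.span ℂ (Set.range w) ≤ LinearMap.ker (b.coord j) := by
      rw [Submodule.span_le]
      rintro _ ⟨i, rfl⟩
      have : w i = b (Fin.natAdd k i) := by rw [hb, Fin.append_right]
      have hne : Fin.natAdd k i ≠ j := fun h => by
        have := congrArg Fin.val h
        simp at this
        omega
      rw [SetLike.mem_coe, LinearMap.mem_ker, this]
      simp [hne]
    exact hle hx

end JordanForm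

/-! ### Real spectral subspaces -/

section RealSpectral

variable {n : ℕ} {A : Matrix (Fin n) (Fin n) ℝ} {Λ Λ' : Set ℂ}

theorem mem_spectralSubspace {y : EuclideanSpace ℝ (Fin n)} :
    y ∈ spectralSubspace A Λ ↔
      complexify n y ∈ genEigenspan (Matrix.toLin' (A.map Complex.ofReal)) Λ := Iff.rfl

theorem complexify_injective : Function.Injective (complexify n) := fun x y h => by
  ext i
  exact Complex.ofReal_injective (congrFun h i)

theorem complexify_toEuclideanCLM (A : Matrix (Fin n) (Fin n) ℝ)
    (y : EuclideanSpace ℝ (Fin n)) :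
    complexify n (Matrix.toEuclideanCLM (𝕜 := ℝ) A y) =
      Matrix.toLin' (A.map Complex.ofReal) (complexify n y) := by
  ext i
  simp [complexify, Matrix.mulVec, dotProduct, Matrix.ofLp_toEuclideanCLM]

/-- Componentwise complex conjugation. -/
noncomputable def conjVec (n : ℕ) : (Fin n → ℂ) →ₛₗ[starRingEnd ℂ] (Fin n → ℂ) where
  toFun x i := starRingEnd ℂ (x i)
  map_add' x y := by ext i; simp
  map_smul' a x := by ext i; simp

theorem conjVec_toLin' (A : Matrix (Fin n) (Fin n) ℝ) (x : Fin n → ℂ) :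
    conjVec n (Matrix.toLin' (A.map Complex.ofReal) x) =
      Matrix.toLin' (A.map Complex.ofReal) (conjVec n x) := by
  ext i
  simp [conjVec, Matrix.mulVec, dotProduct]

theorem conjVec_mem_genEigenspan (hΛ : ∀ μ ∈ Λ, starRingEnd ℂ μ ∈ Λ) {x : Fin n → ℂ}
    (hx : x ∈ genEigenspan (Matrix.toLin' (A.map Complex.ofReal)) Λ) :
    conjVec n x ∈ genEigenspan (Matrix.toLin' (A.map Complex.ofReal)) Λ := by
  set T := Matrix.toLin' (A.map Complex.ofReal) with hT
  have hpow : ∀ (μ : ℂ) (k : ℕ) (x : Fin n → ℂ),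
      ((T - starRingEnd ℂ μ • 1) ^ k) (conjVec n x) = conjVec n (((T - μ • 1) ^ k) x) := by
    intro μ k
    induction k with
    | zero => intro x; simp
    | succ k ih =>
      intro x
      rw [pow_succ, pow_succ, Module.End.mul_apply, Module.End.mul_apply, ← ih]
      congr 1
      simp only [LinearMap.sub_apply, LinearMap.smul_apply, Module.End.one_apply, map_sub,
        map_smulₛₗ]
      rw [hT, conjVec_toLin']
  have hle : genEigenspan T Λ ≤ (genEigenspan T Λ).comap (conjVec n) := by
    refine iSup₂_le fun μ hμ y hy => maxGenEigenspace_le_genEigenspan T (hΛ μ hμ) ?_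
    obtain ⟨k, hk⟩ := (Module.End.mem_maxGenEigenspace _ _ _).1 hy
    exact (Module.End.mem_maxGenEigenspace _ _ _).2 ⟨k, by rw [hpow, hk, map_zero]⟩
  exact hle hx

/-- The complex splitting of a real vector is conjugation invariant when `Λ` and `Λ'` are, so its
two components are real. -/
theorem isCompl_spectralSubspace (hΛ : ∀ μ ∈ Λ, starRingEnd ℂ μ ∈ Λ)
    (hΛ' : ∀ μ ∈ Λ', starRingEnd ℂ μ ∈ Λ') (hd : Disjoint Λ Λ')
    (hc : ∀ μ ∈ complexEigenvalues A, μ ∈ Λ ∪ Λ') :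
    IsCompl (spectralSubspace A Λ) (spectralSubspace A Λ') := by
  set T := Matrix.toLin' (A.map Complex.ofReal) with hT
  have hdisj : Disjoint (genEigenspan T Λ) (genEigenspan T Λ') := disjoint_genEigenspan hd
  have htop : genEigenspan T Λ ⊔ genEigenspan T Λ' = ⊤ :=
    genEigenspan_sup_eq_top fun μ hμ =>
      hc μ ((hasEigenvalue_iff_mem_complexEigenvalues A μ).1 hμ)
  refine ⟨Submodule.disjoint_def.2 fun y h1 h2 => ?_,
    codisjoint_iff.2 (eq_top_iff.2 fun y _ => ?_)⟩
  · refine complexify_injective ?_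
    rw [map_zero]
    exact Submodule.disjoint_def.1 hdisj _ h1 h2
  · obtain ⟨a, ha, b, hb, hab⟩ := Submodule.mem_sup.1
      (htop ▸ Submodule.mem_top (x := complexify n y))
    have hcy : conjVec n (complexify n y) = complexify n y := by
      ext i; simp [conjVec, complexify]
    have hsub : conjVec n a - a = b - conjVec n b := by
      have : conjVec n a + conjVec n b = a + b := by rw [← map_add, hab, hcy]
      rw [sub_eq_sub_iff_add_eq_add, this, add_comm]
    -- This difference lies in both spectral spans, which are disjoint.
    have hz : conjVec n a - a = 0 :=
      Submodule.disjoint_def.1 hdisj _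
        (Submodule.sub_mem _ (conjVec_mem_genEigenspan hΛ ha) ha)
        (hsub ▸ Submodule.sub_mem _ hb (conjVec_mem_genEigenspan hΛ' hb))
    have hreal : ∀ x, conjVec n x - x = 0 →
        complexify n (WithLp.toLp 2 fun i => (x i).re) = x := by
      intro x hx
      ext i
      exact Complex.conj_eq_iff_re.1 (congrFun (sub_eq_zero.1 hx) i)
    have hzb : conjVec n b - b = 0 := by
      rw [hz, eq_comm, sub_eq_zero] at hsub
      rw [← hsub, sub_self]
    refine Submodule.mem_sup.2 ⟨WithLp.toLp 2 fun i => (a i).re, ?_,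
      WithLp.toLp 2 fun i => (b i).re, ?_, ?_⟩
    · rw [mem_spectralSubspace, hreal a hz]; exact ha
    · rw [mem_spectralSubspace, hreal b hzb]; exact hb
    · refine complexify_injective ?_
      rw [map_add, hreal a hz, hreal b hzb, hab]

theorem toEuclideanCLM_mem_spectralSubspace {y : EuclideanSpace ℝ (Fin n)}
    (hy : y ∈ spectralSubspace A Λ) :
    Matrix.toEuclideanCLM (𝕜 := ℝ) A y ∈ spectralSubspace A Λ := by
  rw [mem_spectralSubspace, complexify_toEuclideanCLM]
  exact map_mem_genEigenspan hy

end RealSpectral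

/-! ### Growth of the linear flow on spectral subspaces -/

section ExponentialBounds

theorem exists_one_add_pow_le (m : ℕ) {ε : ℝ} (hε : 0 < ε) :
    ∃ C, ∀ t, 0 ≤ t → (1 + t) ^ m ≤ C * Real.exp (ε * t) := by
  set ε' := ε / (m + 1)
  have hε' : 0 < ε' := by positivity
  refine ⟨(1 + 1 / ε') ^ m, fun t ht => ?_⟩
  have h1 : 1 + t ≤ (1 + 1 / ε') * Real.exp (ε' * t) := by
    have h2 := Real.add_one_le_exp (ε' * t)
    calc 1 + t ≤ (1 + 1 / ε') * (ε' * t + 1) := by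
          have : 0 ≤ ε' * t + 1 / ε' := by positivity
          field_simp at this ⊢
          nlinarith [mul_nonneg hε'.le ht]
      _ ≤ _ := by gcongr
  calc (1 + t) ^ m ≤ ((1 + 1 / ε') * Real.exp (ε' * t)) ^ m := by gcongr
    _ = (1 + 1 / ε') ^ m * Real.exp (m * (ε' * t)) := by rw [mul_pow, Real.exp_nat_mul]
    _ ≤ _ := by
      have : m * ε' ≤ ε := by
        rw [mul_div_assoc', div_le_iff₀ (by positivity)]
        nlinarith
      refine mul_le_mul_of_nonneg_left (Real.exp_le_exp.2 ?_) (by positivity)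
      rw [← mul_assoc]
      gcongr

variable {n : ℕ} {L : (Fin n → ℂ) →L[ℝ] (Fin n → ℂ)} {T : Module.End ℂ (Fin n → ℂ)}

theorem expL_complex_smul (hL : ∀ x, L x = T x) (t : ℝ) (μ : ℂ) (x : Fin n → ℂ) :
    expL L t (μ • x) = μ • expL L t x := by
  let f : (Fin n → ℂ) →L[ℝ] (Fin n → ℂ) :=
    LinearMap.toContinuousLinearMap ((LinearMap.lsmul ℂ (Fin n → ℂ) μ).restrictScalars ℝ)
  have hf : ∀ x, f x = μ • x := fun _ => rfl
  have := expL_comm_apply (L := L) (q := f) (fun z => by rw [hf, hf, hL, hL, map_smul]) t x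
  rw [hf, hf] at this
  exact this.symm

/-- Differentiating `exp (-μ t) exp (t L) v` replaces `v` by `(T - μ) v`, of lower nilpotency order.
The mean value inequality then costs one factor `1 + |t|` per step. -/
theorem exists_norm_expL_le_of_pow_eq_zero (hL : ∀ x, L x = T x) (μ : ℂ) (m : ℕ) :
    ∀ v, ((T - μ • 1) ^ m) v = 0 →
      ∃ C, ∀ t : ℝ, ‖expL L t v‖ ≤ C * (1 + |t|) ^ m * Real.exp (μ.re * t) := by
  induction m with
  | zero =>
    intro v hv
    have : v = 0 := by simpa using hv
    exact ⟨0, fun t => by simp [this]⟩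
  | succ m ih =>
    intro v hv
    rw [pow_succ, Module.End.mul_apply] at hv
    obtain ⟨C, hC⟩ := ih _ hv
    set v' := (T - μ • 1) v with hv'
    have hLv : L v = μ • v + v' := by simp [hv', hL]
    have hC0 : 0 ≤ C := by
      have := (norm_nonneg _).trans (hC 0)
      simpa using this
    have hderiv : ∀ t : ℝ, HasDerivAt (fun τ : ℝ => Complex.exp (-(μ * τ)) • expL L τ v)
        (Complex.exp (-(μ * t)) • expL L t v') t := by
      intro t
      have h1 : HasDerivAt (fun τ : ℝ => Complex.exp (-(μ * τ)))
          (Complex.exp (-(μ * t)) * -μ) t := by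
        have h2 : HasDerivAt (fun τ : ℝ => -(μ * (τ : ℂ))) (-μ) t := by
          simpa using ((hasDerivAt_id t).ofReal_comp.const_mul μ).fun_neg
        exact h2.cexp
      have h3 : HasDerivAt (fun τ : ℝ => expL L τ v) (L (expL L t v)) t := by
        simpa using hasDerivAt_expL_apply L (hasDerivAt_const t v)
      have h4 : L (expL L t v) = μ • expL L t v + expL L t v' := by
        rw [expL_comm_apply (q := L) (fun _ => rfl), hLv, map_add, expL_complex_smul hL]
      refine (h1.smul h3).congr_deriv ?_
      rw [h4]
      module
    have hnorm : ∀ (t : ℝ) (x : Fin n → ℂ),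
        ‖Complex.exp (-(μ * t)) • x‖ = Real.exp (-(μ.re * t)) * ‖x‖ := by
      intro t x
      rw [norm_smul, Complex.norm_exp]
      simp
    refine ⟨‖v‖ + C, fun t => ?_⟩
    have hbound : ∀ τ ∈ Set.uIcc 0 t,
        ‖Complex.exp (-(μ * τ)) • expL L τ v'‖ ≤ C * (1 + |t|) ^ m := by
      intro τ hτ
      have hτt : |τ| ≤ |t| := by
        have := Set.abs_sub_left_of_mem_uIcc hτ
        simpa using this
      rw [hnorm, Real.exp_neg, inv_mul_le_iff₀ (Real.exp_pos _), mul_comm (Real.exp _)]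
      refine (hC τ).trans ?_
      gcongr
    have hmv := (convex_uIcc (0 : ℝ) t).norm_image_sub_le_of_norm_hasDerivWithin_le
      (fun τ _ => (hderiv τ).hasDerivWithinAt) hbound Set.left_mem_uIcc Set.right_mem_uIcc
    simp only [Complex.ofReal_zero, mul_zero, neg_zero, Complex.exp_zero, one_smul,
      expL_zero_apply, sub_zero, Real.norm_eq_abs] at hmv
    have h5 := (norm_le_norm_add_norm_sub' _ v).trans (add_le_add_right hmv ‖v‖)
    rw [hnorm, Real.exp_neg, inv_mul_le_iff₀ (Real.exp_pos _), mul_comm (Real.exp _)] at h5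
    refine h5.trans ?_
    gcongr
    have h6 : 1 ≤ (1 + |t|) ^ (m + 1) := one_le_pow₀ (by linarith [abs_nonneg t])
    have h7 : (1 + |t|) ^ m * |t| ≤ (1 + |t|) ^ (m + 1) := by
      rw [pow_succ]
      gcongr
      linarith
    have h8 : ‖v‖ ≤ ‖v‖ * (1 + |t|) ^ (m + 1) := le_mul_of_one_le_right (norm_nonneg _) h6
    nlinarith

/-- The strict inequality leaves room to absorb the polynomial factor. The parameter `θ` treats
forward and backward time together. -/
theorem exists_norm_expL_le_of_mem_maxGenEigenspace (hL : ∀ x, L x = T x) {μ : ℂ}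
    {v : Fin n → ℂ} (hv : v ∈ Module.End.maxGenEigenspace T μ) {θ a : ℝ} (hθ : |θ| ≤ 1)
    (ha : θ * μ.re < a) :
    ∃ C, ∀ t, 0 ≤ t → ‖expL L (θ * t) v‖ ≤ C * Real.exp (a * t) := by
  obtain ⟨m, hm⟩ := (Module.End.mem_maxGenEigenspace _ _ _).1 hv
  obtain ⟨C, hC⟩ := exists_norm_expL_le_of_pow_eq_zero hL μ m v hm
  obtain ⟨C', hC'⟩ := exists_one_add_pow_le m (sub_pos.2 ha)
  have hC0 : 0 ≤ C := by
    have := (norm_nonneg _).trans (hC 0)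
    simpa using this
  refine ⟨C * C', fun t ht => (hC _).trans ?_⟩
  have h1 : |θ * t| ≤ t := by
    rw [abs_mul, abs_of_nonneg ht]
    exact mul_le_of_le_one_left ht hθ
  calc _ ≤ C * (1 + t) ^ m * Real.exp (μ.re * (θ * t)) := by gcongr
    _ ≤ C * (C' * Real.exp ((a - θ * μ.re) * t)) * Real.exp (μ.re * (θ * t)) := by
      gcongr
      exact hC' t ht
    _ = C * C' * (Real.exp ((a - θ * μ.re) * t) * Real.exp (μ.re * (θ * t))) := by ring
    _ = _ := by rw [← Real.exp_add]; congr 2; ring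

theorem exists_norm_expL_le_of_mem_genEigenspan (hL : ∀ x, L x = T x) {Λ : Set ℂ}
    {v : Fin n → ℂ} (hv : v ∈ genEigenspan T Λ) {θ a : ℝ} (hθ : |θ| ≤ 1)
    (ha : ∀ μ ∈ Λ, T.HasEigenvalue μ → θ * μ.re < a) :
    ∃ C, ∀ t, 0 ≤ t → ‖expL L (θ * t) v‖ ≤ C * Real.exp (a * t) := by
  let W : Submodule ℂ (Fin n → ℂ) :=
    { carrier := {v | ∃ C, ∀ t, 0 ≤ t → ‖expL L (θ * t) v‖ ≤ C * Real.exp (a * t)}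
      zero_mem' := ⟨0, fun t _ => by simp⟩
      add_mem' := by
        rintro x y ⟨C, hC⟩ ⟨C', hC'⟩
        refine ⟨C + C', fun t ht => ?_⟩
        rw [map_add, add_mul]
        exact (norm_add_le _ _).trans (add_le_add (hC t ht) (hC' t ht))
      smul_mem' := by
        rintro c x ⟨C, hC⟩
        refine ⟨‖c‖ * C, fun t ht => ?_⟩
        rw [expL_complex_smul hL, norm_smul, mul_assoc]
        exact mul_le_mul_of_nonneg_left (hC t ht) (norm_nonneg _) }
  have hle : genEigenspan T Λ ≤ W := by
    refine iSup₂_le fun μ hμ x hx => ?_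
    by_cases h : T.HasEigenvalue μ
    · exact exists_norm_expL_le_of_mem_maxGenEigenspace hL hx hθ (ha μ hμ h)
    · rw [maxGenEigenspace_eq_bot h, Submodule.mem_bot] at hx
      rw [hx]
      exact W.zero_mem
  exact hle hv

/-- The flow of a real matrix on a spectral subspace grows at a rate governed by the
eigenvalues. -/
theorem exists_norm_expL_le_of_mem_spectralSubspace (A : Matrix (Fin n) (Fin n) ℝ) {Λ : Set ℂ}
    {y : EuclideanSpace ℝ (Fin n)} (hy : y ∈ spectralSubspace A Λ) {θ a : ℝ} (hθ : |θ| ≤ 1)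
    (ha : ∀ μ ∈ Λ, μ ∈ complexEigenvalues A → θ * μ.re < a) :
    ∃ C, ∀ t, 0 ≤ t →
      ‖expL (Matrix.toEuclideanCLM (𝕜 := ℝ) A) (θ * t) y‖ ≤ C * Real.exp (a * t) := by
  set T := Matrix.toLin' (A.map Complex.ofReal) with hT
  let L : (Fin n → ℂ) →L[ℝ] (Fin n → ℂ) :=
    LinearMap.toContinuousLinearMap (T.restrictScalars ℝ)
  let f : EuclideanSpace ℝ (Fin n) →L[ℝ] (Fin n → ℂ) :=
    LinearMap.toContinuousLinearMap (complexify n)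
  have hf : ∀ y, f y = complexify n y := fun _ => rfl
  obtain ⟨C, hC⟩ := exists_norm_expL_le_of_mem_genEigenspan (L := L) (T := T) (fun _ => rfl)
    hy hθ fun μ hμ h => ha μ hμ ((hasEigenvalue_iff_mem_complexEigenvalues A μ).1 h)
  -- An injective linear map on a finite-dimensional space is bounded below, so the complex bound
  -- descends to the real flow.
  obtain ⟨c, -, hc⟩ := f.toLinearMap.exists_antilipschitzWith
    (LinearMap.ker_eq_bot.2 complexify_injective)
  refine ⟨c * C, fun t ht => ?_⟩
  have h1 := hc.le_mul_dist (expL (Matrix.toEuclideanCLM (𝕜 := ℝ) A) (θ * t) y) 0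
  rw [map_zero, dist_zero_right, dist_zero_right] at h1
  have h2 : f (expL (Matrix.toEuclideanCLM (𝕜 := ℝ) A) (θ * t) y) = expL L (θ * t) (f y) :=
    expL_intertwine f (fun z => complexify_toEuclideanCLM A z) _ _
  change _ ≤ _ * ‖f _‖ at h1
  rw [h2] at h1
  rw [mul_assoc]
  exact h1.trans (mul_le_mul_of_nonneg_left (hC t ht) c.2)

end ExponentialBounds

/-! ### Dichotomies on the state space -/

section StateSpaceDichotomy

/-- Pointwise exponential bounds are uniform. -/
theorem exists_uniform_norm_expL_le {E : Type*} [NormedAddCommGroup E] [NormedSpace ℝ E]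
    [CompleteSpace E] (L q : E →L[ℝ] E) (θ a : ℝ)
    (h : ∀ z, ∃ C, ∀ t, 0 ≤ t → ‖expL L (θ * t) (q z)‖ ≤ C * Real.exp (a * t)) :
    ∃ K, 0 ≤ K ∧ ∀ t, 0 ≤ t → ∀ z, ‖expL L (θ * t) (q z)‖ ≤ K * Real.exp (a * t) * ‖z‖ := by
  obtain ⟨K, hK⟩ := banach_steinhaus
    (g := fun t : {t : ℝ // 0 ≤ t} => Real.exp (-(a * t)) • (expL L (θ * t) * q)) (by
      intro z
      obtain ⟨C, hC⟩ := h z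
      refine ⟨C, fun t => ?_⟩
      rw [ContinuousLinearMap.smul_apply, norm_smul, Real.norm_of_nonneg (Real.exp_pos _).le,
        Real.exp_neg, inv_mul_le_iff₀ (Real.exp_pos _), mul_comm (Real.exp _)]
      exact hC t t.2)
  refine ⟨max K 0, le_max_right _ _, fun t ht z => ?_⟩
  have h1 := (ContinuousLinearMap.le_of_opNorm_le _ (hK ⟨t, ht⟩) z)
  rw [ContinuousLinearMap.smul_apply, norm_smul, Real.norm_of_nonneg (Real.exp_pos _).le,
    Real.exp_neg, inv_mul_le_iff₀ (Real.exp_pos _)] at h1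
  calc _ ≤ _ := h1
    _ = K * (Real.exp (a * t) * ‖z‖) := by ring
    _ ≤ max K 0 * (Real.exp (a * t) * ‖z‖) := by gcongr; exact le_max_left _ _
    _ = _ := by ring

theorem exists_complProj {E : Type*} [NormedAddCommGroup E] [NormedSpace ℝ E]
    [FiniteDimensional ℝ E] {P Q : Submodule ℝ E} (h : IsCompl P Q) :
    ∃ p q : E →L[ℝ] E, ComplProj p q P Q := by
  refine ⟨LinearMap.toContinuousLinearMap (P.projection Q h),
    LinearMap.toContinuousLinearMap (Q.projection P h.symm), ?_, ?_, ?_, ?_, ?_⟩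
  · intro z
    exact Submodule.projection_add_projection_eq_self h z
  · intro z
    exact Submodule.projection_apply_mem h z
  · intro z
    exact Submodule.projection_apply_mem h.symm z
  · intro z hz
    exact (Submodule.projection_eq_self_iff h z).2 hz
  · intro z hz
    exact (Submodule.projection_eq_self_iff h.symm z).2 hz

theorem ComplProj.comm {E : Type*} [NormedAddCommGroup E] [NormedSpace ℝ E]
    {P Q : Submodule ℝ E} {p q L : E →L[ℝ] E} (h : ComplProj p q P Q)
    (hP : ∀ z ∈ P, L z ∈ P) (hQ : ∀ z ∈ Q, L z ∈ Q) (z : E) : q (L z) = L (q z) := by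
  conv_lhs => rw [← h.add_apply z]
  rw [map_add, map_add, h.q_eq_zero (hP _ (h.p_mem z)), h.q_eq _ (hQ _ (h.q_mem z)), zero_add]

variable {c n : ℕ}

/-- The linear part `(B x, A y)`. -/
noncomputable def linearPart (B : Matrix (Fin c) (Fin c) ℝ) (A : Matrix (Fin n) (Fin n) ℝ) :
    StateSpace c n →L[ℝ] StateSpace c n :=
  (Matrix.toEuclideanCLM (𝕜 := ℝ) B).prodMap (Matrix.toEuclideanCLM (𝕜 := ℝ) A)

/-- The projection `(x, y) ↦ (x, 0)`. -/
noncomputable def centerProj (c n : ℕ) : StateSpace c n →L[ℝ] StateSpace c n :=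
  (ContinuousLinearMap.fst ℝ _ _).prod 0

/-- The operator `(x, y) ↦ (0, r y)`. -/
noncomputable def hyperbolicPart (c : ℕ)
    (r : EuclideanSpace ℝ (Fin n) →L[ℝ] EuclideanSpace ℝ (Fin n)) :
    StateSpace c n →L[ℝ] StateSpace c n :=
  (0 : StateSpace c n →L[ℝ] _).prod (r ∘L ContinuousLinearMap.snd ℝ _ _)

@[simp] theorem centerProj_apply (z : StateSpace c n) : centerProj c n z = (z.1, 0) := rfl

@[simp] theorem hyperbolicPart_apply
    (r : EuclideanSpace ℝ (Fin n) →L[ℝ] EuclideanSpace ℝ (Fin n)) (z : StateSpace c n) :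
    hyperbolicPart c r z = (0, r z.2) := rfl

theorem expL_linearPart (B : Matrix (Fin c) (Fin c) ℝ) (A : Matrix (Fin n) (Fin n) ℝ) (t : ℝ)
    (z : StateSpace c n) : expL (linearPart B A) t z =
      (expL (Matrix.toEuclideanCLM (𝕜 := ℝ) B) t z.1,
        expL (Matrix.toEuclideanCLM (𝕜 := ℝ) A) t z.2) :=
  Prod.ext
    (expL_intertwine (L := linearPart B A) (ContinuousLinearMap.fst ℝ _ _) (fun _ => rfl) t z)
    (expL_intertwine (L := linearPart B A) (ContinuousLinearMap.snd ℝ _ _) (fun _ => rfl) t z)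

theorem expL_smul {E : Type*} [NormedAddCommGroup E] [NormedSpace ℝ E] (L : E →L[ℝ] E)
    (θ t : ℝ) : expL (θ • L) t = expL L (θ * t) := by
  rw [expL, expL, smul_smul, mul_comm]

/-- The center has spectrum on the imaginary axis, so it grows slower than `exp (a t)` for every `a
> 0`, and it joins the slow side for both time directions `θ = 1` and `θ = -1`. -/
theorem exists_expDichotomy_linearPart {B : Matrix (Fin c) (Fin c) ℝ}
    {A : Matrix (Fin n) (Fin n) ℝ}
    (hB : ∀ μ ∈ complexEigenvalues B, μ.re = 0) {Λ Λ' : Set ℂ}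
    {r q : EuclideanSpace ℝ (Fin n) →L[ℝ] EuclideanSpace ℝ (Fin n)}
    (hc : ComplProj r q (spectralSubspace A Λ) (spectralSubspace A Λ')) {θ b : ℝ} (hθ : |θ| ≤ 1)
    (hΛ : ∀ μ ∈ Λ, μ ∈ complexEigenvalues A → θ * μ.re < 0)
    (hΛ' : ∀ μ ∈ Λ', μ ∈ complexEigenvalues A → b < θ * μ.re) {a : ℝ} (ha : 0 < a) :
    ∃ K, ExpDichotomy (θ • linearPart B A) (centerProj c n + hyperbolicPart c r)
      (hyperbolicPart c q) K a b := by
  have hBtop : ∀ x, x ∈ spectralSubspace B Set.univ := by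
    intro x
    rw [mem_spectralSubspace]
    have := genEigenspan_sup_eq_top (T := Matrix.toLin' (B.map Complex.ofReal))
      (Λ := Set.univ) (Λ' := Set.univ) (by simp)
    rw [sup_idem] at this
    rw [this]
    exact Submodule.mem_top
  obtain ⟨K₁, hK₁, h1⟩ := exists_uniform_norm_expL_le (linearPart B A)
    (centerProj c n + hyperbolicPart c r) θ a (by
      intro z
      obtain ⟨C, hC⟩ := exists_norm_expL_le_of_mem_spectralSubspace B (hBtop z.1) hθ
        (a := a) fun μ _ hμ => by rw [hB μ hμ, mul_zero]; exact ha
      obtain ⟨C', hC'⟩ := exists_norm_expL_le_of_mem_spectralSubspace A (hc.p_mem z.2) hθ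
        (a := a) fun μ hμ hμ' => (hΛ μ hμ hμ').trans ha
      refine ⟨max C C', fun t ht => ?_⟩
      rw [expL_linearPart]
      rw [Prod.norm_def]
      refine max_le ?_ ?_
      · refine le_trans ?_ ((hC t ht).trans (by gcongr; exact le_max_left _ _))
        simp
      · refine le_trans ?_ ((hC' t ht).trans (by gcongr; exact le_max_right _ _))
        simp)
  obtain ⟨K₂, hK₂, h2⟩ := exists_uniform_norm_expL_le (linearPart B A)
    (hyperbolicPart c q) (-θ) (-b) (by
      intro z
      obtain ⟨C', hC'⟩ := exists_norm_expL_le_of_mem_spectralSubspace A (hc.q_mem z.2)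
        (θ := -θ) (by rwa [abs_neg]) (a := -b) fun μ hμ hμ' => by
          have := hΛ' μ hμ hμ'
          linarith
      have hC0 : 0 ≤ C' := by
        have := (norm_nonneg _).trans (hC' 0 le_rfl)
        simpa using this
      refine ⟨C', fun t ht => ?_⟩
      rw [expL_linearPart]
      rw [Prod.norm_def]
      refine max_le ?_ ?_
      · simp only [hyperbolicPart_apply, map_zero, norm_zero]
        positivity
      · exact hC' t ht)
  refine ⟨max K₁ K₂, hK₁.trans (le_max_left _ _), ?_, ?_, ?_, ?_, ?_, ?_⟩
  · intro z
    refine Prod.ext (by simp) ?_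
    simpa using hc.add_apply z.2
  · intro z
    refine Prod.ext (by simp) ?_
    simpa using hc.p_eq_zero (hc.q_mem z.2)
  · intro z
    refine Prod.ext (by simp) ?_
    simpa using hc.q_eq_zero (hc.p_mem z.2)
  · intro z
    have := hc.comm (L := Matrix.toEuclideanCLM (𝕜 := ℝ) A)
      (fun z hz => toEuclideanCLM_mem_spectralSubspace hz)
      (fun z hz => toEuclideanCLM_mem_spectralSubspace hz) z.2
    refine Prod.ext (by simp [linearPart]) ?_
    simp [linearPart, this]
  · intro t ht z
    rw [expL_smul]
    refine (h1 t ht z).trans ?_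
    gcongr
    exact le_max_left _ _
  · intro t ht z
    rw [expL_smul, mul_neg, ← neg_mul]
    refine (h2 t ht z).trans ?_
    gcongr
    exact le_max_right _ _

theorem complProj_withCenter {Y Y' : Submodule ℝ (EuclideanSpace ℝ (Fin n))}
    {r q : EuclideanSpace ℝ (Fin n) →L[ℝ] EuclideanSpace ℝ (Fin n)} (hc : ComplProj r q Y Y') :
    ComplProj (centerProj c n + hyperbolicPart c r) (hyperbolicPart c q)
      (withCenter c Y) (withoutCenter c Y') where
  add_apply z := Prod.ext (by simp) (by simpa using hc.add_apply z.2)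
  p_mem z := Submodule.mem_prod.2 ⟨trivial, by simpa using hc.p_mem z.2⟩
  q_mem z := Submodule.mem_prod.2 ⟨by simp, hc.q_mem z.2⟩
  p_eq z hz := Prod.ext (by simp) (by simpa using hc.p_eq z.2 (Submodule.mem_prod.1 hz).2)
  q_eq z hz := Prod.ext (by simpa using (Submodule.mem_prod.1 hz).1.symm)
    (hc.q_eq z.2 (Submodule.mem_prod.1 hz).2)

theorem exists_pos_lt_abs_re (M : Multiset ℂ) (h : ∀ μ ∈ M, μ.re ≠ 0) :
    ∃ b : ℝ, 0 < b ∧ ∀ μ ∈ M, b < |μ.re| := by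
  induction M using Multiset.induction with
  | empty => exact ⟨1, one_pos, by simp⟩
  | cons a M ih =>
    obtain ⟨b, hb, hbM⟩ := ih fun μ hμ => h μ (Multiset.mem_cons_of_mem hμ)
    have ha : 0 < |a.re| := abs_pos.2 (h a (Multiset.mem_cons_self _ _))
    refine ⟨min b (|a.re| / 2), by positivity, fun μ hμ => ?_⟩
    rcases Multiset.mem_cons.1 hμ with rfl | hμ
    · exact (min_le_right _ _).trans_lt (by linarith)
    · exact (min_le_left _ _).trans_lt (hbM μ hμ)

end StateSpaceDichotomy

/-! ### Koopman eigenfunctions from the Jordan coordinates -/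

section Eigenfunctions

theorem IsJordanMatrix.exists_koopmanNilpotent {E : Type*} [NormedAddCommGroup E]
    [NormedSpace ℝ E] {S : ℝ → E → E} {n : ℕ} {J : Matrix (Fin n) (Fin n) ℂ}
    (hJ : IsJordanMatrix J) {σ : Fin n → E → ℂ} (hσ : ∀ j, Continuous (σ j))
    (hd : ∀ j z t, HasDerivAt (fun τ => koopman S τ (σ j) z)
      (∑ k, J j k * koopman S t (σ k) z) t) (j : Fin n) :
    ∃ m, KoopmanNilpotent S (J j j) m (σ j) := by
  -- Induction runs from the last row upwards: each row of `J` couples `σ j` at most to the next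
  -- function, which has the same diagonal entry.
  obtain ⟨d, hd'⟩ : ∃ d, d = n - (j : ℕ) := ⟨_, rfl⟩
  induction d generalizing j with
  | zero => omega
  | succ d ih =>
    by_cases h : ∃ k, k ≠ j ∧ J j k ≠ 0
    · obtain ⟨k, hkj, hk⟩ := h
      obtain ⟨h1, h2, h3⟩ := (hJ j k hkj.symm).resolve_left hk
      obtain ⟨m, hm⟩ := ih k (by omega)
      refine ⟨m + 1, hσ j, σ k, h3 ▸ hm, fun z t => ?_⟩
      refine (hd j z t).congr_deriv ?_
      rw [Finset.sum_eq_add j k hkj.symm]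
      · rw [h2, one_mul]
      · rintro i - ⟨hij, hik⟩
        rcases hJ j i hij.symm with h4 | ⟨h4, -⟩
        · rw [h4, zero_mul]
        · exact absurd (Fin.ext (h4.trans h1.symm)) hik
      · simp
      · simp
    · push Not at h
      refine ⟨1, hσ j, 0, rfl, fun z t => ?_⟩
      refine (hd j z t).congr_deriv ?_
      rw [Finset.sum_eq_single j (fun i _ hij => by rw [h i hij, zero_mul]) (by simp)]
      simp [koopman]

variable {c n : ℕ}

/-- A linear relation among the `σ j` makes the same combination of linear coordinates bounded on
`{0} × ℝ^n`. A bounded linear function is zero, and the coordinates are independent because `X` is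
invertible. -/
theorem linearIndependent_of_bounded_sub (X : GL (Fin n) ℂ) {σ : Fin n → StateSpace c n → ℂ}
    {M : ℝ} (h : ∀ j z,
      ‖σ j z - ((↑X⁻¹ : Matrix (Fin n) (Fin n) ℂ).mulVec (complexify n z.2)) j‖ ≤ M) :
    LinearIndependent ℂ σ := by
  rw [Fintype.linearIndependent_iff]
  intro a ha
  set Y : Matrix (Fin n) (Fin n) ℂ := (↑X⁻¹ : Matrix (Fin n) (Fin n) ℂ) with hY
  have hbd : ∀ y, ‖∑ j, a j * Y.mulVec (complexify n y) j‖ ≤ ∑ j, ‖a j‖ * M := by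
    intro y
    have h1 : ∑ j, a j * σ j (0, y) = 0 := by
      have := congrFun ha (0, y)
      simpa using this
    have h2 : ∑ j, a j * Y.mulVec (complexify n y) j =
        -∑ j, a j * (σ j (0, y) - Y.mulVec (complexify n y) j) := by
      simp only [mul_sub, Finset.sum_sub_distrib, h1, zero_sub, neg_neg]
    rw [h2, norm_neg]
    refine (norm_sum_le _ _).trans (Finset.sum_le_sum fun j _ => ?_)
    rw [norm_mul]
    exact mul_le_mul_of_nonneg_left (h j (0, y)) (norm_nonneg _)
  have hzero : ∀ y, ∑ j, a j * Y.mulVec (complexify n y) j = 0 := by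
    intro y
    by_contra hne
    have hpos := norm_pos_iff.2 hne
    obtain ⟨k, hk⟩ := exists_nat_gt ((∑ j, ‖a j‖ * M) /
      ‖∑ j, a j * Y.mulVec (complexify n y) j‖)
    rw [div_lt_iff₀ hpos] at hk
    have h1 := hbd ((k : ℝ) • y)
    have h2 : ∑ j, a j * Y.mulVec (complexify n ((k : ℝ) • y)) j =
        (k : ℂ) * ∑ j, a j * Y.mulVec (complexify n y) j := by
      have : complexify n ((k : ℝ) • y) = (k : ℂ) • complexify n y := by
        ext i; simp [complexify]
      rw [this, Matrix.mulVec_smul, Finset.mul_sum]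
      refine Finset.sum_congr rfl fun j _ => ?_
      rw [Pi.smul_apply, smul_eq_mul]
      ring
    rw [h2, norm_mul, Complex.norm_natCast] at h1
    linarith
  have hvec : Matrix.vecMul a Y = 0 := by
    ext i
    have h1 := hzero (EuclideanSpace.single i 1)
    have h2 : complexify n (EuclideanSpace.single i 1) = Pi.single i 1 := by
      ext k
      by_cases hk : k = i
      · subst hk; simp [complexify]
      · simp [complexify, hk]
    rw [h2] at h1
    simpa [Matrix.vecMul, dotProduct] using h1
  have hYX : Y * (X : Matrix (Fin n) (Fin n) ℂ) = 1 := by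
    rw [hY]; exact X.inv_mul
  have := congrArg (fun v => Matrix.vecMul v (X : Matrix (Fin n) (Fin n) ℂ)) hvec
  simp only [Matrix.vecMul_vecMul, hYX, Matrix.vecMul_one, Matrix.zero_vecMul] at this
  exact fun i => congrFun this i

variable {u s : ℕ} {A : Matrix (Fin (u + s)) (Fin (u + s)) ℝ}

/-- Eigenfunctions from observables that linearize the unstable and the stable dynamics. -/
theorem exists_eigenfunctions
    (hu : (complexEigenvalues A).countP (fun μ => 0 < μ.re) = u)
    (hs : (complexEigenvalues A).countP (fun μ => μ.re < 0) = s)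
    {S : ℝ → StateSpace c (u + s) → StateSpace c (u + s)}
    {Gu Gs : StateSpace c (u + s) → EuclideanSpace ℝ (Fin (u + s))}
    (hGu : Continuous Gu) (hGs : Continuous Gs)
    (hGum : ∀ z, Gu z ∈ unstableSubspace A) (hGsm : ∀ z, Gs z ∈ stableSubspace A)
    (hGuS : ∀ z t, Gu (S t z) = expL (Matrix.toEuclideanCLM (𝕜 := ℝ) A) t (Gu z))
    (hGsS : ∀ z t, Gs (S t z) = expL (Matrix.toEuclideanCLM (𝕜 := ℝ) A) t (Gs z))
    {M : ℝ} (hM : ∀ z, ‖Gu z + Gs z - z.2‖ ≤ M) :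
    ∃ (J : Matrix (Fin (u + s)) (Fin (u + s)) ℂ) (σ : Fin (u + s) → StateSpace c (u + s) → ℂ),
      IsJordanFormOf J A ∧
      (∀ j : Fin (u + s), (j : ℕ) < u → 0 < (J j j).re) ∧
      (∀ j : Fin (u + s), u ≤ (j : ℕ) → (J j j).re < 0) ∧
      (∀ j, Continuous (σ j)) ∧
      LinearIndependent ℂ σ ∧
      (∀ j, IsGeneralizedKoopmanEigenfunction S (J j j) (σ j)) ∧
      (∀ j z t, HasDerivAt (fun τ => koopman S τ (σ j) z)
        (∑ k, J j k * koopman S t (σ k) z) t) ∧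
      (∀ z, (∀ j : Fin (u + s), (j : ℕ) < u → σ j z = 0) ↔ Gu z = 0) ∧
      (∀ z, (∀ j : Fin (u + s), u ≤ (j : ℕ) → σ j z = 0) ↔ Gs z = 0) := by
  obtain ⟨J, X, hJ, hJX, hpos, hneg, hXu, hXs⟩ := exists_jordanForm hu hs
  set Y : Matrix (Fin (u + s)) (Fin (u + s)) ℂ := (↑X⁻¹ : Matrix (Fin (u + s)) (Fin (u + s)) ℂ) with hY
  have hXY : (X : Matrix (Fin (u + s)) (Fin (u + s)) ℂ) * Y = 1 := by
    rw [hY]; exact X.mul_inv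
  let f : EuclideanSpace ℝ (Fin (u + s)) →L[ℝ] (Fin (u + s) → ℂ) :=
    LinearMap.toContinuousLinearMap ((Y.mulVecLin.restrictScalars ℝ) ∘ₗ complexify (u + s))
  have hf : ∀ y, f y = Y.mulVec (complexify (u + s) y) := fun _ => rfl
  have hfA : ∀ y, f (Matrix.toEuclideanCLM (𝕜 := ℝ) A y) = J.mulVec (f y) := by
    intro y
    rw [hf, hf, complexify_toEuclideanCLM, Matrix.toLin'_apply, Matrix.mulVec_mulVec,
      Matrix.mulVec_mulVec, hJX, Matrix.mul_assoc (Y * _), hXY, Matrix.mul_one]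
  have hfinj : ∀ y, f y = 0 → y = 0 := by
    intro y hy
    refine complexify_injective ?_
    rw [map_zero, ← Matrix.one_mulVec (complexify (u + s) y), ← hXY, ← Matrix.mulVec_mulVec,
      ← hf, hy, Matrix.mulVec_zero]
  -- Since `Gu` and `Gs` occupy complementary blocks of Jordan coordinates, the first `u` functions
  -- see only `Gu` and the last `s` only `Gs`.
  let σ : Fin (u + s) → StateSpace c (u + s) → ℂ := fun j z => f (Gu z + Gs z) j
  have hσc : ∀ j, Continuous (σ j) := fun j =>
    (continuous_apply j).comp (f.continuous.comp (hGu.add hGs))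
  have hσS : ∀ j t z, koopman S t (σ j) z =
      f (expL (Matrix.toEuclideanCLM (𝕜 := ℝ) A) t (Gu z + Gs z)) j := by
    intro j t z
    simp only [koopman, σ, hGuS, hGsS, map_add]
  have hσd : ∀ j z t, HasDerivAt (fun τ => koopman S τ (σ j) z)
      (∑ k, J j k * koopman S t (σ k) z) t := by
    intro j z t
    simp only [hσS]
    have h1 : HasDerivAt (fun τ => expL (Matrix.toEuclideanCLM (𝕜 := ℝ) A) τ (Gu z + Gs z))
        (Matrix.toEuclideanCLM (𝕜 := ℝ) A
          (expL (Matrix.toEuclideanCLM (𝕜 := ℝ) A) t (Gu z + Gs z))) t := by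
      simpa using hasDerivAt_expL_apply (Matrix.toEuclideanCLM (𝕜 := ℝ) A)
        (hasDerivAt_const t (Gu z + Gs z))
    have h2 := f.hasFDerivAt.comp_hasDerivAt t h1
    rw [hfA] at h2
    exact hasDerivAt_pi.1 h2 j
  have hli : LinearIndependent ℂ σ := by
    refine linearIndependent_of_bounded_sub (M := ‖f‖ * M) X fun j z => ?_
    rw [← hY, ← hf]
    calc _ = ‖f (Gu z + Gs z - z.2) j‖ := by rw [map_sub, Pi.sub_apply]
      _ ≤ ‖f (Gu z + Gs z - z.2)‖ := norm_le_pi_norm _ j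
      _ ≤ ‖f‖ * M := (f.le_opNorm _).trans (by gcongr; exact hM z)
  have hfu : ∀ z, ∀ j : Fin (u + s), u ≤ (j : ℕ) → f (Gu z) j = 0 := fun z => hXu _ (hGum z)
  have hfs : ∀ z, ∀ j : Fin (u + s), (j : ℕ) < u → f (Gs z) j = 0 := fun z => hXs _ (hGsm z)
  have hσ_apply : ∀ j z, σ j z = f (Gu z) j + f (Gs z) j := fun j z => by
    simp only [σ, map_add, Pi.add_apply]
  refine ⟨J, σ, ⟨hJ, X, hJX⟩, hpos, hneg, hσc, hli,
    fun j => ⟨hli.ne_zero j, hJ.exists_koopmanNilpotent hσc hσd j⟩, hσd, fun z => ⟨fun h => ?_,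
    fun h j hj => ?_⟩, fun z => ⟨fun h => ?_, fun h j hj => ?_⟩⟩
  · refine hfinj _ (funext fun j => ?_)
    rcases lt_or_ge (j : ℕ) u with hj | hj
    · have := h j hj
      rwa [hσ_apply, hfs z j hj, add_zero] at this
    · exact hfu z j hj
  · rw [hσ_apply, hfs z j hj, h]; simp
  · refine hfinj _ (funext fun j => ?_)
    rcases lt_or_ge (j : ℕ) u with hj | hj
    · exact hfs z j hj
    · have := h j hj
      rwa [hσ_apply, hfu z j hj, zero_add] at this
  · rw [hσ_apply, hfu z j hj, h]; simp

end Eigenfunctions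

/-! ### Choice of constants and assembly -/

section MainTheorem

theorem ComplProj.symm {E : Type*} [NormedAddCommGroup E] [NormedSpace ℝ E]
    {P Q : Submodule ℝ E} {p q : E →L[ℝ] E} (h : ComplProj p q P Q) : ComplProj q p Q P where
  add_apply z := by rw [add_comm, h.add_apply]
  p_mem := h.q_mem
  q_mem := h.p_mem
  p_eq := h.q_eq
  q_eq := h.p_eq

/-- The factor `2` passes from the sum of the two component norms to their maximum, the norm of the
product. -/
theorem LipschitzPair.norm_sub_le {c n : ℕ} {G : Type*} [NormedAddCommGroup G]
    {f : StateSpace c n → G} {a b δ : ℝ} (hf : LipschitzPair f a b) (ha : a ≤ δ) (hb : b ≤ δ)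
    (z w : StateSpace c n) : ‖f z - f w‖ ≤ 2 * δ * (max ‖z.1 - w.1‖ ‖z.2 - w.2‖) := by
  refine (hf z w).trans ?_
  have h1 : a * ‖z.1 - w.1‖ ≤ δ * ‖z.1 - w.1‖ := by gcongr
  have h2 : b * ‖z.2 - w.2‖ ≤ δ * ‖z.2 - w.2‖ := by gcongr
  rcases le_or_gt 0 δ with hδ | hδ
  · have h3 : δ * ‖z.1 - w.1‖ ≤ δ * (max ‖z.1 - w.1‖ ‖z.2 - w.2‖) := by
      gcongr; exact le_max_left _ _
    have h4 : δ * ‖z.2 - w.2‖ ≤ δ * (max ‖z.1 - w.1‖ ‖z.2 - w.2‖) := by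
      gcongr; exact le_max_right _ _
    linarith
  · have h3 := (norm_nonneg _).trans (hf z w)
    have h5 : δ * ‖z.1 - w.1‖ ≤ 0 := mul_nonpos_of_nonpos_of_nonneg hδ.le (norm_nonneg _)
    have h6 : δ * ‖z.2 - w.2‖ ≤ 0 := mul_nonpos_of_nonpos_of_nonneg hδ.le (norm_nonneg _)
    have h7 : ‖z.1 - w.1‖ = 0 := by nlinarith
    have h8 : ‖z.2 - w.2‖ = 0 := by nlinarith
    simp [h7, h8]

/-- A smallness condition on the Lipschitz constant that suffices for two dichotomies. -/
theorem exists_small {κ₁ κ₂ K₁ K₂ ℓ : ℝ} (h1 : 0 ≤ κ₁) (h2 : 0 ≤ κ₂) (h3 : 0 ≤ K₁)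
    (h4 : 0 ≤ K₂) (hℓ : 0 < ℓ) : ∃ ε, 0 < ε ∧ κ₁ * ε ≤ ℓ ∧ κ₂ * ε ≤ ℓ ∧
      κ₁ * (ε * (2 * K₁)) ≤ ℓ ∧ κ₂ * (ε * (2 * K₂)) ≤ ℓ := by
  set R := 1 + κ₁ + κ₂ + κ₁ * (2 * K₁) + κ₂ * (2 * K₂) with hR
  have e1 : 0 ≤ κ₁ * (2 * K₁) := by positivity
  have e2 : 0 ≤ κ₂ * (2 * K₂) := by positivity
  have hR0 : 0 < R := by positivity
  have key : ∀ x, x ≤ R → x * (ℓ / R) ≤ ℓ := by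
    intro x hx
    rw [mul_div_assoc', div_le_iff₀ hR0, mul_comm]
    gcongr
  refine ⟨ℓ / R, by positivity, key _ (by linarith), key _ (by linarith), ?_, ?_⟩
  · have := key (κ₁ * (2 * K₁)) (by linarith)
    linarith
  · have := key (κ₂ * (2 * K₂)) (by linarith)
    linarith

end MainTheorem

theorem mainTheorem1 (c u s : ℕ)
    (B : Matrix (Fin c) (Fin c) ℝ) (A : Matrix (Fin (u + s)) (Fin (u + s)) ℝ)
    (hB : ∀ μ ∈ complexEigenvalues B, μ.re = 0)
    (hu : (complexEigenvalues A).countP (fun μ => 0 < μ.re) = u)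
    (hs : (complexEigenvalues A).countP (fun μ => μ.re < 0) = s) :
    ∃ δ : ℝ, 0 < δ ∧
      ∀ (g : StateSpace c (u + s) → EuclideanSpace ℝ (Fin c))
        (h : StateSpace c (u + s) → EuclideanSpace ℝ (Fin (u + s)))
        (c₁ c₂ d₁ d₂ : ℝ),
        c₁ ≤ δ → c₂ ≤ δ → d₁ ≤ δ → d₂ ≤ δ →
        LipschitzPair g c₁ c₂ → LipschitzPair h d₁ d₂ →
        (∃ M : ℝ, ∀ z, ‖g z‖ ≤ M) → (∃ M : ℝ, ∀ z, ‖h z‖ ≤ M) →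
        g 0 = 0 → h 0 = 0 →
        (∃ S : ℝ → StateSpace c (u + s) → StateSpace c (u + s),
          IsFlowOf (vectorField B A g h) S) ∧
        ∀ S : ℝ → StateSpace c (u + s) → StateSpace c (u + s),
          IsFlowOf (vectorField B A g h) S →
          ∃ (J : Matrix (Fin (u + s)) (Fin (u + s)) ℂ)
            (σ : Fin (u + s) → StateSpace c (u + s) → ℂ),
            -- the (generalized) eigenfunctions: the first `u` unstable, the last `s` stable
            IsJordanFormOf J A ∧
            (∀ j : Fin (u + s), (j : ℕ) < u → 0 < (J j j).re) ∧
            (∀ j : Fin (u + s), u ≤ (j : ℕ) → (J j j).re < 0) ∧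
            (∀ j, Continuous (σ j)) ∧
            LinearIndependent ℂ σ ∧
            (∀ j, IsGeneralizedKoopmanEigenfunction S (J j j) (σ j)) ∧
            (∀ j z t, HasDerivAt (fun τ => koopman S τ (σ j) z)
              (∑ k, J j k * koopman S t (σ k) z) t) ∧
            -- the joint zero set of the unstable ones is the center-stable manifold
            ({z | ∀ j : Fin (u + s), (j : ℕ) < u → σ j z = 0} = centerStableSet S ∧
              IsUniqueGlobalInvariantManifold S (withCenter c (stableSubspace A))
                (withoutCenter c (unstableSubspace A)) (centerStableSet S)) ∧
            -- the joint zero set of all of them is the center manifold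
            ({z | ∀ j : Fin (u + s), σ j z = 0} = centerSet S ∧
              IsUniqueGlobalInvariantManifold S (withCenter c ⊥)
                (withoutCenter c ⊤) (centerSet S)) ∧
            -- the joint zero set of the stable ones is the center-unstable manifold
            ({z | ∀ j : Fin (u + s), u ≤ (j : ℕ) → σ j z = 0} = centerUnstableSet S ∧
              IsUniqueGlobalInvariantManifold S (withCenter c (unstableSubspace A))
                (withoutCenter c (stableSubspace A)) (centerUnstableSet S)) ∧
            -- tangency to the linear subspaces, if `B` and `A` give the linearization at `0`
            (HasFDerivAt g (0 : StateSpace c (u + s) →L[ℝ] EuclideanSpace ℝ (Fin c)) 0 →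
              HasFDerivAt h (0 : StateSpace c (u + s) →L[ℝ] EuclideanSpace ℝ (Fin (u + s))) 0 →
              IsTangentAtZero (withCenter c (stableSubspace A))
                (withoutCenter c (unstableSubspace A)) (centerStableSet S) ∧
              IsTangentAtZero (withCenter c ⊥) (withoutCenter c ⊤) (centerSet S) ∧
              IsTangentAtZero (withCenter c (unstableSubspace A))
                (withoutCenter c (stableSubspace A)) (centerUnstableSet S)) := by
  have hre := re_ne_zero_of_countP hu hs
  obtain ⟨b, hb, hbA⟩ := exists_pos_lt_abs_re (complexEigenvalues A) hre
  have hcompl : IsCompl (stableSubspace A) (unstableSubspace A) := by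
    refine isCompl_spectralSubspace (fun μ hμ => ?_) (fun μ hμ => ?_)
      (Set.disjoint_left.2 fun μ (h1 : μ.re < 0) (h2 : 0 < μ.re) => lt_asymm h1 h2)
      fun μ hμ => (hre μ hμ).lt_or_gt
    · simpa using hμ
    · simpa using hμ
  obtain ⟨rs, ru, hsu⟩ := exists_complProj hcompl
  have hus := hsu.symm
  set Pc := centerProj c (u + s) with hPc
  set Ps := hyperbolicPart c rs with hPs
  set Pu := hyperbolicPart c ru with hPu
  set L := linearPart B A with hL
  have hD₁ : ∀ a, 0 < a → ∃ K, ExpDichotomy L (Pc + Ps) Pu K a b := by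
    intro a ha
    have := exists_expDichotomy_linearPart hB hsu (θ := 1) (b := b) (by simp)
      (fun μ (hμ : μ.re < 0) _ => by simpa using hμ)
      (fun μ (hμ : 0 < μ.re) h => by simpa [abs_of_pos hμ] using hbA μ h) ha
    rwa [one_smul] at this
  have hD₂ : ∀ a, 0 < a → ∃ K, ExpDichotomy (-L) (Pc + Pu) Ps K a b := by
    intro a ha
    have := exists_expDichotomy_linearPart hB hus (θ := -1) (b := b) (by simp)
      (fun μ (hμ : 0 < μ.re) _ => by simpa using hμ)
      (fun μ (hμ : μ.re < 0) h => by simpa [abs_of_neg hμ] using hbA μ h) ha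
    have h1 : (-1 : ℝ) • linearPart B A = -L :=
      ContinuousLinearMap.ext fun z => neg_one_smul ℝ (linearPart B A z)
    rwa [h1] at this
  obtain ⟨K₁, D₁⟩ := hD₁ (b / 4) (by positivity)
  obtain ⟨K₂, D₂⟩ := hD₂ (b / 4) (by positivity)
  have hK₁ := D₁.nonneg
  have hK₂ := D₂.nonneg
  have hb4 : 0 < 1 / (b / 2 - b / 4) + 1 / (b - b / 2) := by
    have h1 : 0 < b / 2 - b / 4 := by linarith
    have h2 : 0 < b - b / 2 := by linarith
    positivity
  -- The largest slope allowed for the two graphs: it meets both requirements of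
  -- `SlowManifold.inter`, namely `ℓ ≤ 1 / 2` and the contraction bound.
  set ℓ := 1 / (2 * (1 + ‖Ps‖ + ‖Pu‖)) with hℓ
  have hℓ0 : 0 < ℓ := by positivity
  have hℓ1 : ℓ ≤ 1 / 2 := by
    rw [hℓ, div_le_div_iff₀ (by positivity) (by positivity)]
    linarith [norm_nonneg Ps, norm_nonneg Pu]
  have hℓP : ℓ * (‖Ps‖ + ‖Pu‖) ≤ 1 / 2 := by
    rw [hℓ, div_mul_eq_mul_div, div_le_div_iff₀ (by positivity) (by positivity)]
    linarith [norm_nonneg Ps, norm_nonneg Pu]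
  obtain ⟨ε, hε, hκ₁, hκ₂, hℓ₁, hℓ₂⟩ := exists_small
    (mul_nonneg hK₁ hb4.le) (mul_nonneg hK₂ hb4.le) hK₁ hK₂ hℓ0
  -- All constants so far come from `A` and `B` alone; bounds `ε / 2` on the four coefficients make
  -- `N` globally `ε`-Lipschitz.
  refine ⟨ε / 2, by positivity, ?_⟩
  intro g h c₁ c₂ d₁ d₂ hc₁ hc₂ hd₁ hd₂ hg hh hgM hhM hg0 hh0
  obtain ⟨Mg, hMg⟩ := hgM
  obtain ⟨Mh, hMh⟩ := hhM
  set N : StateSpace c (u + s) → StateSpace c (u + s) := fun z => (g z, h z) with hNdef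
  have hF : vectorField B A g h = fun z => L z + N z := rfl
  have hN : ∀ z w, ‖N z - N w‖ ≤ ε * ‖z - w‖ := by
    intro z w
    have e1 := hg.norm_sub_le hc₁ hc₂ z w
    have e2 := hh.norm_sub_le hd₁ hd₂ z w
    rw [mul_div_cancel₀ _ (two_ne_zero)] at e1 e2
    exact max_le e1 e2
  have hN0 : N 0 = 0 := by simp [hNdef, hg0, hh0]
  have hNc := continuous_of_norm_sub_le hN
  have hM : ∀ z, ‖N z‖ ≤ max Mg Mh := fun z => max_le_max (hMg z) (hMh z)
  have hN' : ∀ z w, ‖-N z - -N w‖ ≤ ε * ‖z - w‖ := fun z w => by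
    rw [neg_sub_neg, norm_sub_rev]; exact hN z w
  have hN0' : -N 0 = 0 := by rw [hN0, neg_zero]
  have hM' : ∀ z, ‖-N z‖ ≤ max Mg Mh := fun z => by rw [norm_neg]; exact hM z
  rw [hF]
  refine ⟨exists_isFlowOf L hε.le hN hN0, fun S hS => ?_⟩
  have hS' := hS.reverse_linear_add
  have slow₁ := slowManifold_centerStableSet hb hD₁ D₁ hS hε.le hN hM hN0 (hκ₁.trans hℓ1) hℓ₁
  have slow₂ := (slowManifold_centerStableSet hb hD₂ D₂ hS' hε.le hN' hM' hN0'
    (hκ₂.trans hℓ1) hℓ₂).reverse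
  rw [← centerUnstableSet_eq] at slow₂
  have compl₁ : ComplProj (Pc + Ps) Pu (withCenter c (stableSubspace A))
    (withoutCenter c (unstableSubspace A)) := complProj_withCenter hsu
  have compl₂ : ComplProj (Pc + Pu) Ps (withCenter c (unstableSubspace A))
    (withoutCenter c (stableSubspace A)) := complProj_withCenter hus
  have compl₃ : ComplProj Pc (Ps + Pu)
      (withCenter c (⊥ : Submodule ℝ (EuclideanSpace ℝ (Fin (u + s))))) (withoutCenter c ⊤) := by
    have h1 := complProj_withCenter (c := c) (n := u + s) (Y := ⊥) (Y' := ⊤) (r := 0)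
      (q := ContinuousLinearMap.id ℝ _)
      ⟨by simp, by simp, by simp, fun z hz => by simpa using hz.symm, by simp⟩
    have h2 : centerProj c (u + s) + hyperbolicPart c 0 = Pc :=
      ContinuousLinearMap.ext fun z => Prod.ext (by simp [hPc]) (by simp [hPc])
    have h3 : hyperbolicPart c (ContinuousLinearMap.id ℝ _) = Ps + Pu :=
      ContinuousLinearMap.ext fun z => Prod.ext (by simp [hPs, hPu])
        (by simpa [hPs, hPu] using (hsu.add_apply z.2).symm)
    rwa [h2, h3] at h1
  have hsc : ∀ z, Ps (Pc z) = 0 := fun z => by simp [hPs, hPc]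
  have huc : ∀ z, Pu (Pc z) = 0 := fun z => by simp [hPu, hPc]
  have hsu0 : ∀ z, Ps (Pu z) = 0 := fun z => by
    simp [hPs, hPu, hsu.p_eq_zero (hsu.q_mem z.2)]
  have hus0 : ∀ z, Pu (Ps z) = 0 := fun z => by
    simp [hPs, hPu, hsu.q_eq_zero (hsu.p_mem z.2)]
  have hss : ∀ z, Ps (Ps z) = Ps z := D₂.q_idem
  have huu : ∀ z, Pu (Pu z) = Pu z := D₁.q_idem
  have slow₃ : SlowManifold S Pc (Ps + Pu) (centerSet S) (4 * ℓ) :=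
    slow₁.inter slow₂ D₁.add_apply (fun z => by simp [hPs, hPc])
      (fun z => by simp [hPu, hPc]) hsc hsu0 huc hus0 hℓ0.le hℓ1 hℓP
  set σu := straightened L Pu N S with hσu
  set σs := straightened (-L) Ps (fun z => -N z) (fun t => S (-t)) with hσs
  have hW₁ : centerStableSet S = {z | σu z = 0} := centerStableSet_eq hb hD₁ hS hN hM
  have hW₂ : centerUnstableSet S = {z | σs z = 0} := by
    rw [centerUnstableSet_eq, centerStableSet_eq hb hD₂ hS' hN' hM']
  have hσu_q : ∀ z, Pu (σu z) = σu z := D₁.q_straightened hb hS hNc hM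
  have hσs_q : ∀ z, Ps (σs z) = σs z := D₂.q_straightened hb hS' hNc.neg hM'
  have hσuS : ∀ z t, σu (S t z) = expL L t (σu z) := D₁.straightened_flow hb hS hN hM
  -- Two reversals cancel: the reversed flow at time `-t` is intertwined with `exp ((-t) (-L)) = exp
  -- (t L)`.
  have hσsS : ∀ z t, σs (S t z) = expL L t (σs z) := by
    intro z t
    have h1 := D₂.straightened_flow hb hS' hN' hM' z (-t)
    simpa [expL_neg] using h1
  have hσu0 : ∀ z, (σu z).2 = 0 ↔ σu z = 0 := by
    refine fun z => ⟨fun h1 => ?_, fun h1 => by rw [h1]; rfl⟩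
    rw [← hσu_q, hPu, hyperbolicPart_apply, h1, map_zero]; rfl
  have hσs0 : ∀ z, (σs z).2 = 0 ↔ σs z = 0 := by
    refine fun z => ⟨fun h1 => ?_, fun h1 => by rw [h1]; rfl⟩
    rw [← hσs_q, hPs, hyperbolicPart_apply, h1, map_zero]; rfl
  obtain ⟨J, σ, hJ, hpos, hneg, hσc, hli, heig, hder, hzu, hzs⟩ := exists_eigenfunctions
    (Gu := fun z => (σu z).2) (Gs := fun z => (σs z).2) (S := S)
    (M := K₁ * max Mg Mh * (1 / b) + K₂ * max Mg Mh * (1 / b)) hu hs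
    (continuous_snd.comp (D₁.continuous_straightened hb hS hN hM))
    (continuous_snd.comp (D₂.continuous_straightened hb hS' hN' hM'))
    (fun z => by rw [← hσu_q]; exact hsu.q_mem _) (fun z => by rw [← hσs_q]; exact hsu.p_mem _)
    (fun z t => by rw [hσuS, expL_linearPart]) (fun z t => by rw [hσsS, expL_linearPart])
    (fun z => by
      have e1 := D₁.norm_straightened_sub_le hb hS hNc hM z
      have e2 := D₂.norm_straightened_sub_le hb hS' hNc.neg hM' z
      -- The hyperbolic coordinate splits as `rs z.2 + ru z.2`, so the defect is the sum of the two
      -- bounded defects of the straightenings.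
      have e3 : (σu z).2 + (σs z).2 - z.2 = (σu z - Pu z).2 + (σs z - Ps z).2 := by
        have h1 : ru z.2 = z.2 - rs z.2 := eq_sub_of_add_eq' (hsu.add_apply z.2)
        simp only [Prod.snd_sub, hPu, hPs, hyperbolicPart_apply]
        rw [h1]
        abel
      rw [e3]
      exact (norm_add_le _ _).trans (add_le_add ((norm_snd_le _).trans e1)
        ((norm_snd_le _).trans e2)))
  have hz₁ : ∀ z, (∀ j : Fin (u + s), (j : ℕ) < u → σ j z = 0) ↔ z ∈ centerStableSet S := by
    intro z
    rw [hzu, hσu0, hW₁]; rfl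
  have hz₂ : ∀ z, (∀ j : Fin (u + s), u ≤ (j : ℕ) → σ j z = 0) ↔ z ∈ centerUnstableSet S := by
    intro z
    rw [hzs, hσs0, hW₂]; rfl
  refine ⟨J, σ, hJ, hpos, hneg, hσc, hli, heig, hder,
    ⟨Set.ext hz₁, slow₁.isUniqueGlobalInvariantManifold compl₁⟩,
    ⟨Set.ext fun z => ?_, slow₃.isUniqueGlobalInvariantManifold compl₃⟩,
    ⟨Set.ext hz₂, slow₂.isUniqueGlobalInvariantManifold compl₂⟩, fun hgd hhd => ?_⟩
  · rw [centerSet, Set.mem_inter_iff, ← hz₁, ← hz₂]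
    exact ⟨fun h1 => ⟨fun j _ => h1 j, fun j _ => h1 j⟩,
      fun h1 j => (lt_or_ge (j : ℕ) u).elim (h1.1 j) (h1.2 j)⟩
  · have hNd : HasFDerivAt N (0 : StateSpace c (u + s) →L[ℝ] StateSpace c (u + s)) 0 :=
      hgd.prodMk hhd
    have hNd' : HasFDerivAt (fun z => -N z)
        (0 : StateSpace c (u + s) →L[ℝ] StateSpace c (u + s)) 0 := by
      simpa using hNd.fun_neg
    have flat₁ := flatAtZero_centerStableSet hb hD₁ D₁ hS hε.le hN hM hN0 (hκ₁.trans hℓ1) hNd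
    have flat₂ := flatAtZero_centerStableSet hb hD₂ D₂ hS' hε.le hN' hM' hN0'
      (hκ₂.trans hℓ1) hNd'
    rw [← centerUnstableSet_eq] at flat₂
    exact ⟨slow₁.isTangentAtZero compl₁ flat₁,
      slow₃.isTangentAtZero compl₃
        (flat₁.inter flat₂ slow₃ hsu0 hss hus0 huu),
      slow₂.isTangentAtZero compl₂ flat₂⟩
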